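/- Let $n\ge 0$. For a Borel probability measure $p$ on $\mathbb R^n$ and $t>0$ let $p_t$ be the (smooth, positive) density of $p*\mathcal N(0,t^2I)$. For $T>0$ and $x_T\in\mathbb R^n$, a trajectory of the probability flow ODE of $p$ ending in $x_T$ is a continuous curve $t\mapsto x_t$ on $[0,T]$ with value $x_T$ at $t=T$ and $$\frac{\mathrm d x_t}{\mathrm dt}=-t\,\nabla\log p_t(x_t),\qquad 0<t<T .$$ Let $\Phi_p^T(x_T):=x_0$ be the value of this trajectory at time $0$ (and $\Phi_p^T(x_T):=0$ if there is no trajectory). For Borel probability measures $p,q$ put $$\mathtt{PFD}_T(p,q)=\Big(\mathbb E_{x_T\sim\mathcal N(0,T^2I)}\big\|\Phi^T_p(x_T)-\Phi^T_q(x_T)\big\|_2^2\Big)^{1/2},\qquad \mathtt{PFD}(p,q)=\liminf_{T\to\infty}\mathtt{PFD}_T(p,q)\in[0,\infty]$$ (the limit, whenever it exists), and $$W_2(p,q)=\inf_{\gamma\in\Gamma(p,q)}\Big(\mathbb E_{(x,y)\sim\gamma}\|x-y\|_2^2\Big)^{1/2}\in[0,\infty],$$ where $\Gamma(p,q)$ is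 the set of couplings of $p$ and $q$. Then: 1. For every Borel probability measure $p$ and every $T>0$, a trajectory ending in $x_T$ exists for Lebesgue-almost every $x_T$, and for every $x_T$ there is at most one; so $\Phi_p^T$ is well defined almost everywhere. 2. For all Borel probability measures $p,q$ on $\mathbb R^n$, $W_2(p,q)\le\mathtt{PFD}(p,q)$. 3. If $p=\mathcal N(\mu,\Sigma)$ with $\mu\in\mathbb R^n$ and $\Sigma\in\mathbb R^{n\times n}$ symmetric positive semidefinite, then, with the noise normalized as $x_T=T\varepsilon$, $\lim_{T\to\infty}\Phi_p^T(T\varepsilon)=\mu+\Sigma^{1/2}\varepsilon$ for every $\varepsilon\in\mathbb R^n$. 4. If $p=\mathcal N(\mu_1,\Sigma_1)$ and $q=\mathcal N(\mu_2,\Sigma_2)$ with $\mu_1,\mu_2\in\mathbb R^n$ and $\Sigma_1,\Sigma_2\in\mathbb R^{n\times n}$ symmetric positive semidefinite, then $\mathtt{PFD}_T(p,q)$ converges to $\mathtt{PFD}(p,q)$ as $T\to\infty$, and $$\mathtt{PFD}(p,q)=\Big(\|\mu_1-\mu_2\|_2^2+\big\|\Sigma_1^{1/2}-\Sigma_2^{1/2}\big\|_F^2\Big)^{1/2}.$$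 If moreover $\Sigma_1\Sigma_2=\Sigma_2\Sigma_1$, then $\mathtt{PFD}(p,q)=W_2(p,q)$. -/

import Mathlib

open MeasureTheory ProbabilityTheory Filter Topology
open scoped ENNReal MatrixOrder

noncomputable section

/-- The density `p_t` of the noisy variable `x_t = x_0 + ∫₀ᵗ √(2τ) dw_τ`, `x_0 ∼ p`. The stochastic
integral is an independent `N(0, t² I)` variable, so `p_t` is the convolution of `p` with the
`N(0, t² I)` density. Meaningful for `t > 0`. -/
def noisyDensity {n : ℕ} (p : Measure (EuclideanSpace ℝ (Fin n))) (t : ℝ)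
    (x : EuclideanSpace ℝ (Fin n)) : ℝ :=
  ∫ y, (2 * Real.pi * t ^ 2) ^ (-(n : ℝ) / 2) * Real.exp (-‖x - y‖ ^ 2 / (2 * t ^ 2)) ∂p

/-- The score function `∇ₓ log p_t(x)`. -/
def score {n : ℕ} (p : Measure (EuclideanSpace ℝ (Fin n))) (t : ℝ)
    (x : EuclideanSpace ℝ (Fin n)) : EuclideanSpace ℝ (Fin n) :=
  gradient (fun z => Real.log (noisyDensity p t z)) x

/-- `x` is a trajectory on `[0, T]` of the probability flow ODE `dx_t = - t ∇ log p_t(x_t) dt`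
with terminal value `x_T = xT`: it solves the ODE on `(0, T)` and is continuous on `[0, T]`. -/
structure IsPFTrajectory {n : ℕ} (p : Measure (EuclideanSpace ℝ (Fin n))) (T : ℝ)
    (xT : EuclideanSpace ℝ (Fin n)) (x : ℝ → EuclideanSpace ℝ (Fin n)) : Prop where
  continuousOn : ContinuousOn x (Set.Icc 0 T)
  terminal : x T = xT
  hasDerivAt : ∀ t ∈ Set.Ioo 0 T, HasDerivAt x (-(t • score p t (x t))) t

open Classical in
/-- The noise-to-image map `Φ_p` of the probability flow ODE started at time `T`: it sends `xT` to
the value at time `0` of the trajectory ending in `xT` at time `T` (and to `0` if there is none). -/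
def noiseToImage {n : ℕ} (p : Measure (EuclideanSpace ℝ (Fin n))) (T : ℝ)
    (xT : EuclideanSpace ℝ (Fin n)) : EuclideanSpace ℝ (Fin n) :=
  if h : ∃ x, IsPFTrajectory p T xT x then h.choose 0 else 0

/-- `(E ‖Φ_p(x_T) - Φ_q(x_T)‖²)^{1/2}` with `x_T ∼ N(0, T² I)`, at the finite noise level `T`. -/
def pfdAt {n : ℕ} (p q : Measure (EuclideanSpace ℝ (Fin n))) (T : ℝ) : ℝ≥0∞ :=
  (∫⁻ xT, ‖noiseToImage p T xT - noiseToImage q T xT‖ₑ ^ 2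
    ∂(multivariateGaussian 0 (T ^ 2 • (1 : Matrix (Fin n) (Fin n) ℝ)))) ^ (1 / 2 : ℝ)

/-- The probability flow distance (with the identity as image descriptor): the limit of `pfdAt p q T`
as `T → ∞`. Taking the lower limit makes it defined for all `p` and `q`; it is the limit whenever
that exists. -/
def pfd {n : ℕ} (p q : Measure (EuclideanSpace ℝ (Fin n))) : ℝ≥0∞ :=
  liminf (fun T : ℝ => pfdAt p q T) atTop

/-- The set `Γ(p, q)` of couplings of `p` and `q`. -/
def couplings {n : ℕ} (p q : Measure (EuclideanSpace ℝ (Fin n))) :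
    Set (Measure (EuclideanSpace ℝ (Fin n) × EuclideanSpace ℝ (Fin n))) :=
  {γ | γ.map Prod.fst = p ∧ γ.map Prod.snd = q}

/-- The 2-Wasserstein distance, with values in `[0, ∞]`. -/
def wasserstein2 {n : ℕ} (p q : Measure (EuclideanSpace ℝ (Fin n))) : ℝ≥0∞ :=
  ⨅ γ ∈ couplings p q, (∫⁻ z, ‖z.1 - z.2‖ₑ ^ 2 ∂γ) ^ (1 / 2 : ℝ)

/-- The Frobenius norm of a real square matrix. -/
def frobeniusNorm {n : ℕ} (A : Matrix (Fin n) (Fin n) ℝ) : ℝ :=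
  letI : NormedAddCommGroup (Matrix (Fin n) (Fin n) ℝ) := Matrix.frobeniusNormedAddCommGroup
  ‖A‖

end

/-! Write `X_t = Y + t Z` with `Y ∼ p` and `Z` an independent standard Gaussian. By Tweedie's
formula (`neg_smul_score`) the right-hand side of the ODE is the conditional mean `v_t(x) = E[Z |
X_t = x]`, a quotient of two Gaussian integrals against `p`. Some ball carries half of the mass of
`p`, which bounds the denominator below; hence for every `p` the field is locally Lipschitz with
linear growth on `(0, ∞)` (`isTameField_flowVelocity`), and it has a unique global flow there.

The flow carries the law of `X_s` to that of `X_t` (`map_fieldFlow_noised`). For a test function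
`f`, let `u_s` be `f` composed with the flow from `s` to `t`; the derivative of `E u_s(X_s)` in `s`
is `E Du_s(X_s)(Z - v_s(X_s))`, and this vanishes because `v_s(X_s)` is the conditional mean of `Z`.
Since also `E ‖v_t(X_t)‖ ≤ E ‖Z‖` for all `t`, Tonelli shows that almost every flow line has
integrable velocity on `(0, T)` and so extends to time `0`. Letting the time tend to `0`, `Φ_p^T`
pushes the law of `X_T` to `p` (`map_noiseToImage`).

For the lower bound, `N(0, T² I)` and the law of `X_T` approach each other in total variation
(`tendsto_noiseGap`). So under `x_T ∼ N(0, T² I)` the joint law of `(Φ_p^T(x_T), Φ_q^T(x_T))` has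
marginals converging weakly to `p` and `q`. By tightness it has a weak limit along a sequence, a
coupling of `p` and `q`, and the quadratic cost is lower semicontinuous.

For a Gaussian the velocity is affine and diagonal in an eigenbasis of `Σ^{1/2}`: coordinates of
`x_t - μ` scale like `√(α² + t²)`, where `α` is the eigenvalue. The limit `μ + Σ^{1/2} ε` and, by
dominated convergence, the closed form follow. If the covariances commute, a common eigenbasis
reduces the bound `PFD ≤ W₂` to the one-dimensional fact that the standard deviation of `X - Y` is
at least the difference of those of `X` and `Y`. -/

set_option linter.unusedSectionVars false

/-! ### Grönwall estimates. -/

section Gronwall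

variable {E : Type*} [NormedAddCommGroup E] [NormedSpace ℝ E]

/-- Grönwall's inequality in both time directions. -/
lemma norm_le_gronwallBound_of_mem_uIcc {f f' : ℝ → E} {K ε s t : ℝ}
    (hf : ∀ r ∈ Set.uIcc s t, HasDerivAt f (f' r) r)
    (hb : ∀ r ∈ Set.uIcc s t, ‖f' r‖ ≤ K * ‖f r‖ + ε) :
    ‖f t‖ ≤ gronwallBound ‖f s‖ K ε |t - s| := by
  rcases le_total s t with h | h
  · rw [Set.uIcc_of_le h] at hf hb
    rw [abs_of_nonneg (sub_nonneg.2 h)]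
    exact norm_le_gronwallBound_of_norm_deriv_right_le
      (fun r hr => (hf r hr).continuousAt.continuousWithinAt)
      (fun r hr => (hf r ⟨hr.1, hr.2.le⟩).hasDerivWithinAt) le_rfl
      (fun r hr => hb r ⟨hr.1, hr.2.le⟩) t ⟨h, le_rfl⟩
  · rw [Set.uIcc_of_ge h] at hf hb
    have key := norm_le_gronwallBound_of_norm_deriv_right_le (f := fun r => f (-r))
      (f' := fun r => -f' (-r)) (δ := ‖f s‖) (K := K) (ε := ε) (a := -s) (b := -t)
      (fun r hr => by
        have := (hf (-r) ⟨by linarith [hr.2], by linarith [hr.1]⟩).scomp r (hasDerivAt_neg r)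
        exact this.continuousAt.continuousWithinAt)
      (fun r hr => by
        have := (hf (-r) ⟨by linarith [hr.2], by linarith [hr.1]⟩).scomp r (hasDerivAt_neg r)
        simpa [Function.comp_def] using this.hasDerivWithinAt)
      (by simp) (fun r hr => by
        simpa using hb (-r) ⟨by linarith [hr.2], by linarith [hr.1]⟩)
      (-t) ⟨by linarith, le_rfl⟩
    rw [abs_of_nonpos (by linarith)]
    simpa [neg_sub, sub_eq_add_neg, add_comm] using key

lemma norm_le_of_linear_growth {f f' : ℝ → E} {C s t : ℝ} (hC : 0 < C)
    (hf : ∀ r ∈ Set.uIcc s t, HasDerivAt f (f' r) r)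
    (hb : ∀ r ∈ Set.uIcc s t, ‖f' r‖ ≤ C * (1 + ‖f r‖)) :
    ‖f t‖ ≤ (1 + ‖f s‖) * Real.exp (C * |t - s|) := by
  have h := norm_le_gronwallBound_of_mem_uIcc (K := C) (ε := C) hf
    (fun r hr => (hb r hr).trans (by linarith))
  rw [gronwallBound_of_K_ne_0 hC.ne', div_self hC.ne'] at h
  linarith [Real.exp_pos (C * |t - s|)]

end Gronwall

/-! ### Truncation by a radial retraction. -/

section RadialRetraction

variable {E : Type*} [NormedAddCommGroup E] [NormedSpace ℝ E]

/-- The radial retraction onto the closed ball of radius `R`. -/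
noncomputable def radialRetraction (R : ℝ) (x : E) : E := (R / max R ‖x‖) • x

lemma radialRetraction_of_norm_le {R : ℝ} (hR : 0 < R) {x : E} (hx : ‖x‖ ≤ R) :
    radialRetraction R x = x := by
  rw [radialRetraction, max_eq_left hx, div_self hR.ne', one_smul]

lemma norm_radialRetraction_le {R : ℝ} (hR : 0 < R) (x : E) : ‖radialRetraction R x‖ ≤ R := by
  have hm : 0 < max R ‖x‖ := lt_max_of_lt_left hR
  rw [radialRetraction, norm_smul, Real.norm_of_nonneg (by positivity), div_mul_eq_mul_div,
    div_le_iff₀ hm]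
  exact mul_le_mul_of_nonneg_left (le_max_right _ _) hR.le

lemma norm_radialRetraction_le_norm {R : ℝ} (hR : 0 < R) (x : E) :
    ‖radialRetraction R x‖ ≤ ‖x‖ := by
  have hm : 0 < max R ‖x‖ := lt_max_of_lt_left hR
  rw [radialRetraction, norm_smul, Real.norm_of_nonneg (by positivity)]
  exact mul_le_of_le_one_left (norm_nonneg _) ((div_le_one hm).2 (le_max_left _ _))

/-- One `‖x - y‖` comes from moving the point, a second from the change of the scaling factor. No
inner product is used. -/
lemma lipschitzWith_radialRetraction {R : ℝ} (hR : 0 < R) :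
    LipschitzWith 2 (radialRetraction R : E → E) := by
  refine LipschitzWith.of_dist_le_mul fun x y => ?_
  have hx : 0 < max R ‖x‖ := lt_max_of_lt_left hR
  have hy : 0 < max R ‖y‖ := lt_max_of_lt_left hR
  have hdec : radialRetraction R x - radialRetraction R y
      = (R / max R ‖x‖) • (x - y) + (R / max R ‖x‖ - R / max R ‖y‖) • y := by
    simp only [radialRetraction]; module
  have h1 : R / max R ‖x‖ ≤ 1 := (div_le_one hx).2 (le_max_left _ _)
  have h2 : |max R ‖y‖ - max R ‖x‖| ≤ ‖x - y‖ :=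
    calc |max R ‖y‖ - max R ‖x‖| ≤ |‖y‖ - ‖x‖| := by
          simpa [max_comm] using abs_max_sub_max_le_abs ‖y‖ ‖x‖ R
      _ ≤ ‖y - x‖ := abs_norm_sub_norm_le _ _
      _ = _ := norm_sub_rev _ _
  have h3 : |R / max R ‖x‖ - R / max R ‖y‖| * ‖y‖ ≤ ‖x - y‖ := by
    have : R / max R ‖x‖ - R / max R ‖y‖
        = (R / max R ‖x‖) * ((max R ‖y‖ - max R ‖x‖) / max R ‖y‖) := by field_simp
    rw [this, abs_mul, abs_of_nonneg (by positivity : 0 ≤ R / max R ‖x‖), abs_div,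
      abs_of_pos hy]
    calc R / max R ‖x‖ * (|max R ‖y‖ - max R ‖x‖| / max R ‖y‖) * ‖y‖
        = (R / max R ‖x‖) * |max R ‖y‖ - max R ‖x‖| * (‖y‖ / max R ‖y‖) := by ring
      _ ≤ 1 * ‖x - y‖ * 1 := by
          gcongr
          exact (div_le_one hy).2 (le_max_right _ _)
      _ = _ := by ring
  rw [dist_eq_norm, dist_eq_norm, hdec]
  refine (norm_add_le _ _).trans ?_
  rw [norm_smul, norm_smul, Real.norm_eq_abs, Real.norm_eq_abs,
    abs_of_nonneg (by positivity : 0 ≤ R / max R ‖x‖)]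
  have : R / max R ‖x‖ * ‖x - y‖ ≤ ‖x - y‖ := mul_le_of_le_one_left (norm_nonneg _) h1
  push_cast
  linarith

end RadialRetraction

/-! ### Existence, uniqueness and continuity of flows on positive times. -/

/-- A time-dependent vector field on `(0, ∞) × E`, continuous in time, locally Lipschitz in space
and of at most linear growth in space, both locally uniformly in time. -/
structure IsTameField {E : Type*} [NormedAddCommGroup E] (V : ℝ → E → E) : Prop where
  continuousOn : ∀ x, ContinuousOn (fun t => V t x) (Set.Ioi 0)
  lipschitz : ∀ a b R : ℝ, 0 < a → ∃ K : NNReal, ∀ t ∈ Set.Icc a b,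
    LipschitzOnWith K (V t) (Metric.closedBall 0 R)
  growth : ∀ a b : ℝ, 0 < a → ∃ C : ℝ, 0 < C ∧ ∀ t ∈ Set.Icc a b, ∀ x,
    ‖V t x‖ ≤ C * (1 + ‖x‖)

namespace IsTameField

variable {E : Type*} [NormedAddCommGroup E] [NormedSpace ℝ E] {V : ℝ → E → E}

/-- The truncation of a tame field outside a ball is tame. -/
lemma truncate (hV : IsTameField V) {R : ℝ} (hR : 0 < R) :
    IsTameField (fun t x => V t (radialRetraction R x)) where
  continuousOn x := hV.continuousOn _
  lipschitz a b R' ha := by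
    obtain ⟨K, hK⟩ := hV.lipschitz a b R ha
    exact ⟨K * 2, fun t ht => (hK t ht).comp (lipschitzWith_radialRetraction hR).lipschitzOnWith
      fun x _ => by simpa using norm_radialRetraction_le hR x⟩
  growth a b ha := by
    obtain ⟨C, hC, h⟩ := hV.growth a b ha
    exact ⟨C, hC, fun t ht x => (h t ht _).trans (by
      gcongr; exact norm_radialRetraction_le_norm hR x)⟩

/-- Truncation turns the local bounds into global ones, as needed for Picard–Lindelöf and for
differentiating under the expectation. -/
lemma truncate_bounded (hV : IsTameField V) {a b R : ℝ} (ha : 0 < a) (hR : 0 < R) :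
    ∃ K B : NNReal, ∀ t ∈ Set.Icc a b, LipschitzWith K (fun x => V t (radialRetraction R x)) ∧
      ∀ x, ‖V t (radialRetraction R x)‖ ≤ B := by
  obtain ⟨K, hK⟩ := hV.lipschitz a b R ha
  obtain ⟨C, hC, h⟩ := hV.growth a b ha
  refine ⟨K * 2, (C * (1 + R)).toNNReal, fun t ht => ⟨?_, fun x => ?_⟩⟩
  · rw [← lipschitzOnWith_univ]
    exact (hK t ht).comp (lipschitzWith_radialRetraction hR).lipschitzOnWith
      fun x _ => by simpa using norm_radialRetraction_le hR x
  · rw [Real.coe_toNNReal _ (by positivity)]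
    exact (h t ht _).trans (by gcongr; exact norm_radialRetraction_le hR x)

/-- Two solutions are at exponentially controlled distance, as long as they stay in a ball. -/
lemma dist_le {K : NNReal} {s t : ℝ} {S : Set E} {γ₁ γ₂ : ℝ → E}
    (hK : ∀ r ∈ Set.uIcc s t, LipschitzOnWith K (V r) S)
    (h₁ : ∀ r ∈ Set.uIcc s t, HasDerivAt γ₁ (V r (γ₁ r)) r) (hS₁ : ∀ r ∈ Set.uIcc s t, γ₁ r ∈ S)
    (h₂ : ∀ r ∈ Set.uIcc s t, HasDerivAt γ₂ (V r (γ₂ r)) r)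
    (hS₂ : ∀ r ∈ Set.uIcc s t, γ₂ r ∈ S) :
    dist (γ₁ t) (γ₂ t) ≤ dist (γ₁ s) (γ₂ s) * Real.exp (K * |t - s|) := by
  have := norm_le_gronwallBound_of_mem_uIcc (f := fun r => γ₁ r - γ₂ r)
    (f' := fun r => V r (γ₁ r) - V r (γ₂ r)) (K := K) (ε := 0) (s := s) (t := t)
    (fun r hr => (h₁ r hr).sub (h₂ r hr))
    (fun r hr => by
      have := (hK r hr).dist_le_mul _ (hS₁ r hr) _ (hS₂ r hr)
      simpa [dist_eq_norm] using this)
  rw [gronwallBound_ε0] at this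
  simpa [dist_eq_norm] using this

/-- Between `s` and `t` both curves stay in a ball, on which the field is Lipschitz. The case `a =
0` is allowed because only interior times are compared. -/
lemma eqOn_Ioo (hV : IsTameField V) {a b s : ℝ} (ha : 0 ≤ a) (hs : s ∈ Set.Ioo a b)
    {γ₁ γ₂ : ℝ → E}
    (h₁ : ∀ r ∈ Set.Ioo a b, HasDerivAt γ₁ (V r (γ₁ r)) r)
    (h₂ : ∀ r ∈ Set.Ioo a b, HasDerivAt γ₂ (V r (γ₂ r)) r) (h : γ₁ s = γ₂ s) :
    Set.EqOn γ₁ γ₂ (Set.Ioo a b) := by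
  intro t ht
  have hsub : Set.uIcc s t ⊆ Set.Ioo a b := (Set.ordConnected_Ioo).uIcc_subset hs ht
  have hc : ∀ γ : ℝ → E, (∀ r ∈ Set.Ioo a b, HasDerivAt γ (V r (γ r)) r) →
      ∃ R, ∀ r ∈ Set.uIcc s t, ‖γ r‖ ≤ R := fun γ hγ => by
    obtain ⟨R, hR⟩ := (isCompact_uIcc (a := s) (b := t)).exists_bound_of_continuousOn (f := γ)
      fun r hr => (hγ r (hsub hr)).continuousAt.continuousWithinAt
    exact ⟨R, hR⟩
  obtain ⟨R₁, hR₁⟩ := hc γ₁ h₁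
  obtain ⟨R₂, hR₂⟩ := hc γ₂ h₂
  obtain ⟨K, hK⟩ := hV.lipschitz (min s t) (max s t) (max R₁ R₂)
    (lt_min (ha.trans_lt hs.1) (ha.trans_lt ht.1))
  have := dist_le (V := V) (K := K) (s := s) (t := t) (S := Metric.closedBall 0 (max R₁ R₂)) hK
    (fun r hr => h₁ r (hsub hr)) (fun r hr => by simp [hR₁ r hr])
    (fun r hr => h₂ r (hsub hr)) (fun r hr => by simp [hR₂ r hr])
  rw [h, dist_self, zero_mul] at this
  exact dist_le_zero.1 this

variable [CompleteSpace E]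

lemma exists_solution_Ioo (hV : IsTameField V) {a b s : ℝ} (ha : 0 < a) (hs : s ∈ Set.Ioo a b)
    (x : E) : ∃ γ : ℝ → E, γ s = x ∧ ∀ t ∈ Set.Ioo a b, HasDerivAt γ (V t (γ t)) t := by
  obtain ⟨C, hC, hg⟩ := hV.growth a b ha
  -- `R` is the a priori bound given by linear growth, which the truncated field shares; so its
  -- solution never feels the truncation.
  set R := (1 + ‖x‖) * Real.exp (C * (b - a)) with hRdef
  have hR : 0 < R := by positivity
  obtain ⟨K, B, hKB⟩ := hV.truncate_bounded (a := a) (b := b) ha hR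
  -- The truncated field is bounded by `B` everywhere, so the ball of radius `B (b - a)` is large
  -- enough for Picard–Lindelöf on all of `[a, b]` at once.
  have hpl : IsPicardLindelof (fun t x => V t (radialRetraction R x))
      (⟨s, hs.1.le, hs.2.le⟩ : Set.Icc a b) x (B * (b - a).toNNReal) 0 B K := by
    refine ⟨fun t ht => (hKB t ht).1.lipschitzOnWith, fun y _ => ?_, fun t ht y _ => (hKB t ht).2 y,
      ?_⟩
    · exact (hV.continuousOn _).mono fun t ht => ha.trans_le ht.1
    · have : max (b - s) (s - a) ≤ b - a := max_le (by linarith [hs.1]) (by linarith [hs.2])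
      push_cast
      rw [Real.coe_toNNReal _ (by linarith [hs.1, hs.2])]
      simpa using mul_le_mul_of_nonneg_left this B.2
  obtain ⟨γ, hγs, hγ⟩ := hpl.exists_eq_forall_mem_Icc_hasDerivWithinAt₀
  have hγ' : ∀ t ∈ Set.Ioo a b, HasDerivAt γ (V t (radialRetraction R (γ t))) t := fun t ht =>
    (hγ t ⟨ht.1.le, ht.2.le⟩).hasDerivAt (Icc_mem_nhds ht.1 ht.2)
  refine ⟨γ, hγs, fun t ht => ?_⟩
  have hsub : Set.uIcc s t ⊆ Set.Ioo a b := (Set.ordConnected_Ioo).uIcc_subset hs ht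
  have hle : ‖γ t‖ ≤ R := by
    refine (norm_le_of_linear_growth hC (fun r hr => hγ' r (hsub hr)) fun r hr => ?_).trans ?_
    · refine (hg r ⟨(hsub hr).1.le, (hsub hr).2.le⟩ _).trans ?_
      gcongr
      exact norm_radialRetraction_le_norm hR _
    · rw [hγs, hRdef]
      gcongr
      exact abs_le.2 ⟨by linarith [hs.2, ht.1], by linarith [hs.1, ht.2]⟩
  simpa [radialRetraction_of_norm_le hR hle] using hγ' t ht

/-- Global existence. -/
lemma exists_solution (hV : IsTameField V) {s : ℝ} (hs : 0 < s) (x : E) :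
    ∃ γ : ℝ → E, γ s = x ∧ ∀ t, 0 < t → HasDerivAt γ (V t (γ t)) t := by
  -- An exhaustion of `(0, ∞)`; the shift by 2 keeps `s` in the interior already for `k = 0`.
  let I : ℕ → Set ℝ := fun k => Set.Ioo (s / (k + 2)) (s * (k + 2))
  have hI0 : ∀ k : ℕ, 0 < s / (k + 2) := fun k => by positivity
  have hsI : ∀ k, s ∈ I k := fun k =>
    ⟨div_lt_self hs (by linarith [(Nat.cast_nonneg k : (0 : ℝ) ≤ k)]),
      lt_mul_of_one_lt_right hs (by linarith [(Nat.cast_nonneg k : (0 : ℝ) ≤ k)])⟩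
  have hmono : ∀ j k, j ≤ k → I j ⊆ I k := fun j k hjk => by
    have : (j : ℝ) ≤ k := Nat.cast_le.2 hjk
    exact Set.Ioo_subset_Ioo (by gcongr) (by gcongr)
  have hcov : ∀ t, 0 < t → ∃ k, t ∈ I k := fun t ht => by
    obtain ⟨k, hk⟩ := exists_nat_gt (max (s / t) (t / s))
    refine ⟨k, ?_, ?_⟩
    · rw [div_lt_iff₀ (by positivity)]
      have := (div_lt_iff₀ ht).1 ((le_max_left _ _).trans_lt hk)
      nlinarith
    · have := (div_lt_iff₀ hs).1 ((le_max_right _ _).trans_lt hk)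
      nlinarith
  choose γ hγs hγ using fun k => hV.exists_solution_Ioo (hI0 k) (hsI k) x
  have hagree : ∀ j k, j ≤ k → Set.EqOn (γ j) (γ k) (I j) := fun j k hjk =>
    hV.eqOn_Ioo (hI0 j).le (hsI j) (hγ j) (fun r hr => hγ k r (hmono j k hjk hr))
      ((hγs j).trans (hγs k).symm)
  classical
  choose! κ hκ using hcov
  have heq : ∀ k, Set.EqOn (fun t => γ (κ t) t) (γ k) (I k) := fun k t ht => by
    have h0 : 0 < t := (hI0 k).trans ht.1
    rcases le_total (κ t) k with h | h
    · exact hagree _ _ h (hκ t h0)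
    · exact (hagree _ _ h ht).symm
  refine ⟨fun t => γ (κ t) t, hγs _, fun t ht => ?_⟩
  have hn : I (κ t) ∈ 𝓝 t := Ioo_mem_nhds (hκ t ht).1 (hκ t ht).2
  exact (hγ (κ t) t (hκ t ht)).congr_of_eventuallyEq
    (Filter.eventuallyEq_of_mem hn (heq (κ t)))

open Classical in
/-- The flow of a tame field: the value at time `t` of the solution through `x` at time `s`. -/
noncomputable def _root_.fieldFlow (V : ℝ → E → E) (s t : ℝ) (x : E) : E :=
  if h : ∃ γ : ℝ → E, γ s = x ∧ ∀ t, 0 < t → HasDerivAt γ (V t (γ t)) t then h.choose t else x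

lemma fieldFlow_self (hV : IsTameField V) {s : ℝ} (hs : 0 < s) (x : E) :
    fieldFlow V s s x = x := by
  have h := hV.exists_solution hs x
  rw [fieldFlow, dif_pos h]
  exact h.choose_spec.1

lemma hasDerivAt_fieldFlow (hV : IsTameField V) {s : ℝ} (hs : 0 < s) (x : E) {t : ℝ}
    (ht : 0 < t) :
    HasDerivAt (fun r => fieldFlow V s r x) (V t (fieldFlow V s t x)) t := by
  have h := hV.exists_solution hs x
  have : (fun r => fieldFlow V s r x) = h.choose := by
    funext r; rw [fieldFlow, dif_pos h]
  rw [this, fieldFlow, dif_pos h]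
  exact h.choose_spec.2 t ht

/-- A solution on an interval coincides with the flow. -/
lemma eqOn_fieldFlow (hV : IsTameField V) {a b s : ℝ} (ha : 0 ≤ a) (hs : s ∈ Set.Ioo a b)
    {γ : ℝ → E} (h : ∀ r ∈ Set.Ioo a b, HasDerivAt γ (V r (γ r)) r) :
    Set.EqOn γ (fun r => fieldFlow V s r (γ s)) (Set.Ioo a b) :=
  hV.eqOn_Ioo ha hs h (fun _ hr => hV.hasDerivAt_fieldFlow (ha.trans_lt hs.1) _ (ha.trans_lt hr.1))
    (hV.fieldFlow_self (ha.trans_lt hs.1) _).symm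

lemma fieldFlow_fieldFlow (hV : IsTameField V) {s t u : ℝ} (hs : 0 < s) (ht : 0 < t) (hu : 0 < u)
    (x : E) : fieldFlow V t u (fieldFlow V s t x) = fieldFlow V s u x :=
  (hV.eqOn_fieldFlow (a := 0) (b := max t u + 1) (s := t) le_rfl
    ⟨ht, by linarith [le_max_left t u]⟩ (fun r hr => hV.hasDerivAt_fieldFlow hs x hr.1)
    ⟨hu, by linarith [le_max_right t u]⟩).symm

lemma norm_fieldFlow_le_of_growth (hV : IsTameField V) {a b C : ℝ} (ha : 0 < a) (hC : 0 < C)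
    (hg : ∀ t ∈ Set.Icc a b, ∀ x, ‖V t x‖ ≤ C * (1 + ‖x‖)) {s t : ℝ} (hs : s ∈ Set.Icc a b)
    (ht : t ∈ Set.Icc a b) (x : E) :
    ‖fieldFlow V s t x‖ ≤ Real.exp (C * (b - a)) * (1 + ‖x‖) := by
  have hsub : Set.uIcc s t ⊆ Set.Icc a b := (Set.ordConnected_Icc).uIcc_subset hs ht
  have := norm_le_of_linear_growth hC (f := fun r => fieldFlow V s r x)
    (fun r hr => hV.hasDerivAt_fieldFlow (ha.trans_le hs.1) x (ha.trans_le (hsub hr).1))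
    (fun _ hr => hg _ (hsub hr) _)
  rw [hV.fieldFlow_self (ha.trans_le hs.1)] at this
  refine this.trans ?_
  rw [mul_comm]
  gcongr
  exact abs_le.2 ⟨by linarith [hs.2, ht.1], by linarith [hs.1, ht.2]⟩

lemma norm_fieldFlow_le (hV : IsTameField V) {a b : ℝ} (ha : 0 < a) : ∃ C : ℝ, 0 < C ∧
    ∀ s ∈ Set.Icc a b, ∀ t ∈ Set.Icc a b, ∀ x, ‖fieldFlow V s t x‖ ≤ C * (1 + ‖x‖) := by
  obtain ⟨C, hC, hg⟩ := hV.growth a b ha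
  exact ⟨Real.exp (C * (b - a)), by positivity, fun s hs t ht x =>
    hV.norm_fieldFlow_le_of_growth ha hC hg hs ht x⟩

/-- Orbits from the unit ball around `x` stay in one common ball between `s` and `t`, so Grönwall
gives a Lipschitz bound near `x`. -/
lemma continuous_fieldFlow (hV : IsTameField V) {s t : ℝ} (hs : 0 < s) (ht : 0 < t) :
    Continuous (fieldFlow V s t) := by
  rw [continuous_iff_continuousAt]
  intro x
  have ha : 0 < min s t := lt_min hs ht
  obtain ⟨C, hC, hb⟩ := hV.norm_fieldFlow_le (a := min s t) (b := max s t) ha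
  obtain ⟨K, hK⟩ := hV.lipschitz (min s t) (max s t) (C * (1 + (‖x‖ + 1))) ha
  have hsm : s ∈ Set.Icc (min s t) (max s t) := ⟨min_le_left _ _, le_max_left _ _⟩
  have hmem : ∀ y ∈ Metric.closedBall x 1, ∀ r ∈ Set.uIcc s t,
      fieldFlow V s r y ∈ Metric.closedBall 0 (C * (1 + (‖x‖ + 1))) := fun y hy r hr => by
    have h1 : ‖y‖ ≤ ‖x‖ + 1 := by
      have := norm_le_norm_add_norm_sub x y
      rw [Metric.mem_closedBall, dist_eq_norm] at hy
      rw [norm_sub_rev] at hy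
      linarith
    rw [mem_closedBall_zero_iff]
    exact (hb s hsm r hr y).trans (by gcongr)
  have hl : LipschitzOnWith (Real.exp (K * |t - s|)).toNNReal (fieldFlow V s t)
      (Metric.closedBall x 1) := by
    refine LipschitzOnWith.of_dist_le_mul fun y hy z hz => ?_
    have := dist_le (V := V) (γ₁ := fun r => fieldFlow V s r y)
      (γ₂ := fun r => fieldFlow V s r z) (s := s) (t := t) hK
      (fun r hr => hV.hasDerivAt_fieldFlow hs y (ha.trans_le hr.1)) (hmem y hy)
      (fun r hr => hV.hasDerivAt_fieldFlow hs z (ha.trans_le hr.1)) (hmem z hz)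
    rw [Real.coe_toNNReal _ (Real.exp_pos _).le, mul_comm]
    simpa [hV.fieldFlow_self hs] using this
  exact hl.continuousOn.continuousAt (Metric.closedBall_mem_nhds x one_pos)

end IsTameField

/-! ### Bounds on the Gaussian kernel. -/

section Kernel

variable {E : Type*} [NormedAddCommGroup E] [InnerProductSpace ℝ E]

/-- The unnormalised standard Gaussian density. -/
noncomputable def gaussWeight (w : E) : ℝ := Real.exp (-‖w‖ ^ 2 / 2)

lemma gaussWeight_pos (w : E) : 0 < gaussWeight w := Real.exp_pos _

lemma gaussWeight_le_one (w : E) : gaussWeight w ≤ 1 :=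
  Real.exp_le_one_iff.2 (by nlinarith [sq_nonneg ‖w‖])

@[fun_prop]
lemma continuous_gaussWeight : Continuous (gaussWeight : E → ℝ) := by
  unfold gaussWeight; fun_prop

/-- From `1 + u ≤ exp u` with `u = ‖w‖² / 2`. The Lipschitz constants 1 and 2 below come from it. -/
lemma gaussWeight_mul_le (w : E) : gaussWeight w * (1 + ‖w‖ ^ 2) ≤ 2 := by
  have h : 1 + ‖w‖ ^ 2 / 2 ≤ Real.exp (‖w‖ ^ 2 / 2) := by
    linarith [Real.add_one_le_exp (‖w‖ ^ 2 / 2)]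
  have h2 : gaussWeight w * Real.exp (‖w‖ ^ 2 / 2) = 1 := by
    rw [gaussWeight, ← Real.exp_add]; ring_nf; exact Real.exp_zero
  nlinarith [gaussWeight_pos w]

lemma gaussWeight_mul_norm_le (w : E) : gaussWeight w * ‖w‖ ≤ 1 := by
  nlinarith [gaussWeight_mul_le w, gaussWeight_pos w, sq_nonneg (‖w‖ - 1)]

lemma hasFDerivAt_gaussWeight (w : E) :
    HasFDerivAt gaussWeight (-(gaussWeight w) • innerSL ℝ w) w := by
  have h := ((hasStrictFDerivAt_norm_sq w).hasFDerivAt.const_mul (-1 / 2 : ℝ)).exp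
  have e : (fun x : E => Real.exp (-1 / 2 * ‖x‖ ^ 2)) = gaussWeight := by
    funext x; rw [gaussWeight]; ring_nf
  have e' : Real.exp (-1 / 2 * ‖w‖ ^ 2) = gaussWeight w := congrFun e w
  rw [e, e'] at h
  convert h using 1
  ext v
  simp
  ring

lemma lipschitzWith_gaussWeight : LipschitzWith 1 (gaussWeight : E → ℝ) := by
  refine lipschitzWith_of_nnnorm_fderiv_le (𝕜 := ℝ)
    (fun w => (hasFDerivAt_gaussWeight w).differentiableAt) fun w => ?_
  rw [(hasFDerivAt_gaussWeight w).fderiv, ← NNReal.coe_le_coe, coe_nnnorm, norm_smul, norm_neg,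
    innerSL_apply_norm, Real.norm_of_nonneg (gaussWeight_pos w).le]
  exact gaussWeight_mul_norm_le w

lemma hasFDerivAt_gaussWeight_smul (w : E) : HasFDerivAt (fun w : E => gaussWeight w • w)
    (gaussWeight w • ContinuousLinearMap.id ℝ E
      + (-(gaussWeight w) • innerSL ℝ w).smulRight w) w :=
  (hasFDerivAt_gaussWeight w).smul (hasFDerivAt_id w)

lemma lipschitzWith_gaussWeight_smul : LipschitzWith 2 (fun w : E => gaussWeight w • w) := by
  refine lipschitzWith_of_nnnorm_fderiv_le (𝕜 := ℝ)
    (fun w => (hasFDerivAt_gaussWeight_smul w).differentiableAt) fun w => ?_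
  rw [(hasFDerivAt_gaussWeight_smul w).fderiv, ← NNReal.coe_le_coe, coe_nnnorm]
  refine (norm_add_le _ _).trans ?_
  rw [norm_smul, ContinuousLinearMap.norm_smulRight_apply, norm_smul, norm_neg,
    innerSL_apply_norm, Real.norm_of_nonneg (gaussWeight_pos w).le]
  have := ContinuousLinearMap.norm_id_le (𝕜 := ℝ) (E := E)
  have h := gaussWeight_mul_le w
  have h1 : gaussWeight w * ‖ContinuousLinearMap.id ℝ E‖ ≤ gaussWeight w * 1 :=
    mul_le_mul_of_nonneg_left this (gaussWeight_pos w).le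
  push_cast
  nlinarith

lemma norm_gaussWeight_smul_le (w : E) : ‖gaussWeight w • w‖ ≤ 1 := by
  rw [norm_smul, Real.norm_of_nonneg (gaussWeight_pos w).le]
  exact gaussWeight_mul_norm_le w

/-- Beyond `A ≥ 1` the function `r ↦ r exp (-r² / 2)` is decreasing. -/
lemma norm_gaussWeight_smul_le_add (w : E) {A : ℝ} (hA : 1 ≤ A) :
    ‖gaussWeight w • w‖ ≤ A * gaussWeight w + A * Real.exp (-A ^ 2 / 2) := by
  rw [norm_smul, Real.norm_of_nonneg (gaussWeight_pos w).le]
  have hg := gaussWeight_pos w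
  have he := Real.exp_pos (-A ^ 2 / 2)
  rcases le_total ‖w‖ A with h | h
  · nlinarith
  · suffices gaussWeight w * ‖w‖ ≤ A * Real.exp (-A ^ 2 / 2) by nlinarith
    have h1 : ‖w‖ / A ≤ Real.exp (‖w‖ / A - 1) := by
      linarith [Real.add_one_le_exp (‖w‖ / A - 1)]
    have hA0 : 0 < A := by linarith
    -- With `r = ‖w‖ ≥ A ≥ 1`: `(r² - A²) / 2 ≥ (r - A) A ≥ (r - A) / A`.
    have h2 : ‖w‖ / A - 1 ≤ (‖w‖ ^ 2 - A ^ 2) / 2 := by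
      rw [sub_le_iff_le_add, div_le_iff₀ hA0]
      nlinarith [mul_nonneg (sub_nonneg.2 h) (sub_nonneg.2 hA), sq_nonneg (‖w‖ - A),
        mul_nonneg (mul_nonneg (sub_nonneg.2 h) (sub_nonneg.2 hA)) hA0.le,
        mul_nonneg (mul_nonneg (sub_nonneg.2 h) (sub_nonneg.2 h)) hA0.le]
    have h3 : ‖w‖ ≤ A * Real.exp ((‖w‖ ^ 2 - A ^ 2) / 2) := by
      have := h1.trans (Real.exp_le_exp.2 h2)
      rwa [div_le_iff₀ hA0, mul_comm] at this
    calc gaussWeight w * ‖w‖ ≤ gaussWeight w * (A * Real.exp ((‖w‖ ^ 2 - A ^ 2) / 2)) := by gcongr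
      _ = A * (Real.exp (-‖w‖ ^ 2 / 2) * Real.exp ((‖w‖ ^ 2 - A ^ 2) / 2)) := by
          rw [gaussWeight]; ring
      _ = A * Real.exp (-A ^ 2 / 2) := by rw [← Real.exp_add]; ring_nf

end Kernel

/-! ### The velocity as a conditional mean, and its regularity for arbitrary `p`. -/

section Velocity

variable {E : Type*} [NormedAddCommGroup E] [InnerProductSpace ℝ E]
  [MeasurableSpace E]

/-- The unnormalised density of `p * N(0, t² I)`. -/
noncomputable def noisyMass (p : Measure E) (t : ℝ) (x : E) : ℝ :=
  ∫ y, gaussWeight (t⁻¹ • (x - y)) ∂p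

/-- The unnormalised first moment of the noise given the noisy variable. -/
noncomputable def noisyMoment (p : Measure E) (t : ℝ) (x : E) : E :=
  ∫ y, gaussWeight (t⁻¹ • (x - y)) • (t⁻¹ • (x - y)) ∂p

/-- The velocity field of the probability flow ODE: the conditional mean of the noise. -/
noncomputable def flowVelocity (p : Measure E) (t : ℝ) (x : E) : E :=
  (noisyMass p t x)⁻¹ • noisyMoment p t x

variable [BorelSpace E] [FiniteDimensional ℝ E] {p : Measure E} [IsProbabilityMeasure p]

lemma integrable_gaussWeight (t : ℝ) (x : E) :
    Integrable (fun y => gaussWeight (t⁻¹ • (x - y))) p := by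
  refine Integrable.of_bound (by fun_prop) 1 (ae_of_all _ fun y => ?_)
  rw [Real.norm_of_nonneg (gaussWeight_pos _).le]
  exact gaussWeight_le_one _

lemma integrable_gaussWeight_smul (t : ℝ) (x : E) :
    Integrable (fun y => gaussWeight (t⁻¹ • (x - y)) • (t⁻¹ • (x - y))) p :=
  Integrable.of_bound (by fun_prop) 1 (ae_of_all _ fun _ => norm_gaussWeight_smul_le _)

lemma noisyMass_pos (t : ℝ) (x : E) : 0 < noisyMass p t x := by
  rw [noisyMass, integral_pos_iff_support_of_nonneg (fun y => (gaussWeight_pos _).le)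
    (integrable_gaussWeight t x)]
  have : Function.support (fun y : E => gaussWeight (t⁻¹ • (x - y))) = Set.univ :=
    Set.eq_univ_of_forall fun y => (gaussWeight_pos _).ne'
  simp [this]

/-- Tightness of `p` replaces any moment assumption in the bounds on the velocity. -/
lemma exists_half_le_measureReal_closedBall :
    ∃ r : ℝ, 0 ≤ r ∧ 1 / 2 ≤ p.real (Metric.closedBall (0 : E) r) := by
  have h : Tendsto (fun k : ℕ => p (Metric.closedBall (0 : E) k)) atTop (𝓝 1) := by
    have := tendsto_measure_iUnion_atTop (μ := p) (s := fun k : ℕ => Metric.closedBall (0 : E) k)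
      (fun i j hij => Metric.closedBall_subset_closedBall (by exact_mod_cast hij))
    rwa [Metric.iUnion_closedBall_nat, measure_univ] at this
  have h' : (1 / 2 : ℝ≥0∞) < 1 := by simp
  obtain ⟨k, hk⟩ := (h.eventually (lt_mem_nhds h')).exists
  refine ⟨k, Nat.cast_nonneg _, ?_⟩
  have := ENNReal.toReal_mono (measure_ne_top p _) hk.le
  simpa [Measure.real] using this

/-- Only the mass of `p` in the ball is kept; there the kernel is at least the exponential. -/
lemma le_noisyMass {r : ℝ} (hr : 1 / 2 ≤ p.real (Metric.closedBall (0 : E) r)) {t : ℝ}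
    (ht : 0 < t) (x : E) :
    1 / 2 * Real.exp (-((‖x‖ + r) / t) ^ 2 / 2) ≤ noisyMass p t x := by
  set c := Real.exp (-((‖x‖ + r) / t) ^ 2 / 2)
  have h1 := mul_meas_ge_le_integral_of_nonneg (μ := p) (ae_of_all _ fun y => (gaussWeight_pos
    (t⁻¹ • (x - y))).le) (integrable_gaussWeight t x) c
  have h2 : Metric.closedBall (0 : E) r ⊆ {y | c ≤ gaussWeight (t⁻¹ • (x - y))} := fun y hy => by
    rw [mem_closedBall_zero_iff] at hy
    refine Real.exp_le_exp.2 ?_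
    have : ‖t⁻¹ • (x - y)‖ ≤ (‖x‖ + r) / t := by
      rw [norm_smul, norm_inv, Real.norm_of_nonneg ht.le, ← div_eq_inv_mul]
      gcongr
      exact (norm_sub_le _ _).trans (by linarith)
    have := pow_le_pow_left₀ (norm_nonneg _) this 2
    linarith
  have h3 := hr.trans (measureReal_mono (μ := p) h2)
  calc 1 / 2 * c = c * (1 / 2) := mul_comm _ _
    _ ≤ c * p.real {y | c ≤ gaussWeight (t⁻¹ • (x - y))} := by gcongr
    _ ≤ _ := h1

lemma norm_noisyMoment_le (t : ℝ) (x : E) : ‖noisyMoment p t x‖ ≤ 1 := by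
  have := norm_integral_le_of_norm_le_const (μ := p) (ae_of_all _ fun y : E =>
    norm_gaussWeight_smul_le (t⁻¹ • (x - y)))
  simpa [noisyMoment] using this

lemma abs_noisyMass_sub_le {t : ℝ} (ht : 0 < t) (x x' : E) :
    |noisyMass p t x - noisyMass p t x'| ≤ t⁻¹ * ‖x - x'‖ := by
  rw [noisyMass, noisyMass, ← integral_sub (integrable_gaussWeight t x)
    (integrable_gaussWeight t x'), ← Real.norm_eq_abs]
  have := norm_integral_le_of_norm_le_const (μ := p) (C := t⁻¹ * ‖x - x'‖)
    (f := fun y => gaussWeight (t⁻¹ • (x - y)) - gaussWeight (t⁻¹ • (x' - y)))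
    (ae_of_all _ fun y : E => by
    have := lipschitzWith_gaussWeight.dist_le_mul (t⁻¹ • (x - y)) (t⁻¹ • (x' - y))
    rw [dist_eq_norm, dist_eq_norm, ← smul_sub, norm_smul, norm_inv, Real.norm_of_nonneg ht.le,
      sub_sub_sub_cancel_right] at this
    simpa using this)
  simpa using this

lemma norm_noisyMoment_sub_le {t : ℝ} (ht : 0 < t) (x x' : E) :
    ‖noisyMoment p t x - noisyMoment p t x'‖ ≤ 2 * (t⁻¹ * ‖x - x'‖) := by
  rw [noisyMoment, noisyMoment, ← integral_sub (integrable_gaussWeight_smul t x)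
    (integrable_gaussWeight_smul t x')]
  have := norm_integral_le_of_norm_le_const (μ := p) (C := 2 * (t⁻¹ * ‖x - x'‖))
    (f := fun y => gaussWeight (t⁻¹ • (x - y)) • (t⁻¹ • (x - y))
      - gaussWeight (t⁻¹ • (x' - y)) • (t⁻¹ • (x' - y)))
    (ae_of_all _ fun y : E => by
    have := lipschitzWith_gaussWeight_smul.dist_le_mul (t⁻¹ • (x - y)) (t⁻¹ • (x' - y))
    rw [dist_eq_norm, dist_eq_norm, ← smul_sub, norm_smul, norm_inv, Real.norm_of_nonneg ht.le,
      sub_sub_sub_cancel_right] at this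
    simpa using this)
  simpa using this

/-- Let `A` be the maximum. Noise of size at most `A` contributes at most `A` times the mass to the
moment, larger noise at most `A exp(-A² / 2)`. By the choice of `A` this exponential is at most
twice the mass, whence `3 = 1 + 2`. -/
lemma norm_flowVelocity_le {r : ℝ} (hr : 1 / 2 ≤ p.real (Metric.closedBall (0 : E) r)) {t : ℝ}
    (ht : 0 < t) (x : E) : ‖flowVelocity p t x‖ ≤ 3 * max 1 ((‖x‖ + r) / t) := by
  set A := max 1 ((‖x‖ + r) / t) with hA
  have hM := noisyMass_pos (p := p) t x
  have hr0 : 0 ≤ r := by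
    by_contra h
    rw [Metric.closedBall_eq_empty.2 (not_le.1 h)] at hr
    norm_num at hr
  have hE : Real.exp (-A ^ 2 / 2) ≤ 2 * noisyMass p t x := by
    have h1 := le_noisyMass hr ht x
    have h2 : Real.exp (-A ^ 2 / 2) ≤ Real.exp (-((‖x‖ + r) / t) ^ 2 / 2) := by
      apply Real.exp_le_exp.2
      have : ((‖x‖ + r) / t) ^ 2 ≤ A ^ 2 :=
        pow_le_pow_left₀ (by positivity) (le_max_right _ _) 2
      linarith
    linarith
  have hN : ‖noisyMoment p t x‖ ≤ A * noisyMass p t x + A * Real.exp (-A ^ 2 / 2) := by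
    have h := norm_integral_le_of_norm_le (μ := p)
      (((integrable_gaussWeight t x).const_mul A).add (integrable_const (A * Real.exp (-A ^ 2 / 2))))
      (ae_of_all _ fun y : E => norm_gaussWeight_smul_le_add (t⁻¹ • (x - y)) (le_max_left 1 _))
    refine h.trans (le_of_eq ?_)
    simp only [Pi.add_apply]
    rw [integral_add ((integrable_gaussWeight t x).const_mul A) (integrable_const _),
      integral_const_mul, noisyMass]
    simp
  rw [flowVelocity, norm_smul, norm_inv, Real.norm_of_nonneg hM.le, ← div_eq_inv_mul,
    div_le_iff₀ hM]
  have hA1 : 1 ≤ A := le_max_left _ _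
  nlinarith

lemma continuousOn_noisyMass (x : E) : ContinuousOn (fun t => noisyMass p t x) (Set.Ioi 0) := by
  refine continuousOn_of_dominated (bound := fun _ => 1) (fun t _ =>
    (integrable_gaussWeight t x).aestronglyMeasurable) (fun t _ => ae_of_all _ fun y => ?_)
    (integrable_const _) (ae_of_all _ fun y => ?_)
  · rw [Real.norm_of_nonneg (gaussWeight_pos _).le]
    exact gaussWeight_le_one _
  · exact continuous_gaussWeight.comp_continuousOn
      ((continuousOn_inv₀.mono fun t ht => (Set.mem_Ioi.1 ht).ne').smul continuousOn_const)

lemma continuousOn_noisyMoment (x : E) :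
    ContinuousOn (fun t => noisyMoment p t x) (Set.Ioi 0) := by
  refine continuousOn_of_dominated (bound := fun _ => 1) (fun t _ =>
    (integrable_gaussWeight_smul t x).aestronglyMeasurable) (fun t _ => ae_of_all _ fun y =>
    norm_gaussWeight_smul_le _) (integrable_const _) (ae_of_all _ fun y => ?_)
  have h : ContinuousOn (fun t : ℝ => t⁻¹ • (x - y)) (Set.Ioi 0) :=
    (continuousOn_inv₀.mono fun t ht => (Set.mem_Ioi.1 ht).ne').smul continuousOn_const
  exact (continuous_gaussWeight.comp_continuousOn h).smul h

/-- The velocity field of the probability flow ODE is tame, whatever the initial law. -/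
theorem isTameField_flowVelocity (p : Measure E) [IsProbabilityMeasure p] :
    IsTameField (flowVelocity p) := by
  obtain ⟨r, hr0, hr⟩ := exists_half_le_measureReal_closedBall (p := p)
  refine ⟨fun x => ?_, fun a b R ha => ?_, fun a b ha => ?_⟩
  · exact ((continuousOn_noisyMass x).inv₀ fun t _ => (noisyMass_pos t x).ne').smul
      (continuousOn_noisyMoment x)
  · set m := 1 / 2 * Real.exp (-((R + r) / a) ^ 2 / 2) with hm
    have hm0 : 0 < m := by positivity
    -- Quotient rule: the moment is `2 / a`-Lipschitz and bounded by 1, the mass is `1 /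
    -- a`-Lipschitz and at least `m` on the ball.
    refine ⟨(2 * a⁻¹ / m + a⁻¹ / m ^ 2).toNNReal, fun t ht =>
      LipschitzOnWith.of_dist_le_mul fun x hx x' hx' => ?_⟩
    have ht0 : 0 < t := ha.trans_le ht.1
    have hlow : ∀ z ∈ Metric.closedBall (0 : E) R, m ≤ noisyMass p t z := fun z hz => by
      rw [mem_closedBall_zero_iff] at hz
      refine le_trans ?_ (le_noisyMass hr ht0 z)
      rw [hm]
      have h1 : (‖z‖ + r) / t ≤ (R + r) / a := by
        have : 0 ≤ R := (norm_nonneg z).trans hz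
        exact div_le_div₀ (by linarith) (by linarith) ha ht.1
      have := pow_le_pow_left₀ (by positivity) h1 2
      gcongr
    have hx0 := hlow x hx
    have hx0' := hlow x' hx'
    have hMx := hm0.trans_le hx0
    have hMx' := hm0.trans_le hx0'
    have hdec : flowVelocity p t x - flowVelocity p t x'
        = (noisyMass p t x)⁻¹ • (noisyMoment p t x - noisyMoment p t x')
          + ((noisyMass p t x)⁻¹ - (noisyMass p t x')⁻¹) • noisyMoment p t x' := by
      simp only [flowVelocity]; module
    have hinv : t⁻¹ ≤ a⁻¹ := inv_anti₀ ha ht.1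
    rw [dist_eq_norm, dist_eq_norm, hdec, Real.coe_toNNReal _ (by positivity)]
    refine (norm_add_le _ _).trans ?_
    rw [add_mul]
    gcongr
    · rw [norm_smul, norm_inv, Real.norm_of_nonneg hMx.le]
      calc (noisyMass p t x)⁻¹ * ‖noisyMoment p t x - noisyMoment p t x'‖
          ≤ m⁻¹ * (2 * (a⁻¹ * ‖x - x'‖)) := by
            refine mul_le_mul (inv_anti₀ hm0 hx0) ((norm_noisyMoment_sub_le ht0 x x').trans ?_)
              (norm_nonneg _) (by positivity)
            gcongr
        _ = _ := by ring
    · rw [norm_smul, inv_sub_inv hMx.ne' hMx'.ne', norm_div, Real.norm_eq_abs,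
        Real.norm_of_nonneg (by positivity : 0 ≤ noisyMass p t x * noisyMass p t x'), abs_sub_comm]
      calc |noisyMass p t x - noisyMass p t x'| / (noisyMass p t x * noisyMass p t x')
            * ‖noisyMoment p t x'‖
          ≤ (a⁻¹ * ‖x - x'‖) / (m * m) * 1 := by
            gcongr
            · exact (abs_noisyMass_sub_le ht0 x x').trans (by gcongr)
            · exact norm_noisyMoment_le t x'
        _ = _ := by ring
  · refine ⟨3 * (1 + (1 + r) / a), by positivity, fun t ht x => ?_⟩
    have ht0 : 0 < t := ha.trans_le ht.1
    refine (norm_flowVelocity_le hr ht0 x).trans ?_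
    have h1 : (‖x‖ + r) / t ≤ (1 + r) / a * (1 + ‖x‖) := by
      calc (‖x‖ + r) / t ≤ (‖x‖ + r) / a := by gcongr; exact ht.1
        _ ≤ ((1 + r) * (1 + ‖x‖)) / a := by
            gcongr; nlinarith [norm_nonneg x]
        _ = _ := by ring
    have h2 : (1 : ℝ) ≤ 1 + ‖x‖ := by linarith [norm_nonneg x]
    have h3 : 0 ≤ (1 + r) / a * (1 + ‖x‖) := by positivity
    have : max 1 ((‖x‖ + r) / t) ≤ (1 + (1 + r) / a) * (1 + ‖x‖) :=
      max_le (by nlinarith) (by nlinarith)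
    linarith

/-- The gradient in `x` of the kernel at `w = (x - y) / t` is the kernel times `-w / t`, so the
moment is the gradient of the mass up to a factor. Tweedie's formula and the velocity of a Gaussian
both rest on this. -/
lemma hasFDerivAt_noisyMass {t : ℝ} (x : E) :
    HasFDerivAt (noisyMass p t) (-t⁻¹ • innerSL ℝ (noisyMoment p t x)) x := by
  have hd : ∀ y x : E, HasFDerivAt (fun x => gaussWeight (t⁻¹ • (x - y)))
      (-t⁻¹ • innerSL ℝ (gaussWeight (t⁻¹ • (x - y)) • (t⁻¹ • (x - y)))) x := fun y x => by
    have h := (hasFDerivAt_gaussWeight (t⁻¹ • (x - y))).comp x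
      (((hasFDerivAt_id x).sub_const y).const_smul t⁻¹)
    refine h.congr_fderiv ?_
    ext v
    simp
  have h := hasFDerivAt_integral_of_dominated_of_fderiv_le (μ := p) (𝕜 := ℝ) (x₀ := x)
    (F := fun x y => gaussWeight (t⁻¹ • (x - y))) (s := Set.univ)
    (F' := fun x y => -t⁻¹ • innerSL ℝ (gaussWeight (t⁻¹ • (x - y)) • (t⁻¹ • (x - y))))
    (bound := fun _ => |t⁻¹|) Filter.univ_mem
    (Eventually.of_forall fun x => (integrable_gaussWeight t x).aestronglyMeasurable)
    (integrable_gaussWeight t x)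
    (((innerSL ℝ).continuous.comp_aestronglyMeasurable
      (integrable_gaussWeight_smul t x).aestronglyMeasurable).const_smul (-t⁻¹))
    (ae_of_all _ fun y x _ => by
      rw [norm_smul, innerSL_apply_norm, norm_neg, Real.norm_eq_abs]
      exact mul_le_of_le_one_right (abs_nonneg _) (norm_gaussWeight_smul_le _))
    (integrable_const _) (ae_of_all _ fun y x _ => hd y x)
  rw [integral_smul, ContinuousLinearMap.integral_comp_comm _
    (integrable_gaussWeight_smul t x)] at h
  exact h

end Velocity

/-! ### The score and Tweedie's formula. -/

section Score

variable {n : ℕ} {p : Measure (EuclideanSpace ℝ (Fin n))} [IsProbabilityMeasure p]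

lemma noisyDensity_eq (t : ℝ) (x : EuclideanSpace ℝ (Fin n)) :
    noisyDensity p t x = (2 * Real.pi * t ^ 2) ^ (-(n : ℝ) / 2) * noisyMass p t x := by
  rw [noisyDensity, integral_const_mul, noisyMass]
  congr 2
  funext y
  rw [gaussWeight, norm_smul, norm_inv, Real.norm_eq_abs, mul_pow, inv_pow, sq_abs]
  congr 1
  by_cases ht : t = 0
  · simp [ht]
  · field_simp

/-- Tweedie's formula. -/
theorem neg_smul_score {t : ℝ} (ht : 0 < t) (x : EuclideanSpace ℝ (Fin n)) :
    -(t • score p t x) = flowVelocity p t x := by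
  have hc : 0 < (2 * Real.pi * t ^ 2) ^ (-(n : ℝ) / 2) := by positivity
  have h1 := ((hasFDerivAt_noisyMass (p := p) (t := t) x).const_mul
    ((2 * Real.pi * t ^ 2) ^ (-(n : ℝ) / 2))).log
      (mul_pos hc (noisyMass_pos t x)).ne'
  have h2 : HasGradientAt (fun z => Real.log (noisyDensity p t z))
      (-(t⁻¹ • flowVelocity p t x)) x := by
    rw [hasGradientAt_iff_hasFDerivAt]
    simp_rw [noisyDensity_eq]
    refine h1.congr_fderiv ?_
    ext v
    have := (noisyMass_pos (p := p) t x).ne'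
    simp [flowVelocity]
    field_simp
  rw [score, h2.gradient, smul_neg, neg_neg, smul_inv_smul₀ ht.ne']

end Score

/-! ### The density of the standard Gaussian. -/

section GaussianDensity

variable {E : Type*} [NormedAddCommGroup E] [InnerProductSpace ℝ E] [FiniteDimensional ℝ E]
  [MeasurableSpace E] [BorelSpace E]

variable (E) in
/-- The normalising constant of the standard Gaussian density. -/
noncomputable def gaussConst : ℝ := (2 * Real.pi) ^ (-(Module.finrank ℝ E : ℝ) / 2)

lemma gaussConst_pos : 0 < gaussConst E := by unfold gaussConst; positivity

lemma integral_gaussWeight : ∫ x : E, gaussWeight x = (gaussConst E)⁻¹ := by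
  have h := GaussianFourier.integral_rexp_neg_mul_sq_norm (V := E) (b := 1 / 2) (by norm_num)
  rw [gaussConst, neg_div, Real.rpow_neg (by positivity), inv_inv]
  simp only [gaussWeight]
  convert h using 3
  · congr 1; ring
  · ring

lemma integrable_gaussWeight_volume : Integrable (gaussWeight : E → ℝ) := by
  -- A non-integrable function has Bochner integral 0, but the value just computed is positive.
  by_contra h
  have := integral_undef h
  rw [integral_gaussWeight] at this
  exact (inv_pos.2 (gaussConst_pos (E := E))).ne' this

lemma lintegral_gaussDensity :
    ∫⁻ x : E, ENNReal.ofReal (gaussConst E * gaussWeight x) = 1 := by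
  rw [← ofReal_integral_eq_lintegral_ofReal (integrable_gaussWeight_volume.const_mul _)
    (ae_of_all _ fun x => (mul_pos gaussConst_pos (gaussWeight_pos x)).le), integral_const_mul,
    integral_gaussWeight, mul_inv_cancel₀ gaussConst_pos.ne', ENNReal.ofReal_one]

/-- Both sides have the same characteristic function, by the Gaussian Fourier integral. -/
theorem stdGaussian_eq_withDensity : stdGaussian E =
    volume.withDensity fun x => ENNReal.ofReal (gaussConst E * gaussWeight x) := by
  have : IsFiniteMeasure
      ((volume : Measure E).withDensity fun x => ENNReal.ofReal (gaussConst E * gaussWeight x)) :=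
    isFiniteMeasure_withDensity (by rw [lintegral_gaussDensity]; exact ENNReal.one_ne_top)
  refine Measure.ext_of_charFun ?_
  ext t
  rw [charFun_stdGaussian, charFun_apply, integral_withDensity_eq_integral_toReal_smul
    (by fun_prop) (ae_of_all _ fun _ => ENNReal.ofReal_lt_top)]
  have h := GaussianFourier.integral_cexp_neg_mul_sq_norm_add (V := E) (b := 1 / 2)
    (by norm_num) Complex.I t
  have e : ∀ x : E, (ENNReal.ofReal (gaussConst E * gaussWeight x)).toReal
      • Complex.exp ((inner ℝ x t : ℝ) * Complex.I)
      = (gaussConst E : ℂ) * Complex.exp (-(1 / 2) * (‖x‖ : ℂ) ^ 2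
          + Complex.I * (inner ℝ t x : ℝ)) := fun x => by
    rw [ENNReal.toReal_ofReal (mul_pos gaussConst_pos (gaussWeight_pos x)).le, gaussWeight,
      Complex.real_smul, Complex.ofReal_mul, mul_assoc, Complex.ofReal_exp, ← Complex.exp_add,
      real_inner_comm]
    congr 2
    push_cast
    ring
  simp_rw [e]
  rw [integral_const_mul, h, ← mul_assoc, gaussConst]
  have h1 : ((Real.pi : ℂ) / (1 / 2)) ^ (Module.finrank ℝ E / 2 : ℂ)
      = (((2 * Real.pi) ^ ((Module.finrank ℝ E : ℝ) / 2) : ℝ) : ℂ) := by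
    rw [Complex.ofReal_cpow (by positivity)]
    push_cast
    congr 1
    ring
  rw [h1, ← Complex.ofReal_mul, ← Real.rpow_add (by positivity), neg_div (2 : ℝ),
    neg_add_cancel, Real.rpow_zero, Complex.I_sq]
  simp only [Complex.ofReal_one, one_mul]
  congr 1
  ring

lemma map_add_smul_volume (y : E) {s : ℝ} (hs : s ≠ 0) :
    (volume : Measure E).map (fun z => y + s • z)
      = ENNReal.ofReal (|(s ^ Module.finrank ℝ E)⁻¹|) • volume := by
  have : (fun z : E => y + s • z) = (fun z => y + z) ∘ (fun z => s • z) := rfl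
  rw [this, ← Measure.map_map (by fun_prop) (by fun_prop), Measure.map_addHaar_smul _ hs,
    Measure.map_smul, map_add_left_eq_self]

end GaussianDensity

/-! ### The noisy laws and the conditional mean property. -/

section Noised

variable {E : Type*} [NormedAddCommGroup E] [InnerProductSpace ℝ E] [FiniteDimensional ℝ E]
  [MeasurableSpace E] [BorelSpace E]

/-- The law of `y + s z` with `y ∼ p` and independent standard Gaussian `z`. -/
noncomputable def noised (p : Measure E) (s : ℝ) : Measure E :=
  (p.prod (stdGaussian E)).map fun ω => ω.1 + s • ω.2

variable {p : Measure E} [IsProbabilityMeasure p]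

instance (s : ℝ) : IsProbabilityMeasure (noised p s) :=
  Measure.isProbabilityMeasure_map (by fun_prop)

variable (E) in
/-- The normalising constant of the density of `N(0, s² I)`. -/
noncomputable def noiseConst (s : ℝ) : ℝ := |(s ^ Module.finrank ℝ E)⁻¹| * gaussConst E

lemma noiseConst_pos {s : ℝ} (hs : s ≠ 0) : 0 < noiseConst E s :=
  mul_pos (abs_pos.2 (inv_ne_zero (pow_ne_zero _ hs))) gaussConst_pos

/-- The joint law of the clean and the noisy variable. -/
lemma map_clean_noisy (p : Measure E) [IsProbabilityMeasure p] {s : ℝ} (hs : s ≠ 0) :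
    (p.prod (stdGaussian E)).map (fun ω => (ω.1, ω.1 + s • ω.2))
      = (p.prod volume).withDensity
        fun ω => ENNReal.ofReal (noiseConst E s * gaussWeight (s⁻¹ • (ω.2 - ω.1))) := by
  refine Measure.ext_of_lintegral _ fun f hf => ?_
  rw [lintegral_map hf (by fun_prop), lintegral_prod _ (by fun_prop),
    lintegral_withDensity_eq_lintegral_mul _ (by fun_prop) hf, lintegral_prod _ (by fun_prop)]
  refine lintegral_congr fun y => ?_
  rw [stdGaussian_eq_withDensity, lintegral_withDensity_eq_lintegral_mul _ (by fun_prop)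
    (by fun_prop)]
  have h : ∫⁻ x, ENNReal.ofReal (gaussConst E * gaussWeight (s⁻¹ • (x - y))) * f (y, x)
      ∂((volume : Measure E).map (fun z => y + s • z))
      = ∫⁻ z, ENNReal.ofReal (gaussConst E * gaussWeight z) * f (y, y + s • z) := by
    rw [lintegral_map (by fun_prop) (by fun_prop)]
    simp [inv_smul_smul₀ hs]
  simp only [Pi.mul_apply]
  rw [← h, map_add_smul_volume y hs, lintegral_smul_measure, smul_eq_mul,
    ← lintegral_const_mul _ (by fun_prop)]
  refine lintegral_congr fun x => ?_
  rw [← mul_assoc, ← ENNReal.ofReal_mul (abs_nonneg _), noiseConst, mul_assoc]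

lemma noised_eq_withDensity (p : Measure E) [IsProbabilityMeasure p] {s : ℝ} (hs : s ≠ 0) :
    noised p s = volume.withDensity
      fun x => ENNReal.ofReal (noiseConst E s * noisyMass p s x) := by
  have h0 : noised p s = ((p.prod (stdGaussian E)).map
      (fun ω => (ω.1, ω.1 + s • ω.2))).map Prod.snd := by
    rw [Measure.map_map (by fun_prop) (by fun_prop)]; rfl
  have hM : Continuous (noisyMass p s) := continuous_iff_continuousAt.2 fun x =>
    (hasFDerivAt_noisyMass x).continuousAt
  refine Measure.ext_of_lintegral _ fun f hf => ?_
  rw [h0, map_clean_noisy p hs, lintegral_map hf (by fun_prop),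
    lintegral_withDensity_eq_lintegral_mul _ (by fun_prop) (by fun_prop),
    lintegral_withDensity_eq_lintegral_mul _ (by fun_prop) hf,
    lintegral_prod_symm _ (by fun_prop)]
  refine lintegral_congr fun x => ?_
  simp only [Pi.mul_apply]
  rw [lintegral_mul_const _ (by fun_prop), noisyMass, ← integral_const_mul,
    ofReal_integral_eq_lintegral_ofReal ((integrable_gaussWeight s x).const_mul _)
    (ae_of_all _ fun y => (mul_pos (noiseConst_pos hs) (gaussWeight_pos _)).le)]

/-- The noisy density is positive everywhere. Statements almost everywhere for the noisy law thus
pass to Lebesgue measure, and from there to `N(0, T² I)`. -/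
lemma volume_absolutelyContinuous_noised {s : ℝ} (hs : s ≠ 0) :
    (volume : Measure E) ≪ noised p s := by
  have hM : Continuous (noisyMass p s) := continuous_iff_continuousAt.2 fun x =>
    (hasFDerivAt_noisyMass x).continuousAt
  rw [noised_eq_withDensity p hs]
  refine withDensity_absolutelyContinuous' (by fun_prop) (ae_of_all _ fun x => ?_)
  exact (ENNReal.ofReal_pos.2 (mul_pos (noiseConst_pos hs) (noisyMass_pos s x))).ne'

lemma noised_absolutelyContinuous_volume {s : ℝ} (hs : s ≠ 0) :
    noised p s ≪ (volume : Measure E) := by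
  rw [noised_eq_withDensity p hs]
  exact withDensity_absolutelyContinuous _ _

lemma continuous_flowVelocity {s : ℝ} (hs : 0 < s) : Continuous (flowVelocity p s) := by
  rw [continuous_iff_continuousAt]
  intro x
  obtain ⟨K, hK⟩ := (isTameField_flowVelocity p).lipschitz s s (‖x‖ + 1) hs
  refine (hK s ⟨le_rfl, le_rfl⟩).continuousOn.continuousAt ?_
  exact Filter.mem_of_superset (Metric.closedBall_mem_nhds x one_pos)
    fun y hy => by
      rw [mem_closedBall_zero_iff]
      have := norm_le_norm_add_norm_sub x y
      rw [Metric.mem_closedBall, dist_eq_norm, norm_sub_rev] at hy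
      linarith

/-- The velocity is the conditional mean of the noise given the noisy variable. -/
lemma integral_sub_flowVelocity_eq_zero {s : ℝ} (hs : 0 < s) {L : E → E →L[ℝ] ℝ}
    (hL : Measurable L)
    (hint : Integrable (fun ω : E × E => L (ω.1 + s • ω.2)
      (ω.2 - flowVelocity p s (ω.1 + s • ω.2))) (p.prod (stdGaussian E))) :
    ∫ ω, L (ω.1 + s • ω.2) (ω.2 - flowVelocity p s (ω.1 + s • ω.2))
      ∂(p.prod (stdGaussian E)) = 0 := by
  -- The noise is recovered from the clean and noisy variables. Integrating over the clean one
  -- first, with `x` fixed, leaves `L x` of moment minus mass times velocity, which is zero.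
  set H : E × E → ℝ := fun η => L η.2 (s⁻¹ • (η.2 - η.1) - flowVelocity p s η.2) with hH
  have hV := continuous_flowVelocity (p := p) hs
  have hHm : Measurable H := by
    have h1 : Measurable fun η : E × E => L η.2 := hL.comp measurable_snd
    have h2 : Measurable fun η : E × E => s⁻¹ • (η.2 - η.1) - flowVelocity p s η.2 := by fun_prop
    exact (isBoundedBilinearMap_apply (𝕜 := ℝ) (E := E) (F := ℝ)).continuous.measurable.comp
      (h1.prodMk h2)
  have e : (fun ω : E × E => L (ω.1 + s • ω.2) (ω.2 - flowVelocity p s (ω.1 + s • ω.2)))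
      = fun ω => H (ω.1, ω.1 + s • ω.2) := by
    funext ω
    simp only [hH, add_sub_cancel_left, inv_smul_smul₀ hs.ne']
  have hφ : Measurable fun ω : E × E => (ω.1, ω.1 + s • ω.2) := by fun_prop
  rw [e] at hint ⊢
  have hint' : Integrable H ((p.prod (stdGaussian E)).map fun ω => (ω.1, ω.1 + s • ω.2)) :=
    (integrable_map_measure hHm.aestronglyMeasurable hφ.aemeasurable).2 hint
  rw [← integral_map (f := H) hφ.aemeasurable hHm.aestronglyMeasurable]
  rw [map_clean_noisy p hs.ne'] at hint' ⊢
  have hlt : ∀ᵐ ω : E × E ∂(p.prod volume),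
      ENNReal.ofReal (noiseConst E s * gaussWeight (s⁻¹ • (ω.2 - ω.1))) < ∞ :=
    ae_of_all _ fun _ => ENNReal.ofReal_lt_top
  rw [integrable_withDensity_iff_integrable_smul₀' (by fun_prop) hlt] at hint'
  rw [integral_withDensity_eq_integral_toReal_smul (by fun_prop) hlt, integral_prod_symm _ hint']
  refine integral_eq_zero_of_ae (ae_of_all _ fun x => ?_)
  simp only [hH, Pi.zero_apply]
  have e2 : ∀ y : E, (ENNReal.ofReal (noiseConst E s * gaussWeight (s⁻¹ • (x - y)))).toReal
      • L x (s⁻¹ • (x - y) - flowVelocity p s x)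
      = noiseConst E s * L x (gaussWeight (s⁻¹ • (x - y)) • (s⁻¹ • (x - y))
        - gaussWeight (s⁻¹ • (x - y)) • flowVelocity p s x) := fun y => by
    rw [ENNReal.toReal_ofReal (mul_pos (noiseConst_pos hs.ne') (gaussWeight_pos _)).le,
      ← smul_sub, map_smul, smul_eq_mul, smul_eq_mul, mul_assoc]
  simp_rw [e2]
  have hi : Integrable (fun y => gaussWeight (s⁻¹ • (x - y)) • (s⁻¹ • (x - y))
      - gaussWeight (s⁻¹ • (x - y)) • flowVelocity p s x) p :=
    (integrable_gaussWeight_smul s x).sub ((integrable_gaussWeight s x).smul_const _)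
  rw [integral_const_mul, ContinuousLinearMap.integral_comp_comm _ hi, integral_sub (integrable_gaussWeight_smul s x) ((integrable_gaussWeight s x).smul_const _),
    integral_smul_const]
  have : noisyMoment p s x - noisyMass p s x • flowVelocity p s x = 0 := by
    rw [flowVelocity, smul_inv_smul₀ (noisyMass_pos s x).ne', sub_self]
  rw [noisyMoment, noisyMass] at this
  rw [this, map_zero, mul_zero]

/-- Jensen's inequality for a conditional mean. The bound is independent of `s`, which makes
velocities integrable down to time zero. -/
lemma lintegral_enorm_flowVelocity_le {s : ℝ} (hs : 0 < s) :
    ∫⁻ x, ‖flowVelocity p s x‖ₑ ∂(noised p s) ≤ ∫⁻ z, ‖z‖ₑ ∂(stdGaussian E) := by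
  have hV := continuous_flowVelocity (p := p) hs
  have hM : Continuous (noisyMass p s) := continuous_iff_continuousAt.2 fun x =>
    (hasFDerivAt_noisyMass x).continuousAt
  have hφ : Measurable fun ω : E × E => (ω.1, ω.1 + s • ω.2) := by fun_prop
  have h1 : ∫⁻ z, ‖z‖ₑ ∂(stdGaussian E) = ∫⁻ η, ‖s⁻¹ • (η.2 - η.1)‖ₑ
      ∂((p.prod (stdGaussian E)).map fun ω => (ω.1, ω.1 + s • ω.2)) := by
    rw [lintegral_map (by fun_prop) hφ]
    simp only [add_sub_cancel_left, inv_smul_smul₀ hs.ne']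
    rw [lintegral_prod _ (by fun_prop)]
    simp
  rw [h1, map_clean_noisy p hs.ne', lintegral_withDensity_eq_lintegral_mul _ (by fun_prop)
    (by fun_prop), lintegral_prod_symm _ (by fun_prop), noised_eq_withDensity p hs.ne',
    lintegral_withDensity_eq_lintegral_mul _ (by fun_prop) (by fun_prop)]
  refine lintegral_mono fun x => ?_
  simp only [Pi.mul_apply]
  calc ENNReal.ofReal (noiseConst E s * noisyMass p s x) * ‖flowVelocity p s x‖ₑ
      = ENNReal.ofReal (noiseConst E s) * ‖noisyMoment p s x‖ₑ := by
        rw [ENNReal.ofReal_mul (noiseConst_pos hs.ne').le, mul_assoc, flowVelocity, enorm_smul,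
          ← mul_assoc (ENNReal.ofReal (noisyMass p s x)),
          ← Real.enorm_of_nonneg (noisyMass_pos s x).le, ← enorm_mul,
          mul_inv_cancel₀ (noisyMass_pos s x).ne', enorm_one, one_mul]
    _ ≤ ENNReal.ofReal (noiseConst E s)
          * ∫⁻ y, ‖gaussWeight (s⁻¹ • (x - y)) • (s⁻¹ • (x - y))‖ₑ ∂p := by
        gcongr
        exact enorm_integral_le_lintegral_enorm _
    _ = _ := by
        rw [← lintegral_const_mul _ (by fun_prop)]
        refine lintegral_congr fun y => ?_
        rw [enorm_smul, Real.enorm_of_nonneg (gaussWeight_pos _).le, ← mul_assoc,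
          ← ENNReal.ofReal_mul (noiseConst_pos hs.ne').le]

lemma lintegral_enorm_stdGaussian_lt_top : ∫⁻ z, ‖z‖ₑ ∂(stdGaussian E) < ∞ :=
  (IsGaussian.integrable_id (μ := stdGaussian E)).hasFiniteIntegral

end Noised

/-! ### Flows of bounded Lipschitz fields along straight lines. -/

section BoundedField

variable {E : Type*} [NormedAddCommGroup E] [NormedSpace ℝ E] [CompleteSpace E]
  {W : ℝ → E → E} {a b : ℝ} {K B : NNReal}

lemma norm_fieldFlow_sub_le (hW : IsTameField W) (ha : 0 < a)
    (hB : ∀ t ∈ Set.Icc a b, ∀ x, ‖W t x‖ ≤ B) {s t : ℝ} (hs : s ∈ Set.Icc a b)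
    (ht : t ∈ Set.Icc a b) (x : E) : ‖fieldFlow W s t x - x‖ ≤ B * |t - s| := by
  have := (convex_Icc a b).norm_image_sub_le_of_norm_hasDerivWithin_le
    (f := fun r => fieldFlow W s r x) (C := B)
    (fun r hr => (hW.hasDerivAt_fieldFlow (ha.trans_le hs.1) x
      (ha.trans_le hr.1)).hasDerivWithinAt) (fun r hr => hB r hr _) hs ht
  simpa [hW.fieldFlow_self (ha.trans_le hs.1)] using this

lemma dist_fieldFlow_le (hW : IsTameField W) (ha : 0 < a)
    (hK : ∀ t ∈ Set.Icc a b, LipschitzWith K (W t)) {s t : ℝ} (hs : s ∈ Set.Icc a b)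
    (ht : t ∈ Set.Icc a b) (x y : E) :
    dist (fieldFlow W s t x) (fieldFlow W s t y) ≤ Real.exp (K * (b - a)) * dist x y := by
  have hsub : Set.uIcc s t ⊆ Set.Icc a b := (Set.ordConnected_Icc).uIcc_subset hs ht
  have h0 := ha.trans_le hs.1
  have := IsTameField.dist_le (V := W) (K := K) (S := Set.univ) (s := s) (t := t)
    (γ₁ := fun r => fieldFlow W s r x) (γ₂ := fun r => fieldFlow W s r y)
    (fun r hr => (hK r (hsub hr)).lipschitzOnWith)
    (fun r hr => hW.hasDerivAt_fieldFlow h0 x (ha.trans_le (hsub hr).1)) (fun _ _ => trivial)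
    (fun r hr => hW.hasDerivAt_fieldFlow h0 y (ha.trans_le (hsub hr).1)) (fun _ _ => trivial)
  rw [hW.fieldFlow_self h0, hW.fieldFlow_self h0, mul_comm] at this
  refine this.trans ?_
  gcongr
  exact abs_le.2 ⟨by linarith [hs.2, ht.1], by linarith [hs.1, ht.2]⟩

/-- Lipschitz dependence on the starting time along a straight line. -/
lemma dist_fieldFlow_line_le (hW : IsTameField W) (ha : 0 < a)
    (hK : ∀ t ∈ Set.Icc a b, LipschitzWith K (W t)) (hB : ∀ t ∈ Set.Icc a b, ∀ x, ‖W t x‖ ≤ B)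
    {t : ℝ} (ht : t ∈ Set.Icc a b) (y z : E) {r r' : ℝ} (hr : r ∈ Set.Icc a b)
    (hr' : r' ∈ Set.Icc a b) :
    dist (fieldFlow W r t (y + r • z)) (fieldFlow W r' t (y + r' • z))
      ≤ Real.exp (K * (b - a)) * ((B + ‖z‖) * |r - r'|) := by
  have h0 : ∀ {u}, u ∈ Set.Icc a b → 0 < u := fun hu => ha.trans_le hu.1
  rw [← hW.fieldFlow_fieldFlow (h0 hr) (h0 hr') (h0 ht)]
  refine (dist_fieldFlow_le hW ha hK hr' ht _ _).trans ?_
  gcongr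
  have h1 := norm_fieldFlow_sub_le hW ha hB hr hr' (y + r • z)
  have h2 : dist (y + r • z) (y + r' • z) = |r - r'| * ‖z‖ := by
    rw [dist_eq_norm, add_sub_add_left_eq_sub, ← sub_smul, norm_smul, Real.norm_eq_abs]
  rw [← dist_eq_norm, abs_sub_comm] at h1
  have := dist_triangle (fieldFlow W r r' (y + r • z)) (y + r • z) (y + r' • z)
  rw [h2] at this
  linarith

/-- The curve obtained by transporting the points of a straight line to a fixed time. -/
lemma hasDerivAt_fieldFlow_line (hW : IsTameField W) (ha : 0 < a)
    (hK : ∀ t ∈ Set.Icc a b, LipschitzWith K (W t)) (hB : ∀ t ∈ Set.Icc a b, ∀ x, ‖W t x‖ ≤ B)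
    {s : ℝ} (hs : s ∈ Set.Ioo a b) (y z : E) :
    HasDerivAt (fun r => fieldFlow W r s (y + r • z)) (z - W s (y + s • z)) s := by
  have hs0 : 0 < s := ha.trans hs.1
  set x := y + s • z with hx
  rw [hasDerivAt_iff_isLittleO, Asymptotics.isLittleO_iff]
  intro ε hε
  have hc : ContinuousAt (fun t => W t x) s := (hW.continuousOn x).continuousAt (Ioi_mem_nhds hs0)
  obtain ⟨δ, hδ, hcδ⟩ := Metric.continuousAt_iff.1 hc (ε / 2) (half_pos hε)
  set Q : ℝ := K * (B + ‖z‖) with hQ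
  have hQ0 : 0 ≤ Q := by positivity
  have hev : ∀ᶠ r in 𝓝 s, |r - s| < min δ (ε / (2 * (Q + 1))) :=
    Metric.eventually_nhds_iff.2
      ⟨min δ (ε / (2 * (Q + 1))), by positivity, fun r hr => by rwa [Real.dist_eq] at hr⟩
  filter_upwards [hev, Ioo_mem_nhds hs.1 hs.2] with r hr hrI
  have hr0 : 0 < r := ha.trans hrI.1
  have hrδ : |r - s| < δ := hr.trans_le (min_le_left _ _)
  have hrQ : Q * |r - s| ≤ ε / 2 := by
    have h1 := (lt_div_iff₀ (by positivity : (0 : ℝ) < 2 * (Q + 1))).1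
      (hr.trans_le (min_le_right _ _))
    nlinarith [abs_nonneg (r - s)]
  set xr := y + r • z with hxr
  have hsub : Set.uIcc r s ⊆ Set.Icc a b := (Set.ordConnected_Icc).uIcc_subset
    ⟨hrI.1.le, hrI.2.le⟩ ⟨hs.1.le, hs.2.le⟩
  have hxx : xr - x = (r - s) • z := by rw [hxr, hx]; module
  -- The orbit is compared with uniform motion at velocity `W s x`, so no spatial derivative of the
  -- flow is needed. The velocity error is at most `ε`: half from continuity in time at `x`, half
  -- from the Lipschitz bound in space.
  have hmv := (convex_uIcc r s).norm_image_sub_le_of_norm_hasDerivWithin_le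
    (f := fun τ => fieldFlow W r τ xr - τ • W s x) (C := ε)
    (f' := fun τ => W τ (fieldFlow W r τ xr) - W s x)
    (fun τ hτ => by
      have h1 := hW.hasDerivAt_fieldFlow hr0 xr (ha.trans_le (hsub hτ).1)
      have h2 := (hasDerivAt_id τ).smul_const (W s x)
      simpa using (h1.fun_sub h2).hasDerivWithinAt)
    (fun τ hτ => by
      have hτs : |τ - s| ≤ |r - s| := by
        have := Set.abs_sub_right_of_mem_uIcc hτ
        rwa [abs_sub_comm, abs_sub_comm s r] at this
      have hτr : |τ - r| ≤ |r - s| := by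
        have := Set.abs_sub_left_of_mem_uIcc hτ
        rwa [abs_sub_comm s r] at this
      have h1 : ‖W τ x - W s x‖ ≤ ε / 2 := by
        rw [← dist_eq_norm]
        exact (hcδ (by rw [Real.dist_eq]; exact hτs.trans_lt hrδ)).le
      have h2 : ‖W τ (fieldFlow W r τ xr) - W τ x‖ ≤ Q * |r - s| := by
        have h3 := (hK τ (hsub hτ)).dist_le_mul (fieldFlow W r τ xr) x
        have h4 := norm_fieldFlow_sub_le hW ha hB ⟨hrI.1.le, hrI.2.le⟩ (hsub hτ) xr
        have h5 : ‖xr - x‖ = |r - s| * ‖z‖ := by rw [hxx, norm_smul, Real.norm_eq_abs]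
        have h6 : ‖fieldFlow W r τ xr - x‖ ≤ (B + ‖z‖) * |r - s| := by
          have := norm_sub_le_norm_sub_add_norm_sub (fieldFlow W r τ xr) xr x
          have hB' : (B : ℝ) * |τ - r| ≤ B * |r - s| := by gcongr
          linarith
        rw [dist_eq_norm, dist_eq_norm] at h3
        calc _ ≤ K * ‖fieldFlow W r τ xr - x‖ := h3
          _ ≤ K * ((B + ‖z‖) * |r - s|) := by gcongr
          _ = _ := by rw [hQ]; ring
      have := norm_sub_le_norm_sub_add_norm_sub (W τ (fieldFlow W r τ xr)) (W τ x) (W s x)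
      linarith)
    Set.left_mem_uIcc Set.right_mem_uIcc
  rw [hW.fieldFlow_self hr0] at hmv
  rw [hW.fieldFlow_self hs0, ← hx]
  have e : fieldFlow W r s xr - x - (r - s) • (z - W s x)
      = fieldFlow W r s xr - s • W s x - (xr - r • W s x) := by
    rw [show xr = x + (r - s) • z by rw [← hxx]; abel]; module
  rw [e, Real.norm_eq_abs, abs_sub_comm]
  exact hmv

end BoundedField

/-! ### The flow transports the noisy laws. -/

section Transport

variable {E : Type*} [NormedAddCommGroup E] [InnerProductSpace ℝ E] [FiniteDimensional ℝ E]
  [MeasurableSpace E] [BorelSpace E] {p : Measure E} [IsProbabilityMeasure p]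

lemma ae_noised_iff {s : ℝ} {P : E → Prop} (hP : MeasurableSet {x | P x}) :
    (∀ᵐ x ∂(noised p s), P x) ↔ ∀ᵐ ω ∂(p.prod (stdGaussian E)), P (ω.1 + s • ω.2) :=
  ae_map_iff (by fun_prop) hP

lemma integrable_norm_noise :
    Integrable (fun ω : E × E => ‖ω.2‖) (p.prod (stdGaussian E)) :=
  ((IsGaussian.integrable_id (μ := stdGaussian E)).norm).comp_snd p

/-- Integrals of Lipschitz functions transported by a bounded field which agrees with the velocity
field where it matters are conserved. -/
lemma hasDerivAt_integral_fieldFlow_noised {W : ℝ → E → E} {a b : ℝ} {K B Λ : NNReal}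
    (hW : IsTameField W) (ha : 0 < a)
    (hK : ∀ t ∈ Set.Icc a b, LipschitzWith K (W t)) (hB : ∀ t ∈ Set.Icc a b, ∀ x, ‖W t x‖ ≤ B)
    {t : ℝ} (ht : t ∈ Set.Icc a b) {f : E → ℝ} (hf : LipschitzWith Λ f) {M : ℝ}
    (hM : ∀ x, |f x| ≤ M) {s : ℝ} (hs : s ∈ Set.Ioo a b)
    (hWV : ∀ x, W s x = flowVelocity p s x ∨ fderiv ℝ (fun x => f (fieldFlow W s t x)) x = 0) :
    HasDerivAt (fun r => ∫ ω : E × E, f (fieldFlow W r t (ω.1 + r • ω.2))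
      ∂(p.prod (stdGaussian E))) 0 s := by
  have h0 : ∀ {u}, u ∈ Set.Icc a b → 0 < u := fun hu => ha.trans_le hu.1
  have hsI : s ∈ Set.Icc a b := ⟨hs.1.le, hs.2.le⟩
  set u : E → ℝ := fun x => f (fieldFlow W s t x) with hu
  have hul : LipschitzWith (Λ * (Real.exp (K * (b - a))).toNNReal) u := by
    refine hf.comp (LipschitzWith.of_dist_le_mul fun x y => ?_)
    rw [Real.coe_toNNReal _ (Real.exp_pos _).le]
    exact dist_fieldFlow_le hW ha hK hsI ht x y
  have hcont : ∀ r ∈ Set.Icc a b,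
      Continuous fun ω : E × E => f (fieldFlow W r t (ω.1 + r • ω.2)) := fun r hr => by
    have := hW.continuous_fieldFlow (h0 hr) (h0 ht)
    have := hf.continuous
    fun_prop
  have hnI : Set.Icc a b ∈ 𝓝 s := Icc_mem_nhds hs.1 hs.2
  have hVc : Continuous (W s) := (hK s hsI).continuous
  have hm : Measurable (fderiv ℝ u) := measurable_fderiv ℝ u
  have hF'm : Measurable fun ω : E × E =>
      fderiv ℝ u (ω.1 + s • ω.2) (ω.2 - W s (ω.1 + s • ω.2)) := by
    have h1 : Measurable fun ω : E × E => fderiv ℝ u (ω.1 + s • ω.2) := hm.comp (by fun_prop)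
    have h2 : Measurable fun ω : E × E => ω.2 - W s (ω.1 + s • ω.2) :=
      Continuous.measurable (by fun_prop)
    exact (isBoundedBilinearMap_apply (𝕜 := ℝ) (E := E) (F := ℝ)).continuous.measurable.comp
      (h1.prodMk h2)
  -- `u` is only Lipschitz; Rademacher's theorem suffices because the noisy law is absolutely
  -- continuous.
  have hdiff : ∀ᵐ ω ∂(p.prod (stdGaussian E)), DifferentiableAt ℝ u (ω.1 + s • ω.2) :=
    (ae_noised_iff (measurableSet_of_differentiableAt ℝ u)).1
      ((noised_absolutelyContinuous_volume (h0 hsI).ne').ae_le hul.ae_differentiableAt)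
  have key := hasDerivAt_integral_of_dominated_loc_of_lip (μ := p.prod (stdGaussian E)) (𝕜 := ℝ)
    (F := fun r ω => f (fieldFlow W r t (ω.1 + r • ω.2))) (x₀ := s)
    (F' := fun ω => fderiv ℝ u (ω.1 + s • ω.2) (ω.2 - W s (ω.1 + s • ω.2)))
    (bound := fun ω => Λ * (Real.exp (K * (b - a)) * (B + ‖ω.2‖))) hnI
    (Filter.eventually_of_mem hnI fun r hr => (hcont r hr).aestronglyMeasurable)
    (Integrable.of_bound (hcont s hsI).aestronglyMeasurable M (ae_of_all _ fun ω => hM _))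
    hF'm.aestronglyMeasurable
    (ae_of_all _ fun ω => LipschitzOnWith.of_dist_le_mul fun r hr r' hr' => by
      refine (hf.dist_le_mul _ _).trans ?_
      rw [Real.coe_nnabs, abs_of_nonneg (by positivity), mul_assoc]
      gcongr
      rw [mul_assoc]
      exact dist_fieldFlow_line_le hW ha hK hB ht _ _ hr hr')
    ((((integrable_const (B : ℝ)).add integrable_norm_noise).const_mul _).const_mul _)
    (by
      filter_upwards [hdiff] with ω hω
      -- By the group property, flowing from `r` to `t` is flowing from `r` to the fixed time `s`
      -- and then from `s` to `t`; the chain rule applies to `u` along this curve.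
      have hd := hasDerivAt_fieldFlow_line hW ha hK hB hs ω.1 ω.2
      have hω' : HasFDerivAt u (fderiv ℝ u (ω.1 + s • ω.2))
          (fieldFlow W s s (ω.1 + s • ω.2)) := by
        rw [hW.fieldFlow_self (h0 hsI)]; exact hω.hasFDerivAt
      refine (hω'.comp_hasDerivAt s hd).congr_of_eventuallyEq
        (Filter.eventually_of_mem hnI fun r hr => ?_)
      simp only [hu, Function.comp_apply]
      rw [hW.fieldFlow_fieldFlow (h0 hr) (h0 hsI) (h0 ht)])
  have e : (fun ω : E × E => fderiv ℝ u (ω.1 + s • ω.2) (ω.2 - W s (ω.1 + s • ω.2)))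
      = fun ω => fderiv ℝ u (ω.1 + s • ω.2) (ω.2 - flowVelocity p s (ω.1 + s • ω.2)) := by
    funext ω
    rcases hWV (ω.1 + s • ω.2) with h | h
    · rw [h]
    · rw [h]; simp
  rw [e] at key
  rw [integral_sub_flowVelocity_eq_zero (h0 hsI) hm key.1] at key
  exact key.2

/-- The flow of the velocity field conserves integrals of Lipschitz functions of compact
support. -/
lemma integral_fieldFlow_noised {s t : ℝ} (hs : 0 < s) (ht : 0 < t) {f : E → ℝ} {Λ : NNReal}
    (hf : LipschitzWith Λ f) {M ρ : ℝ} (hM : ∀ x, |f x| ≤ M) (hρ : ∀ x, ρ < ‖x‖ → f x = 0) :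
    ∫ x, f (fieldFlow (flowVelocity p) s t x) ∂(noised p s) = ∫ x, f x ∂(noised p t) := by
  wlog hρ0 : 0 ≤ ρ
  · exact this hs ht hf hM (ρ := 0) (fun x hx => hρ x (by linarith)) le_rfl
  have hV := isTameField_flowVelocity p
  obtain ⟨a, b, ha, hsI, htI⟩ : ∃ a b, 0 < a ∧ s ∈ Set.Ioo a b ∧ t ∈ Set.Ioo a b :=
    ⟨min s t / 2, max s t + 1, by positivity,
      ⟨by linarith [min_le_left s t, lt_min hs ht], by linarith [le_max_left s t]⟩,
      ⟨by linarith [min_le_right s t, lt_min hs ht], by linarith [le_max_right s t]⟩⟩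
  obtain ⟨C, hC, hg⟩ := hV.growth a b ha
  -- An orbit inside the support ball at time `t` stays within `ρ'` throughout `(a, b)`. Truncating
  -- at `ρ' + 1` leaves room for the transported function to vanish near every point where the
  -- fields may differ.
  set ρ' := Real.exp (C * (b - a)) * (1 + ρ) with hρ'
  have hR : 0 < ρ' + 1 := by positivity
  set W : ℝ → E → E := fun t x => flowVelocity p t (radialRetraction (ρ' + 1) x) with hWdef
  have hW : IsTameField W := hV.truncate hR
  obtain ⟨K, B, hKB⟩ := hV.truncate_bounded (a := a) (b := b) ha hR
  have hgW : ∀ t ∈ Set.Icc a b, ∀ x, ‖W t x‖ ≤ C * (1 + ‖x‖) := fun t ht x =>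
    (hg t ht _).trans (by gcongr; exact norm_radialRetraction_le_norm hR x)
  have hWV : ∀ τ x, ‖x‖ ≤ ρ' + 1 → W τ x = flowVelocity p τ x := fun τ x hx => by
    simp only [hWdef, radialRetraction_of_norm_le hR hx]
  have hIcc : ∀ {r}, r ∈ Set.Ioo a b → r ∈ Set.Icc a b := fun hr => ⟨hr.1.le, hr.2.le⟩
  have h0 : ∀ {r}, r ∈ Set.Ioo a b → 0 < r := fun hr => ha.trans hr.1
  have hstay : ∀ {U : ℝ → E → E}, IsTameField U → (∀ t ∈ Set.Icc a b, ∀ x,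
      ‖U t x‖ ≤ C * (1 + ‖x‖)) → ∀ {r τ}, r ∈ Set.Ioo a b → τ ∈ Set.Ioo a b → ∀ {x},
      ‖fieldFlow U r t x‖ ≤ ρ → ‖fieldFlow U r τ x‖ ≤ ρ' := fun hU hgU r τ hr hτ x hx => by
    rw [← hU.fieldFlow_fieldFlow (h0 hr) (h0 htI) (h0 hτ)]
    refine (hU.norm_fieldFlow_le_of_growth ha hC hgU (hIcc htI) (hIcc hτ) _).trans ?_
    rw [hρ']
    gcongr
  -- If either orbit ends in the support ball, it lies where the fields agree and uniqueness
  -- identifies the two; otherwise `f` vanishes at both ends.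
  have hagree : ∀ x, f (fieldFlow W s t x) = f (fieldFlow (flowVelocity p) s t x) := fun x => by
    by_cases h1 : ‖fieldFlow (flowVelocity p) s t x‖ ≤ ρ
    · have := hW.eqOn_fieldFlow (γ := fun r => fieldFlow (flowVelocity p) s r x) ha.le hsI
        (fun r hr => by
          rw [hWV _ _ ((hstay hV hg hsI hr h1).trans (by linarith))]
          exact hV.hasDerivAt_fieldFlow hs x (h0 hr)) htI
      simp only [hV.fieldFlow_self hs] at this
      rw [this]
    · by_cases h2 : ‖fieldFlow W s t x‖ ≤ ρ
      · have := hV.eqOn_fieldFlow (γ := fun r => fieldFlow W s r x) ha.le hsI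
          (fun r hr => by
            rw [← hWV _ _ ((hstay hW hgW hsI hr h2).trans (by linarith))]
            exact hW.hasDerivAt_fieldFlow hs x (h0 hr)) htI
        simp only [hW.fieldFlow_self hs] at this
        rw [this]
      · rw [hρ _ (not_le.1 h1), hρ _ (not_le.1 h2)]
  have hd : ∀ r ∈ Set.Ioo a b, HasDerivAt (fun r => ∫ ω : E × E,
      f (fieldFlow W r t (ω.1 + r • ω.2)) ∂(p.prod (stdGaussian E))) 0 r := fun r hr => by
    refine hasDerivAt_integral_fieldFlow_noised hW ha (fun t ht => (hKB t ht).1)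
      (fun t ht => (hKB t ht).2) (hIcc htI) hf hM hr fun x => ?_
    by_cases hx : ‖x‖ ≤ ρ' + 1
    · exact Or.inl (hWV _ _ hx)
    · right
      have hev : (fun x => f (fieldFlow W r t x)) =ᶠ[𝓝 x] fun _ => 0 := by
        have : ∀ᶠ y in 𝓝 x, ρ' < ‖y‖ :=
          continuous_norm.continuousAt.eventually (lt_mem_nhds (by linarith))
        filter_upwards [this] with y hy
        refine hρ _ (not_le.1 fun h => ?_)
        have := hstay hW hgW hr hr h
        rw [hW.fieldFlow_self (h0 hr)] at this
        linarith
      rw [hev.fderiv_eq]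
      simp
  have hconst := isOpen_Ioo.is_const_of_deriv_eq_zero isPreconnected_Ioo
    (fun r hr => (hd r hr).differentiableAt.differentiableWithinAt) (fun r hr => (hd r hr).deriv)
    hsI htI
  have hfc := hf.continuous
  have hVf := hV.continuous_fieldFlow hs ht
  rw [noised, noised, integral_map (by fun_prop) (by fun_prop),
    integral_map (by fun_prop) (by fun_prop)]
  simp only [hagree, hW.fieldFlow_self ht] at hconst
  exact hconst

lemma Measure.ext_of_isCompact {μ ν : Measure E} [IsFiniteMeasure μ] [IsFiniteMeasure ν]
    (h : ∀ K : Set E, IsCompact K → μ K = ν K) : μ = ν := by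
  ext s hs
  rw [hs.measure_eq_iSup_isCompact, hs.measure_eq_iSup_isCompact]
  exact iSup_congr fun K => iSup_congr fun _ => iSup_congr fun hK => h K hK

/-- The flow of the velocity field transports the noisy laws into each other. -/
theorem map_fieldFlow_noised {s t : ℝ} (hs : 0 < s) (ht : 0 < t) :
    (noised p s).map (fieldFlow (flowVelocity p) s t) = noised p t := by
  have hc := (isTameField_flowVelocity p).continuous_fieldFlow hs ht
  have : IsProbabilityMeasure ((noised p s).map (fieldFlow (flowVelocity p) s t)) :=
    Measure.isProbabilityMeasure_map hc.aemeasurable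
  refine Measure.ext_of_isCompact fun C hC => ?_
  have hδ : ∀ k : ℕ, 0 < 1 / ((k : ℝ) + 1) := fun k => by positivity
  -- Thickened indicators of a compact set are Lipschitz with bounded support, so conservation
  -- applies to them.
  have h1 := tendsto_integral_thickenedIndicator_of_isClosed
    ((noised p s).map (fieldFlow (flowVelocity p) s t)) hC.isClosed hδ
    tendsto_one_div_add_atTop_nhds_zero_nat
  have h2 := tendsto_integral_thickenedIndicator_of_isClosed (noised p t) hC.isClosed hδ
    tendsto_one_div_add_atTop_nhds_zero_nat
  refine (measureReal_eq_measureReal_iff).1 (tendsto_nhds_unique h1 (h2.congr fun k => ?_))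
  obtain ⟨ρ, hρ⟩ := (hC.isBounded.thickening (δ := 1 / ((k : ℝ) + 1))).exists_norm_le
  rw [integral_map hc.aemeasurable (by fun_prop)]
  refine (integral_fieldFlow_noised hs ht
    (f := fun x => (thickenedIndicator (hδ k) C x : ℝ))
    ((LipschitzWith.subtype_val _).comp (lipschitzWith_thickenedIndicator (hδ k) C)) (M := 1) (ρ := ρ)
    (fun x => ?_) fun x hx => ?_).symm
  · rw [abs_of_nonneg (NNReal.coe_nonneg _)]
    exact_mod_cast thickenedIndicator_le_one (hδ k) C x
  · rw [NNReal.coe_eq_zero]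
    exact thickenedIndicator_zero (hδ k) C fun h => (hρ x h).not_gt hx

end Transport

/-! ### Extension of almost every flow line to time zero. -/

section Trajectories

variable {E : Type*} [NormedAddCommGroup E] [InnerProductSpace ℝ E] [FiniteDimensional ℝ E]
  [MeasurableSpace E] [BorelSpace E] {p : Measure E} [IsProbabilityMeasure p]

/-- The velocity along the flow, as a function of logarithmic time, is jointly measurable. -/
lemma measurable_velocity_fieldFlow_exp {V : ℝ → E → E} (hV : IsTameField V)
    (hc : ∀ t, 0 < t → Continuous (V t)) {T : ℝ} (hT : 0 < T) :
    Measurable fun q : ℝ × E => V (Real.exp q.1) (fieldFlow V T (Real.exp q.1) q.2) := by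
  -- A Carathéodory function. Logarithmic time gives continuity on all of `ℝ`, whereas in `t` it is
  -- known only on `(0, ∞)`.
  have h1 : Measurable (Function.uncurry fun (τ : ℝ) (x : E) => V (Real.exp τ) x) :=
    measurable_uncurry_of_continuous_of_measurable
      (fun x => (hV.continuousOn x).comp_continuous Real.continuous_exp Real.exp_pos)
      (fun τ => (hc _ (Real.exp_pos τ)).measurable)
  have h2 : Measurable (Function.uncurry fun (τ : ℝ) (x : E) => fieldFlow V T (Real.exp τ) x) :=
    measurable_uncurry_of_continuous_of_measurable
      (fun x => continuous_iff_continuousAt.2 fun τ =>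
        ContinuousAt.comp (f := Real.exp) (g := fun r => fieldFlow V T r x)
          (hV.hasDerivAt_fieldFlow hT x (Real.exp_pos τ)).continuousAt
          Real.continuous_exp.continuousAt)
      (fun τ => (hV.continuous_fieldFlow hT (Real.exp_pos τ)).measurable)
  exact h1.comp (measurable_fst.prodMk h2)

/-- By Tonelli and transport, the expected length of a flow line over `(0, T)` is at most `T E ‖Z‖`.
-/
lemma ae_lintegral_velocity_lt_top {T : ℝ} (hT : 0 < T) :
    ∀ᵐ x ∂(noised p T), ∫⁻ t in Set.Ioo 0 T,
      ‖flowVelocity p t (fieldFlow (flowVelocity p) T t x)‖ₑ < ∞ := by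
  have hV := isTameField_flowVelocity p
  have hm := measurable_velocity_fieldFlow_exp hV (fun t ht => continuous_flowVelocity ht) hT
  set g : E → ℝ → ℝ≥0∞ := fun x t => ‖flowVelocity p (Real.exp (Real.log t))
    (fieldFlow (flowVelocity p) T (Real.exp (Real.log t)) x)‖ₑ with hg
  have hgm : Measurable (Function.uncurry g) := by
    refine measurable_enorm.comp (hm.comp (f := fun q : E × ℝ => (Real.log q.2, q.1)) ?_)
    exact (Real.measurable_log.comp measurable_snd).prodMk measurable_fst
  have hgeq : ∀ x, ∫⁻ t in Set.Ioo 0 T, ‖flowVelocity p t (fieldFlow (flowVelocity p) T t x)‖ₑ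
      = ∫⁻ t in Set.Ioo 0 T, g x t := fun x =>
    setLIntegral_congr_fun measurableSet_Ioo fun t ht => by
      simp only [hg, Real.exp_log ht.1]
  simp_rw [hgeq]
  refine ae_lt_top hgm.lintegral_prod_right' ?_
  rw [lintegral_lintegral_swap hgm.aemeasurable]
  refine ne_of_lt ?_
  calc ∫⁻ t in Set.Ioo 0 T, ∫⁻ x, g x t ∂(noised p T)
      ≤ ∫⁻ _ in Set.Ioo 0 T, ∫⁻ z, ‖z‖ₑ ∂(stdGaussian E) := by
        refine setLIntegral_mono' measurableSet_Ioo fun t ht => ?_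
        simp only [hg, Real.exp_log ht.1]
        rw [← lintegral_map (f := fun x => ‖flowVelocity p t x‖ₑ)
          (continuous_flowVelocity ht.1).measurable.enorm
          (hV.continuous_fieldFlow hT ht.1).measurable, map_fieldFlow_noised hT ht.1]
        exact lintegral_enorm_flowVelocity_le ht.1
    _ < ∞ := by
        rw [setLIntegral_const]
        exact ENNReal.mul_lt_top lintegral_enorm_stdGaussian_lt_top (by simp)

/-- A solution with integrable velocity extends continuously to time zero. -/
lemma exists_continuousOn_extension {V : ℝ → E → E} (hV : IsTameField V) {T : ℝ} (hT : 0 < T)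
    {x : E} (hm : Measurable fun τ : ℝ => V (Real.exp τ) (fieldFlow V T (Real.exp τ) x))
    (hfin : ∫⁻ t in Set.Ioo 0 T, ‖V t (fieldFlow V T t x)‖ₑ < ∞) :
    ∃ y : ℝ → E, ContinuousOn y (Set.Icc 0 T) ∧ y T = x ∧
      ∀ t ∈ Set.Ioo 0 T, y t = fieldFlow V T t x := by
  set v : ℝ → E := fun t => V t (fieldFlow V T t x) with hv
  have hmeas : AEStronglyMeasurable v (volume.restrict (Set.Ioo 0 T)) := by
    refine AEStronglyMeasurable.congr
      ((hm.comp Real.measurable_log).aestronglyMeasurable) ?_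
    filter_upwards [ae_restrict_mem measurableSet_Ioo] with t ht
    simp [hv, Real.exp_log ht.1]
  have hint : IntegrableOn v (Set.Icc 0 T) := by
    rw [integrableOn_Icc_iff_integrableOn_Ioo]
    exact ⟨hmeas, hfin⟩
  refine ⟨fun t => x - ∫ r in t..T, v r, ?_, by simp, fun t ht => ?_⟩
  · have := intervalIntegral.continuousOn_primitive_interval_left (f := v) (a := 0) (b := T)
      (μ := volume) (by rwa [Set.uIcc_of_le hT.le])
    rw [Set.uIcc_of_le hT.le] at this
    exact continuousOn_const.sub this
  · have hsub : Set.uIcc t T ⊆ Set.Icc 0 T := by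
      rw [Set.uIcc_of_le ht.2.le]
      exact Set.Icc_subset_Icc_left ht.1.le
    have := intervalIntegral.integral_eq_sub_of_hasDerivAt (a := t) (b := T)
      (f := fun r => fieldFlow V T r x) (f' := v)
      (fun r hr => by
        rw [Set.uIcc_of_le ht.2.le] at hr
        exact hV.hasDerivAt_fieldFlow hT x (ht.1.trans_le hr.1))
      (hint.mono_set hsub).intervalIntegrable
    simp only [this, hV.fieldFlow_self hT, sub_sub_cancel]

lemma ae_exists_continuousOn_extension {T : ℝ} (hT : 0 < T) :
    ∀ᵐ x ∂(noised p T), ∃ y : ℝ → E, ContinuousOn y (Set.Icc 0 T) ∧ y T = x ∧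
      ∀ t ∈ Set.Ioo 0 T, y t = fieldFlow (flowVelocity p) T t x := by
  have hV := isTameField_flowVelocity p
  have hm := measurable_velocity_fieldFlow_exp hV (fun t ht => continuous_flowVelocity ht) hT
  filter_upwards [ae_lintegral_velocity_lt_top (p := p) hT] with x hx
  have hm' : Measurable fun τ : ℝ => flowVelocity p (Real.exp τ)
      (fieldFlow (flowVelocity p) T (Real.exp τ) x) :=
    hm.comp (f := fun τ : ℝ => (τ, x)) (measurable_id.prodMk measurable_const)
  exact exists_continuousOn_extension hV hT hm' hx

end Trajectories

/-! ### Trajectories and the noise-to-image map. -/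

section NoiseToImage

variable {n : ℕ} {p : Measure (EuclideanSpace ℝ (Fin n))} [IsProbabilityMeasure p]

lemma IsPFTrajectory.hasDerivAt_flowVelocity {T : ℝ} {xT : EuclideanSpace ℝ (Fin n)}
    {x : ℝ → EuclideanSpace ℝ (Fin n)} (hx : IsPFTrajectory p T xT x) {t : ℝ}
    (ht : t ∈ Set.Ioo 0 T) : HasDerivAt x (flowVelocity p t (x t)) t := by
  rw [← neg_smul_score ht.1]
  exact hx.hasDerivAt t ht

/-- Trajectories are restrictions of the flow of the velocity field. -/
lemma IsPFTrajectory.eq_fieldFlow {T : ℝ} {xT : EuclideanSpace ℝ (Fin n)}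
    {x : ℝ → EuclideanSpace ℝ (Fin n)} (hx : IsPFTrajectory p T xT x) {t : ℝ}
    (ht : t ∈ Set.Ioo 0 T) : x t = fieldFlow (flowVelocity p) T t xT := by
  have hV := isTameField_flowVelocity p
  have hT : 0 < T := ht.1.trans ht.2
  -- The ODE holds only at interior times, so the flow is based at `t` and matched with `xT` by
  -- letting the time increase to `T`.
  have heq := hV.eqOn_fieldFlow le_rfl ht fun r hr => hx.hasDerivAt_flowVelocity hr
  have h1 : Tendsto x (𝓝[<] T) (𝓝 xT) := by
    have := hx.continuousOn T ⟨hT.le, le_rfl⟩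
    rw [ContinuousWithinAt, hx.terminal] at this
    exact this.mono_left (nhdsWithin_le_iff.2 (mem_of_superset (Ioo_mem_nhdsLT hT)
      Set.Ioo_subset_Icc_self))
  have h2 : Tendsto x (𝓝[<] T) (𝓝 (fieldFlow (flowVelocity p) t T (x t))) := by
    have h3 := (hV.hasDerivAt_fieldFlow ht.1 (x t) hT).continuousAt.tendsto.mono_left
      (nhdsWithin_le_nhds (s := Set.Iio T))
    refine h3.congr' ?_
    filter_upwards [Ioo_mem_nhdsLT hT] with r hr using (heq hr).symm
  rw [tendsto_nhds_unique h1 h2, hV.fieldFlow_fieldFlow ht.1 hT ht.1, hV.fieldFlow_self ht.1]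

theorem IsPFTrajectory.eqOn {T : ℝ} (hT : 0 < T) {xT : EuclideanSpace ℝ (Fin n)}
    {x y : ℝ → EuclideanSpace ℝ (Fin n)} (hx : IsPFTrajectory p T xT x)
    (hy : IsPFTrajectory p T xT y) : Set.EqOn x y (Set.Icc 0 T) := by
  have : Set.EqOn x y (Set.Ioo 0 T) := fun t ht => by rw [hx.eq_fieldFlow ht, hy.eq_fieldFlow ht]
  exact this.of_subset_closure hx.continuousOn hy.continuousOn Set.Ioo_subset_Icc_self
    (by rw [closure_Ioo hT.ne])

lemma ae_exists_isPFTrajectory_noised {T : ℝ} (hT : 0 < T) :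
    ∀ᵐ xT ∂(noised p T), ∃ x, IsPFTrajectory p T xT x := by
  have hV := isTameField_flowVelocity p
  filter_upwards [ae_exists_continuousOn_extension (p := p) hT] with xT hxT
  obtain ⟨y, hyc, hyT, hy⟩ := hxT
  refine ⟨y, hyc, hyT, fun t ht => ?_⟩
  rw [neg_smul_score ht.1, hy t ht]
  exact (hV.hasDerivAt_fieldFlow hT xT ht.1).congr_of_eventuallyEq
    (Filter.eventually_of_mem (Ioo_mem_nhds ht.1 ht.2) hy)

theorem ae_exists_isPFTrajectory (p : Measure (EuclideanSpace ℝ (Fin n))) [IsProbabilityMeasure p]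
    {T : ℝ} (hT : 0 < T) :
    ∀ᵐ xT ∂(volume : Measure (EuclideanSpace ℝ (Fin n))), ∃ x, IsPFTrajectory p T xT x :=
  (volume_absolutelyContinuous_noised hT.ne').ae_le (ae_exists_isPFTrajectory_noised hT)

lemma noiseToImage_eq {T : ℝ} (hT : 0 < T) {xT : EuclideanSpace ℝ (Fin n)}
    {x : ℝ → EuclideanSpace ℝ (Fin n)} (hx : IsPFTrajectory p T xT x) :
    noiseToImage p T xT = x 0 := by
  have h : ∃ x, IsPFTrajectory p T xT x := ⟨x, hx⟩
  rw [noiseToImage, dif_pos h]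
  exact h.choose_spec.eqOn hT hx ⟨le_rfl, hT.le⟩

lemma tendsto_fieldFlow_noiseToImage {T : ℝ} (hT : 0 < T) {xT : EuclideanSpace ℝ (Fin n)}
    (h : ∃ x, IsPFTrajectory p T xT x) :
    Tendsto (fun t => fieldFlow (flowVelocity p) T t xT) (𝓝[>] 0) (𝓝 (noiseToImage p T xT)) := by
  obtain ⟨x, hx⟩ := h
  rw [noiseToImage_eq hT hx]
  have h1 : Tendsto x (𝓝[>] 0) (𝓝 (x 0)) :=
    (hx.continuousOn 0 ⟨le_rfl, hT.le⟩).mono_left (nhdsWithin_le_iff.2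
      (mem_of_superset (Ioo_mem_nhdsGT hT) Set.Ioo_subset_Icc_self))
  refine h1.congr' ?_
  filter_upwards [Ioo_mem_nhdsGT hT] with t ht using hx.eq_fieldFlow ht

/-- A vanishing sequence of times along which the flow converges to the noise-to-image map. -/
lemma ae_tendsto_fieldFlow_noiseToImage {T : ℝ} (hT : 0 < T) :
    ∀ᵐ xT ∂(noised p T), Tendsto (fun k : ℕ => fieldFlow (flowVelocity p) T (1 / ((k : ℝ) + 1)) xT)
      atTop (𝓝 (noiseToImage p T xT)) := by
  filter_upwards [ae_exists_isPFTrajectory_noised (p := p) hT] with xT hxT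
  refine (tendsto_fieldFlow_noiseToImage hT hxT).comp
    (tendsto_nhdsWithin_iff.2 ⟨tendsto_one_div_add_atTop_nhds_zero_nat, ?_⟩)
  exact Eventually.of_forall fun k => by rw [Set.mem_Ioi]; positivity

/-- The map is defined by choice; it is measurable up to null sets as an almost everywhere limit of
continuous flow maps. -/
lemma aemeasurable_noiseToImage_noised {T : ℝ} (hT : 0 < T) :
    AEMeasurable (noiseToImage p T) (noised p T) :=
  aemeasurable_of_tendsto_metrizable_ae' (fun k => ((isTameField_flowVelocity p).continuous_fieldFlow
    hT (by positivity)).aemeasurable) (ae_tendsto_fieldFlow_noiseToImage hT)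

lemma aemeasurable_noiseToImage (p : Measure (EuclideanSpace ℝ (Fin n))) [IsProbabilityMeasure p]
    {T : ℝ} (hT : 0 < T) :
    AEMeasurable (noiseToImage p T) (volume : Measure (EuclideanSpace ℝ (Fin n))) :=
  (aemeasurable_noiseToImage_noised hT).mono_ac (volume_absolutelyContinuous_noised hT.ne')

/-- The noise-to-image map transports the noisy law at time `T` to the clean law. -/
theorem map_noiseToImage {T : ℝ} (hT : 0 < T) : (noised p T).map (noiseToImage p T) = p := by
  have hme := aemeasurable_noiseToImage_noised (p := p) hT
  have : IsProbabilityMeasure ((noised p T).map (noiseToImage p T)) :=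
    Measure.isProbabilityMeasure_map hme
  refine ext_of_forall_integral_eq_of_IsFiniteMeasure fun f => ?_
  have hpos : ∀ k : ℕ, 0 < 1 / ((k : ℝ) + 1) := fun k => by positivity
  have hflow := fun k => (isTameField_flowVelocity p).continuous_fieldFlow hT (hpos k)
  rw [integral_map hme f.continuous.aestronglyMeasurable]
  have h1 : Tendsto (fun k : ℕ => ∫ x, f (fieldFlow (flowVelocity p) T (1 / ((k : ℝ) + 1)) x)
      ∂(noised p T)) atTop (𝓝 (∫ x, f (noiseToImage p T x) ∂(noised p T))) := by
    refine tendsto_integral_of_dominated_convergence (fun _ => ‖f‖)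
      (fun k => (f.continuous.comp (hflow k)).aestronglyMeasurable) (integrable_const _)
      (fun k => ae_of_all _ fun x => f.norm_coe_le_norm _) ?_
    filter_upwards [ae_tendsto_fieldFlow_noiseToImage (p := p) hT] with x hx
    exact (f.continuous.tendsto _).comp hx
  have h2 : ∀ k : ℕ, ∫ x, f (fieldFlow (flowVelocity p) T (1 / ((k : ℝ) + 1)) x) ∂(noised p T)
      = ∫ ω : EuclideanSpace ℝ (Fin n) × EuclideanSpace ℝ (Fin n),
        f (ω.1 + (1 / ((k : ℝ) + 1)) • ω.2) ∂(p.prod (stdGaussian _)) := fun k => by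
    rw [← integral_map (f := f) (hflow k).aemeasurable f.continuous.aestronglyMeasurable,
      map_fieldFlow_noised hT (hpos k), noised,
      integral_map (by fun_prop) f.continuous.aestronglyMeasurable]
  simp_rw [h2] at h1
  refine tendsto_nhds_unique h1 ?_
  have h3 : ∫ x, f x ∂p = ∫ ω : EuclideanSpace ℝ (Fin n) × EuclideanSpace ℝ (Fin n),
      f ω.1 ∂(p.prod (stdGaussian _)) := by
    rw [integral_fun_fst (f := f)]; simp
  rw [h3]
  refine tendsto_integral_of_dominated_convergence (fun _ => ‖f‖)
    (fun k => (f.continuous.comp (by fun_prop)).aestronglyMeasurable) (integrable_const _)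
    (fun k => ae_of_all _ fun x => f.norm_coe_le_norm _) (ae_of_all _ fun ω => ?_)
  have h4 : Tendsto (fun k : ℕ => ω.1 + (1 / ((k : ℝ) + 1)) • ω.2) atTop (𝓝 (ω.1 + (0 : ℝ) • ω.2)) :=
    tendsto_const_nhds.add (tendsto_one_div_add_atTop_nhds_zero_nat.smul_const _)
  rw [zero_smul, add_zero] at h4
  exact (f.continuous.tendsto _).comp h4

end NoiseToImage

/-! ### Pure noise and noisy data merge in total variation. -/

section TotalVariation

variable {E : Type*} [NormedAddCommGroup E] [InnerProductSpace ℝ E] [FiniteDimensional ℝ E]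
  [MeasurableSpace E] [BorelSpace E] {p : Measure E} [IsProbabilityMeasure p]

lemma continuous_noisyMass (t : ℝ) : Continuous (noisyMass p t) :=
  continuous_iff_continuousAt.2 fun x => (hasFDerivAt_noisyMass x).continuousAt

/-- The substitution `x = s z` allows comparison with the fixed weight `gaussWeight` as `s → ∞`. -/
lemma integral_noised {s : ℝ} (hs : 0 < s) {h : E → ℝ} :
    ∫ x, h x ∂(noised p s) = gaussConst E * ∫ z, h (s • z) * noisyMass p s (s • z) := by
  have hM := continuous_noisyMass (p := p) s
  rw [noised_eq_withDensity p hs.ne', integral_withDensity_eq_integral_toReal_smul (by fun_prop)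
    (ae_of_all _ fun _ => ENNReal.ofReal_lt_top),
    Measure.integral_comp_smul volume (fun x => h x * noisyMass p s x) s, smul_eq_mul,
    ← integral_const_mul, ← integral_const_mul]
  refine integral_congr_ae (ae_of_all _ fun x => ?_)
  simp only [smul_eq_mul]
  rw [ENNReal.toReal_ofReal (mul_pos (noiseConst_pos hs.ne') (noisyMass_pos s x)).le, noiseConst]
  ring

lemma integral_noisyMass_smul {s : ℝ} (hs : 0 < s) :
    ∫ z, noisyMass p s (s • z) = (gaussConst E)⁻¹ := by
  have h := integral_noised (p := p) hs (h := fun _ => 1)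
  simp only [integral_const, one_mul, probReal_univ, smul_eq_mul] at h
  exact eq_inv_of_mul_eq_one_right h.symm

lemma integrable_noisyMass_smul {s : ℝ} (hs : 0 < s) :
    Integrable fun z => noisyMass p s (s • z) := by
  by_contra h
  have := integral_undef h
  rw [integral_noisyMass_smul hs] at this
  exact (inv_pos.2 (gaussConst_pos (E := E))).ne' this

lemma tendsto_noisyMass_smul (z : E) :
    Tendsto (fun T : ℝ => noisyMass p T (T • z)) atTop (𝓝 (gaussWeight z)) := by
  have h : Tendsto (fun T : ℝ => noisyMass p T (T • z)) atTop (𝓝 (∫ _, gaussWeight z ∂p)) := by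
    refine tendsto_integral_filter_of_dominated_convergence (fun _ => 1)
      (Eventually.of_forall fun T => (integrable_gaussWeight T _).aestronglyMeasurable)
      (Eventually.of_forall fun T => ae_of_all _ fun y => ?_) (integrable_const _)
      (ae_of_all _ fun y => ?_)
    · rw [Real.norm_of_nonneg (gaussWeight_pos _).le]
      exact gaussWeight_le_one _
    · refine (continuous_gaussWeight.tendsto z).comp ?_
      have h1 : Tendsto (fun T : ℝ => z - T⁻¹ • y) atTop (𝓝 (z - (0 : ℝ) • y)) :=
        tendsto_const_nhds.sub (tendsto_inv_atTop_zero.smul_const y)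
      rw [zero_smul, sub_zero] at h1
      refine h1.congr' ?_
      filter_upwards [eventually_gt_atTop 0] with T hT
      rw [smul_sub, inv_smul_smul₀ hT.ne']
  simpa using h

variable (p) in
/-- (Up to a constant) the total variation distance between `N(0, T² I)` and `p * N(0, T² I)`. -/
noncomputable def noiseGap (T : ℝ) : ℝ := ∫ z, |gaussWeight z - noisyMass p T (T • z)|

/-- Scheffé's argument. -/
lemma tendsto_noiseGap : Tendsto (noiseGap p) atTop (𝓝 0) := by
  -- The positive part is dominated by `gaussWeight` uniformly in `T`. As both functions have the
  -- same integral, the gap is twice its integral.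
  have h1 : Tendsto (fun T : ℝ => ∫ z, max (gaussWeight z - noisyMass p T (T • z)) 0) atTop
      (𝓝 (∫ _ : E, (0 : ℝ))) := by
    refine tendsto_integral_filter_of_dominated_convergence gaussWeight
      (Eventually.of_forall fun T => ?_) (Eventually.of_forall fun T => ae_of_all _ fun z => ?_)
      integrable_gaussWeight_volume (ae_of_all _ fun z => ?_)
    · have := continuous_noisyMass (p := p) T
      exact Continuous.aestronglyMeasurable (by fun_prop)
    · rw [Real.norm_of_nonneg (le_max_right _ _)]
      exact max_le (by linarith [noisyMass_pos (p := p) T (T • z)]) (gaussWeight_pos z).le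
    · have := ((tendsto_const_nhds (x := gaussWeight z)).sub
        (tendsto_noisyMass_smul (p := p) z)).max (tendsto_const_nhds (x := (0 : ℝ)))
      simpa using this
  have h2 : Tendsto (fun T : ℝ => 2 * ∫ z, max (gaussWeight z - noisyMass p T (T • z)) 0) atTop
      (𝓝 0) := by simpa using h1.const_mul 2
  refine h2.congr' ?_
  filter_upwards [eventually_gt_atTop 0] with T hT
  have hi : Integrable fun z => gaussWeight z - noisyMass p T (T • z) :=
    integrable_gaussWeight_volume.sub (integrable_noisyMass_smul hT)
  have h3 : ∫ z, (gaussWeight z - noisyMass p T (T • z)) = 0 := by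
    rw [integral_sub integrable_gaussWeight_volume (integrable_noisyMass_smul hT),
      integral_gaussWeight, integral_noisyMass_smul hT, sub_self]
  have h4 : ∀ z : E, |gaussWeight z - noisyMass p T (T • z)|
      = 2 * max (gaussWeight z - noisyMass p T (T • z)) 0
        - (gaussWeight z - noisyMass p T (T • z)) := fun z => by
    rcases le_total (gaussWeight z - noisyMass p T (T • z)) 0 with h | h
    · rw [max_eq_right h, abs_of_nonpos h]; ring
    · rw [max_eq_left h, abs_of_nonneg h]; ring
  simp_rw [noiseGap, h4]
  rw [integral_sub (hi.pos_part.const_mul 2) hi, h3, sub_zero, integral_const_mul]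

lemma integral_map_smul_stdGaussian (T : ℝ) {h : E → ℝ} (hh : Measurable h) :
    ∫ x, h x ∂((stdGaussian E).map fun z => T • z)
      = gaussConst E * ∫ z, h (T • z) * gaussWeight z := by
  rw [integral_map (by fun_prop) hh.aestronglyMeasurable, stdGaussian_eq_withDensity,
    integral_withDensity_eq_integral_toReal_smul (by fun_prop)
      (ae_of_all _ fun _ => ENNReal.ofReal_lt_top), ← integral_const_mul]
  refine integral_congr_ae (ae_of_all _ fun x => ?_)
  simp only [smul_eq_mul]
  rw [ENNReal.toReal_ofReal (mul_pos gaussConst_pos (gaussWeight_pos x)).le]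
  ring

lemma abs_integral_sub_noised_le {T : ℝ} (hT : 0 < T) {h : E → ℝ} (hh : Measurable h) {M : ℝ}
    (hM : ∀ x, |h x| ≤ M) :
    |∫ x, h x ∂((stdGaussian E).map fun z => T • z) - ∫ x, h x ∂(noised p T)|
      ≤ gaussConst E * (M * noiseGap p T) := by
  have hm : Measurable fun z : E => h (T • z) := hh.comp (by fun_prop)
  have hi1 : Integrable fun z : E => h (T • z) * gaussWeight z :=
    integrable_gaussWeight_volume.bdd_mul hm.aestronglyMeasurable (ae_of_all _ fun z => hM _)
  have hi2 : Integrable fun z : E => h (T • z) * noisyMass p T (T • z) :=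
    (integrable_noisyMass_smul hT).bdd_mul hm.aestronglyMeasurable (ae_of_all _ fun z => hM _)
  rw [integral_map_smul_stdGaussian T hh, integral_noised hT, ← mul_sub, abs_mul,
    abs_of_pos gaussConst_pos, ← integral_sub hi1 hi2, noiseGap, ← integral_const_mul]
  refine mul_le_mul_of_nonneg_left ?_ gaussConst_pos.le
  have hi : Integrable fun z : E => M * |gaussWeight z - noisyMass p T (T • z)| :=
    ((integrable_gaussWeight_volume.sub (integrable_noisyMass_smul hT)).abs).const_mul M
  rw [← Real.norm_eq_abs]
  refine norm_integral_le_of_norm_le hi (ae_of_all _ fun z => ?_)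
  rw [← mul_sub, norm_mul]
  exact mul_le_mul_of_nonneg_right (hM _) (norm_nonneg _)

lemma map_smul_stdGaussian_absolutelyContinuous {T : ℝ} (hT : T ≠ 0) :
    (stdGaussian E).map (fun z => T • z) ≪ volume := by
  have h1 : stdGaussian E ≪ volume := by
    rw [stdGaussian_eq_withDensity]; exact withDensity_absolutelyContinuous _ _
  have h2 := map_add_smul_volume (0 : E) hT
  simp only [zero_add] at h2
  refine (h1.map (by fun_prop : Measurable fun z : E => T • z)).trans ?_
  rw [h2]
  exact Measure.smul_absolutelyContinuous

end TotalVariation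

/-! ### Weak limits of couplings. -/

section CouplingLimit

variable {E : Type*} [NormedAddCommGroup E] [CompleteSpace E] [SecondCountableTopology E]
  [MeasurableSpace E] [BorelSpace E]

lemma isTightMeasureSet_range_of_tendsto {μ : ℕ → ProbabilityMeasure E} {p : ProbabilityMeasure E}
    (h : Tendsto μ atTop (𝓝 p)) : IsTightMeasureSet (Set.range fun k => (μ k : Measure E)) := by
  have h1 : IsCompact (closure (Set.range μ)) :=
    h.isCompact_insert_range.closure_of_subset (Set.subset_insert _ _)
  refine (isTightMeasureSet_of_isCompact_closure h1).subset ?_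
  rintro _ ⟨k, rfl⟩
  exact ⟨μ k, ⟨k, rfl⟩, rfl⟩

/-- Weak limits of couplings of bounded quadratic cost. -/
lemma exists_coupling_of_tendsto {γ : ℕ → ProbabilityMeasure (E × E)}
    {p q : ProbabilityMeasure E}
    (h₁ : Tendsto (fun k => (γ k).map (measurable_fst (α := E) (β := E)).aemeasurable) atTop (𝓝 p))
    (h₂ : Tendsto (fun k => (γ k).map (measurable_snd (α := E) (β := E)).aemeasurable) atTop (𝓝 q))
    {c : ℝ≥0∞} (hc : ∀ k, ∫⁻ z, ‖z.1 - z.2‖ₑ ^ 2 ∂(γ k : Measure (E × E)) ≤ c) :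
    ∃ g : Measure (E × E), g.map Prod.fst = p ∧ g.map Prod.snd = q ∧
      ∫⁻ z, ‖z.1 - z.2‖ₑ ^ 2 ∂g ≤ c := by
  have ht : IsTightMeasureSet {((μ : ProbabilityMeasure (E × E)) : Measure (E × E)) |
      μ ∈ Set.range γ} := by
    refine IsTightMeasureSet.prodMk ?_ ?_
    · refine (isTightMeasureSet_range_of_tendsto h₁).subset ?_
      rintro _ ⟨_, ⟨_, ⟨k, rfl⟩, rfl⟩, rfl⟩
      exact ⟨k, rfl⟩
    · refine (isTightMeasureSet_range_of_tendsto h₂).subset ?_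
      rintro _ ⟨_, ⟨_, ⟨k, rfl⟩, rfl⟩, rfl⟩
      exact ⟨k, rfl⟩
  obtain ⟨g, -, φ, hφ, hg⟩ := (isCompact_closure_of_isTightMeasureSet ht).tendsto_subseq
    (fun k => subset_closure (Set.mem_range_self k))
  have hfst := ((ProbabilityMeasure.continuous_map (continuous_fst (X := E) (Y := E))).tendsto
    g).comp hg
  have hsnd := ((ProbabilityMeasure.continuous_map (continuous_snd (X := E) (Y := E))).tendsto
    g).comp hg
  refine ⟨g, ?_, ?_, ?_⟩
  · exact congrArg (fun μ : ProbabilityMeasure E => (μ : Measure E)) (tendsto_nhds_unique hfst (h₁.comp hφ.tendsto_atTop))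
  · exact congrArg (fun μ : ProbabilityMeasure E => (μ : Measure E)) (tendsto_nhds_unique hsnd (h₂.comp hφ.tendsto_atTop))
  · have e : ∀ z : E × E, ‖z.1 - z.2‖ₑ ^ 2 = ENNReal.ofReal (‖z.1 - z.2‖ ^ 2) := fun z => by
      rw [ENNReal.ofReal_pow (norm_nonneg _), ofReal_norm]
    simp_rw [e] at hc ⊢
    -- The cost is continuous but unbounded, so only lower semicontinuity is available, from the
    -- portmanteau theorem on open sets.
    refine (lintegral_le_liminf_lintegral_of_forall_isOpen_measure_le_liminf_measure
      (μs := fun k => (γ (φ k) : Measure (E × E))) (f := fun z => ‖z.1 - z.2‖ ^ 2) (by fun_prop)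
      (fun z => by positivity)
      (fun G hG => ProbabilityMeasure.le_liminf_measure_open_of_tendsto hg hG)).trans ?_
    exact liminf_le_of_frequently_le' (Frequently.of_forall fun k => hc _)

end CouplingLimit

/-! ### The Wasserstein lower bound. -/

section LowerBound

variable {n : ℕ}

lemma multivariateGaussian_zero_smul_one {T : ℝ} (hT : 0 ≤ T) :
    multivariateGaussian 0 (T ^ 2 • (1 : Matrix (Fin n) (Fin n) ℝ))
      = (stdGaussian (EuclideanSpace ℝ (Fin n))).map fun z => T • z := by
  have h1 : CFC.sqrt (T ^ 2 • (1 : Matrix (Fin n) (Fin n) ℝ)) = T • 1 := by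
    refine CFC.sqrt_unique (by simp [pow_two, smul_smul]) ?_
    exact smul_nonneg hT zero_le_one
  rw [multivariateGaussian, h1]
  simp

/-- Under Gaussian noise, the law of the noise-to-image map converges to the clean law. -/
lemma tendsto_integral_noiseToImage (p : Measure (EuclideanSpace ℝ (Fin n)))
    [IsProbabilityMeasure p] {f : EuclideanSpace ℝ (Fin n) → ℝ} (hf : Continuous f) {M : ℝ}
    (hM : ∀ x, |f x| ≤ M) :
    Tendsto (fun T : ℝ => ∫ x, f (noiseToImage p T x)
      ∂((stdGaussian (EuclideanSpace ℝ (Fin n))).map fun z => T • z)) atTop (𝓝 (∫ x, f x ∂p)) := by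
  rw [tendsto_iff_norm_sub_tendsto_zero]
  have h0 := ((tendsto_noiseGap (p := p)).const_mul M).const_mul
    (gaussConst (EuclideanSpace ℝ (Fin n)))
  simp only [mul_zero] at h0
  refine squeeze_zero' (Eventually.of_forall fun _ => norm_nonneg _) ?_ h0
  filter_upwards [eventually_gt_atTop 0] with T hT
  have hae := aemeasurable_noiseToImage p hT
  -- The total variation estimate needs a measurable function. Both laws are absolutely continuous,
  -- so one measurable version serves for both.
  set Φ := hae.mk (noiseToImage p T) with hΦ
  have hΦm : Measurable Φ := hae.measurable_mk
  have hmap := map_noiseToImage (p := p) hT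
  have e1 : ∫ x, f (noiseToImage p T x)
      ∂((stdGaussian (EuclideanSpace ℝ (Fin n))).map fun z => T • z) = ∫ x, f (Φ x)
      ∂((stdGaussian (EuclideanSpace ℝ (Fin n))).map fun z => T • z) := by
    refine integral_congr_ae ?_
    filter_upwards [(map_smul_stdGaussian_absolutelyContinuous hT.ne').ae_le hae.ae_eq_mk] with x hx
    rw [hx]
  have e2 : ∫ x, f x ∂p = ∫ x, f (Φ x) ∂(noised p T) := by
    conv_lhs => rw [← hmap]
    rw [integral_map (aemeasurable_noiseToImage_noised hT) hf.aestronglyMeasurable]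
    refine integral_congr_ae ?_
    filter_upwards [(noised_absolutelyContinuous_volume hT.ne').ae_le hae.ae_eq_mk] with x hx
    rw [hx]
  rw [e1, e2, Real.norm_eq_abs]
  exact abs_integral_sub_noised_le hT (hf.measurable.comp hΦm) fun x => hM _

/-- For `c` above the lower limit there are times `T k → ∞` with `pfdAt` below `c`. The joint laws
of the two images then have cost at most `c²` and asymptotically correct marginals; a weak limit is
an exact coupling. -/
theorem wasserstein2_le_pfd (p q : Measure (EuclideanSpace ℝ (Fin n))) [IsProbabilityMeasure p]
    [IsProbabilityMeasure q] : wasserstein2 p q ≤ pfd p q := by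
  refine le_of_forall_gt_imp_ge_of_dense fun c hc => ?_
  have hfreq := (frequently_lt_of_liminf_lt (by isBoundedDefault) hc).and_eventually
    (eventually_gt_atTop (0 : ℝ))
  obtain ⟨T, hT, hTc⟩ := exists_seq_forall_of_frequently hfreq
  set ν : ℝ → Measure (EuclideanSpace ℝ (Fin n)) := fun T =>
    (stdGaussian (EuclideanSpace ℝ (Fin n))).map fun z => T • z with hν
  have hνp : ∀ T, IsProbabilityMeasure (ν T) := fun T =>
    Measure.isProbabilityMeasure_map (by fun_prop)
  have hmeas : ∀ (r : Measure (EuclideanSpace ℝ (Fin n))) [IsProbabilityMeasure r] (k : ℕ),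
      AEMeasurable (noiseToImage r (T k)) (ν (T k)) := fun r _ k =>
    (aemeasurable_noiseToImage r (hTc k).2).mono_ac
      (map_smul_stdGaussian_absolutelyContinuous (hTc k).2.ne')
  have hpair := fun k => (hmeas p k).prodMk (hmeas q k)
  obtain ⟨γ, hγ⟩ : ∃ γ : ℕ → ProbabilityMeasure (EuclideanSpace ℝ (Fin n) ×
      EuclideanSpace ℝ (Fin n)), ∀ k, (γ k : Measure (EuclideanSpace ℝ (Fin n) ×
      EuclideanSpace ℝ (Fin n))) =
        (ν (T k)).map fun x => (noiseToImage p (T k) x, noiseToImage q (T k) x) :=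
    ⟨fun k => ⟨_, Measure.isProbabilityMeasure_map (hpair k)⟩, fun k => rfl⟩
  have hlim : ∀ (r : Measure (EuclideanSpace ℝ (Fin n))) [IsProbabilityMeasure r]
      (f : BoundedContinuousFunction (EuclideanSpace ℝ (Fin n)) ℝ),
      Tendsto (fun k => ∫ x, f (noiseToImage r (T k) x) ∂(ν (T k))) atTop (𝓝 (∫ x, f x ∂r)) :=
    fun r _ f => (tendsto_integral_noiseToImage r f.continuous
      (fun x => f.norm_coe_le_norm x)).comp hT
  obtain ⟨p', hp'⟩ : ∃ p' : ProbabilityMeasure (EuclideanSpace ℝ (Fin n)),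
      (p' : Measure (EuclideanSpace ℝ (Fin n))) = p := ⟨⟨p, inferInstance⟩, rfl⟩
  obtain ⟨q', hq'⟩ : ∃ q' : ProbabilityMeasure (EuclideanSpace ℝ (Fin n)),
      (q' : Measure (EuclideanSpace ℝ (Fin n))) = q := ⟨⟨q, inferInstance⟩, rfl⟩
  have h₁ : Tendsto (fun k => (γ k).map measurable_fst.aemeasurable) atTop
      (𝓝 p') := by
    rw [ProbabilityMeasure.tendsto_iff_forall_integral_tendsto]
    intro f
    rw [hp']
    refine (hlim p f).congr fun k => ?_
    rw [ProbabilityMeasure.toMeasure_map, hγ, integral_map (by fun_prop) f.continuous.aestronglyMeasurable, integral_map (hpair k)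
      (f := fun z => f z.1) (f.continuous.comp continuous_fst).aestronglyMeasurable]
  have h₂ : Tendsto (fun k => (γ k).map measurable_snd.aemeasurable) atTop
      (𝓝 q') := by
    rw [ProbabilityMeasure.tendsto_iff_forall_integral_tendsto]
    intro f
    rw [hq']
    refine (hlim q f).congr fun k => ?_
    rw [ProbabilityMeasure.toMeasure_map, hγ, integral_map (by fun_prop) f.continuous.aestronglyMeasurable, integral_map (hpair k)
      (f := fun z => f z.2) (f.continuous.comp continuous_snd).aestronglyMeasurable]
  have hcost : ∀ k, ∫⁻ z, ‖z.1 - z.2‖ₑ ^ 2 ∂(γ k : Measure (EuclideanSpace ℝ (Fin n)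
      × EuclideanSpace ℝ (Fin n))) ≤ c ^ (2 : ℝ) := fun k => by
    rw [hγ, lintegral_map' (by fun_prop) (hpair k)]
    have := (hTc k).1.le
    rw [pfdAt, multivariateGaussian_zero_smul_one (hTc k).2.le] at this
    have h2 := ENNReal.rpow_le_rpow this (by norm_num : (0 : ℝ) ≤ 2)
    rw [← ENNReal.rpow_mul] at h2
    norm_num at h2
    simpa using h2
  obtain ⟨g, hg1, hg2, hg⟩ := exists_coupling_of_tendsto (p := p') (q := q') h₁ h₂ hcost
  have hgmem : g ∈ couplings p q := ⟨hg1.trans hp', hg2.trans hq'⟩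
  rw [wasserstein2]
  refine iInf₂_le_of_le g hgmem ?_
  refine (ENNReal.rpow_le_rpow hg (by norm_num)).trans ?_
  rw [← ENNReal.rpow_mul]
  norm_num

end LowerBound

/-! ### Operators diagonal in an orthonormal basis. -/

section DiagonalMap

variable {E : Type*} [NormedAddCommGroup E] [InnerProductSpace ℝ E] {ι : Type*} [Fintype ι]

/-- The operator with eigenvalues `f i` in the orthonormal basis `b`. -/
noncomputable def diagonalMap (b : OrthonormalBasis ι ℝ E) (f : ι → ℝ) : E →L[ℝ] E :=
  ∑ i, f i • (innerSL ℝ (b i)).smulRight (b i)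

variable (b : OrthonormalBasis ι ℝ E)

lemma diagonalMap_apply (f : ι → ℝ) (x : E) :
    diagonalMap b f x = ∑ i, (f i * inner ℝ (b i) x) • b i := by
  simp [diagonalMap, mul_smul]

lemma inner_diagonalMap (f : ι → ℝ) (x : E) (i : ι) :
    inner ℝ (b i) (diagonalMap b f x) = f i * inner ℝ (b i) x := by
  rw [diagonalMap_apply, b.orthonormal.inner_right_fintype]

lemma inner_diagonalMap_left (f : ι → ℝ) (x y : E) :
    inner ℝ (diagonalMap b f x) y = ∑ i, f i * inner ℝ (b i) x * inner ℝ (b i) y := by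
  simp [diagonalMap_apply, sum_inner, real_inner_smul_left]

lemma norm_sq_diagonalMap (f : ι → ℝ) (x : E) :
    ‖diagonalMap b f x‖ ^ 2 = ∑ i, (f i * inner ℝ (b i) x) ^ 2 := by
  simp_rw [← b.sum_sq_inner_right (diagonalMap b f x), inner_diagonalMap]

lemma norm_diagonalMap_le {f : ι → ℝ} {M : ℝ} (hM : ∀ i, |f i| ≤ M) (hM0 : 0 ≤ M) (x : E) :
    ‖diagonalMap b f x‖ ≤ M * ‖x‖ := by
  refine abs_le_of_sq_le_sq' ?_ (by positivity) |>.2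
  rw [norm_sq_diagonalMap, mul_pow, ← b.sum_sq_inner_right x, Finset.mul_sum]
  refine Finset.sum_le_sum fun i _ => ?_
  rw [mul_pow]
  refine mul_le_mul_of_nonneg_right ?_ (sq_nonneg _)
  exact sq_le_sq' (abs_le.1 (hM i)).1 (abs_le.1 (hM i)).2

lemma diagonalMap_diagonalMap (f g : ι → ℝ) (x : E) :
    diagonalMap b f (diagonalMap b g x) = diagonalMap b (fun i => f i * g i) x := by
  rw [diagonalMap_apply]
  simp_rw [inner_diagonalMap, ← mul_assoc]
  rw [diagonalMap_apply]

lemma diagonalMap_smul (c : ℝ) (f : ι → ℝ) (x : E) :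
    diagonalMap b f (c • x) = diagonalMap b (fun i => f i * c) x := by
  simp_rw [diagonalMap_apply, real_inner_smul_right, mul_assoc]

lemma diagonalMap_one (x : E) : diagonalMap b (fun _ => 1) x = x := by
  simp [diagonalMap_apply, b.sum_repr']

lemma eq_diagonalMap {A : E →L[ℝ] E} {f : ι → ℝ} (h : ∀ i, A (b i) = f i • b i) :
    A = diagonalMap b f := by
  ext x
  conv_lhs => rw [← b.sum_repr' x]
  simp [diagonalMap_apply, h, smul_smul, mul_comm]

lemma diagonalMap_basis (f : ι → ℝ) (i : ι) : diagonalMap b f (b i) = f i • b i := by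
  classical
  simp [diagonalMap_apply, b.inner_eq_ite]

lemma tendsto_diagonalMap {X : Type*} {l : Filter X} {f : X → ι → ℝ} {g : ι → ℝ}
    (h : ∀ i, Tendsto (fun t => f t i) l (𝓝 (g i))) (x : E) :
    Tendsto (fun t => diagonalMap b (f t) x) l (𝓝 (diagonalMap b g x)) := by
  simp_rw [diagonalMap_apply]
  exact tendsto_finsetSum _ fun i _ => ((h i).mul_const _).smul_const _

lemma hasDerivAt_diagonalMap {f : ℝ → ι → ℝ} {f' : ι → ℝ} {t : ℝ}
    (h : ∀ i, HasDerivAt (fun s => f s i) (f' i) t) (x : E) :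
    HasDerivAt (fun s => diagonalMap b (f s) x) (diagonalMap b f' x) t := by
  simp_rw [diagonalMap_apply]
  exact HasDerivAt.fun_sum fun i _ => ((h i).mul_const _).smul_const _

end DiagonalMap

/-! ### The velocity field of a Gaussian. -/

section GaussianVelocity

variable {E : Type*} [NormedAddCommGroup E] [InnerProductSpace ℝ E] [FiniteDimensional ℝ E]
  [MeasurableSpace E] [BorelSpace E] {ι : Type*} [Fintype ι] (b : OrthonormalBasis ι ℝ E)

/-- Completion of the square in an eigenbasis of the covariance. -/
lemma gaussWeight_mul_gaussWeight_diagonalMap {t : ℝ} (ht : 0 < t) (α : ι → ℝ) (w z : E) :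
    gaussWeight z * gaussWeight (t⁻¹ • (w - diagonalMap b α z))
      = Real.exp (-(∑ i, (α i ^ 2 + t ^ 2)⁻¹ * inner ℝ (b i) w ^ 2) / 2)
        * Real.exp (-(∑ i, (α i ^ 2 + t ^ 2) / t ^ 2 * inner ℝ (b i)
          (z - diagonalMap b (fun i => α i / (α i ^ 2 + t ^ 2)) w) ^ 2) / 2) := by
  rw [gaussWeight, gaussWeight, ← Real.exp_add, ← Real.exp_add, ← b.sum_sq_inner_right z,
    ← b.sum_sq_inner_right (t⁻¹ • (w - diagonalMap b α z)), ← add_div, ← add_div, ← neg_add,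
    ← neg_add, ← Finset.sum_add_distrib, ← Finset.sum_add_distrib]
  congr 3
  refine Finset.sum_congr rfl fun i _ => ?_
  rw [real_inner_smul_right, inner_sub_right, inner_diagonalMap, inner_sub_right,
    inner_diagonalMap]
  have : α i ^ 2 + t ^ 2 ≠ 0 := by positivity
  field_simp
  ring

/-- After completing the square, `x` enters the second factor only as a translation of `z`, so its
integral `K` is constant. It cancels in the velocity and is never evaluated. -/
lemma noisyMass_map_diagonalMap {t : ℝ} (ht : 0 < t) (μ : E) (α : ι → ℝ) :
    ∃ K : ℝ, ∀ x, noisyMass ((stdGaussian E).map fun z => μ + diagonalMap b α z) t x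
      = K * Real.exp (-(∑ i, (α i ^ 2 + t ^ 2)⁻¹ * inner ℝ (b i) (x - μ) ^ 2) / 2) := by
  refine ⟨∫ z, gaussConst E * Real.exp (-(∑ i, (α i ^ 2 + t ^ 2) / t ^ 2 * inner ℝ (b i) z ^ 2) / 2),
    fun x => ?_⟩
  rw [noisyMass, integral_map (by fun_prop) (by fun_prop), stdGaussian_eq_withDensity,
    integral_withDensity_eq_integral_toReal_smul (by fun_prop) (by simp)]
  rw [← integral_sub_right_eq_self (fun z => gaussConst E * Real.exp (-(∑ i, (α i ^ 2 + t ^ 2) /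
      t ^ 2 * inner ℝ (b i) z ^ 2) / 2)) (diagonalMap b (fun i => α i / (α i ^ 2 + t ^ 2)) (x - μ)),
    ← integral_mul_const]
  refine integral_congr_ae (ae_of_all _ fun z => ?_)
  have h := gaussWeight_mul_gaussWeight_diagonalMap b ht α (x - μ) z
  have hc := (gaussConst_pos (E := E)).le
  simp only [smul_eq_mul]
  rw [ENNReal.toReal_ofReal (mul_nonneg hc (gaussWeight_pos _).le), ← sub_sub, mul_assoc, h]
  ring

/-- The derivative of the mass in a direction `v` is computed twice, through the moment and from the
closed form; comparing the two gives the moment. -/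
theorem flowVelocity_map_diagonalMap {t : ℝ} (ht : 0 < t) (μ : E) (α : ι → ℝ) (x : E) :
    flowVelocity ((stdGaussian E).map fun z => μ + diagonalMap b α z) t x
      = diagonalMap b (fun i => t / (α i ^ 2 + t ^ 2)) (x - μ) := by
  have : IsProbabilityMeasure ((stdGaussian E).map fun z => μ + diagonalMap b α z) :=
    Measure.isProbabilityMeasure_map (by fun_prop)
  obtain ⟨K, hK⟩ := noisyMass_map_diagonalMap b ht μ α
  set p := (stdGaussian E).map fun z => μ + diagonalMap b α z
  have hM := noisyMass_pos (p := p) t x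
  have h1 := hasFDerivAt_noisyMass (p := p) (t := t) x
  rw [funext hK] at h1
  rw [flowVelocity, inv_smul_eq_iff₀ hM.ne']
  refine ext_inner_right ℝ fun v => ?_
  have h2 := h1.comp_hasDerivAt_of_eq (0 : ℝ) (f := fun s : ℝ => x + s • v)
    ((((hasDerivAt_id (0 : ℝ)).smul_const v)).const_add x) (by simp)
  have h3 : HasDerivAt (fun s : ℝ => K * Real.exp (-(∑ i, (α i ^ 2 + t ^ 2)⁻¹ *
      inner ℝ (b i) (x + s • v - μ) ^ 2) / 2))
      (K * (Real.exp (-(∑ i, (α i ^ 2 + t ^ 2)⁻¹ * inner ℝ (b i) (x - μ) ^ 2) / 2) *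
        (-(∑ i, (α i ^ 2 + t ^ 2)⁻¹ * (2 * inner ℝ (b i) (x - μ) * inner ℝ (b i) v)) / 2))) 0 := by
    have h4 : ∀ i, HasDerivAt (fun s : ℝ => (α i ^ 2 + t ^ 2)⁻¹ *
        inner ℝ (b i) (x + s • v - μ) ^ 2)
        ((α i ^ 2 + t ^ 2)⁻¹ * (2 * inner ℝ (b i) (x - μ) * inner ℝ (b i) v)) 0 := fun i => by
      have h5 : HasDerivAt (fun s : ℝ => inner ℝ (b i) (x - μ) + s * inner ℝ (b i) v)
          (inner ℝ (b i) v) 0 := by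
        simpa using ((hasDerivAt_id (0 : ℝ)).mul_const (inner ℝ (b i) v)).const_add
          (inner ℝ (b i) (x - μ))
      have h6 := (h5.fun_pow 2).const_mul (α i ^ 2 + t ^ 2)⁻¹
      simp only [zero_mul, add_zero] at h6
      have h7 : (fun s : ℝ => (α i ^ 2 + t ^ 2)⁻¹ * inner ℝ (b i) (x + s • v - μ) ^ 2)
          = fun s : ℝ => (α i ^ 2 + t ^ 2)⁻¹ *
            (inner ℝ (b i) (x - μ) + s * inner ℝ (b i) v) ^ 2 := by
        funext s
        rw [add_sub_right_comm, inner_add_right, real_inner_smul_right]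
      rw [h7]
      simpa using h6
    have h7 := ((HasDerivAt.fun_sum fun i (_ : i ∈ Finset.univ) => h4 i).fun_neg.div_const 2).exp.const_mul K
    simpa using h7
  have h8 := h2.unique h3
  simp only [_root_.smul_apply, one_smul, innerSL_apply_apply, smul_eq_mul] at h8
  have h9 : inner ℝ (noisyMoment p t x) v = -t * (-t⁻¹ * inner ℝ (noisyMoment p t x) v) := by
    field_simp
  have h10 : ∑ i, (α i ^ 2 + t ^ 2)⁻¹ * (2 * inner ℝ (b i) (x - μ) * inner ℝ (b i) v)
      = 2 / t * ∑ i, t / (α i ^ 2 + t ^ 2) * inner ℝ (b i) (x - μ) * inner ℝ (b i) v := by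
    rw [Finset.mul_sum]
    refine Finset.sum_congr rfl fun i _ => ?_
    have : α i ^ 2 + t ^ 2 ≠ 0 := by positivity
    field_simp
  rw [real_inner_smul_left, hK x, inner_diagonalMap_left, h9, h8, h10]
  field_simp

end GaussianVelocity

/-! ### Common eigenbases of commuting symmetric operators. -/

section SimultaneousDiagonalization

variable {E : Type*} [NormedAddCommGroup E] [InnerProductSpace ℝ E] [FiniteDimensional ℝ E]

open Module Module.End in
/-- Commuting symmetric operators have a common orthonormal eigenbasis. -/
theorem exists_eq_diagonalMap_of_commute {n : ℕ} (hn : finrank ℝ E = n) {A B : E →L[ℝ] E}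
    (hA : (A : E →ₗ[ℝ] E).IsSymmetric) (hB : (B : E →ₗ[ℝ] E).IsSymmetric)
    (hAB : Commute (A : E →ₗ[ℝ] E) (B : E →ₗ[ℝ] E)) :
    ∃ (b : OrthonormalBasis (Fin n) ℝ E) (α β : Fin n → ℝ),
      A = diagonalMap b α ∧ B = diagonalMap b β := by
  classical
  -- Indexing by eigenvalues instead of all reals makes the family finite, as a subordinate basis
  -- requires; the omitted intersections are zero.
  let V : Eigenvalues (B : E →ₗ[ℝ] E) × Eigenvalues (A : E →ₗ[ℝ] E) → Submodule ℝ E := fun i =>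
    eigenspace (A : E →ₗ[ℝ] E) (i.2 : ℝ) ⊓ eigenspace (B : E →ₗ[ℝ] E) (i.1 : ℝ)
  have hV' : OrthogonalFamily ℝ (fun i => V i) fun i => (V i).subtypeₗᵢ :=
    (LinearMap.IsSymmetric.orthogonalFamily_eigenspace_inf_eigenspace hA hB).comp
      (γ := Eigenvalues (B : E →ₗ[ℝ] E) × Eigenvalues (A : E →ₗ[ℝ] E))
      (f := fun i => ((i.1 : ℝ), (i.2 : ℝ)))
      fun i j h => by
        rw [Prod.mk.injEq] at h
        exact Prod.ext (Subtype.ext h.1) (Subtype.ext h.2)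
  have hV : DirectSum.IsInternal V := by
    rw [hV'.isInternal_iff, Submodule.orthogonal_eq_bot_iff, eq_top_iff,
      ← LinearMap.IsSymmetric.iSup_iSup_eigenspace_inf_eigenspace_eq_top_of_commute hA hB hAB]
    refine iSup_le fun α => iSup_le fun β => ?_
    by_cases h : eigenspace (A : E →ₗ[ℝ] E) α ⊓ eigenspace (B : E →ₗ[ℝ] E) β = ⊥
    · rw [h]; exact bot_le
    · have h1 : HasEigenvalue (A : E →ₗ[ℝ] E) α := fun h' => h (by
        rw [eq_bot_iff]; exact inf_le_left.trans h'.le)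
      have h2 : HasEigenvalue (B : E →ₗ[ℝ] E) β := fun h' => h (by
        rw [eq_bot_iff]; exact inf_le_right.trans h'.le)
      exact le_iSup V (⟨β, h2⟩, ⟨α, h1⟩)
  have hmem := fun a => hV.subordinateOrthonormalBasis_subordinate hn a hV'
  refine ⟨hV.subordinateOrthonormalBasis hn hV', _, _,
    eq_diagonalMap _ fun a => mem_eigenspace_iff.1 (hmem a).1,
    eq_diagonalMap _ fun a => mem_eigenspace_iff.1 (hmem a).2⟩

end SimultaneousDiagonalization

/-! ### Diagonalization of positive semidefinite matrices. -/

section SqrtOperator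

variable {n : ℕ}

lemma isSymmetric_toEuclideanCLM {A : Matrix (Fin n) (Fin n) ℝ} (hA : A.IsHermitian) :
    (Matrix.toEuclideanCLM (𝕜 := ℝ) A : EuclideanSpace ℝ (Fin n) →ₗ[ℝ]
      EuclideanSpace ℝ (Fin n)).IsSymmetric := by
  rw [Matrix.coe_toEuclideanCLM_eq_toEuclideanLin]
  exact Matrix.isSymmetric_toEuclideanLin_iff.2 hA

/-- Two commuting positive semidefinite matrices are diagonal in a common orthonormal basis. -/
lemma exists_toEuclideanCLM_eq_diagonalMap_of_commute {A B : Matrix (Fin n) (Fin n) ℝ}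
    (hA : 0 ≤ A) (hB : 0 ≤ B) (hAB : Commute A B) :
    ∃ (b : OrthonormalBasis (Fin n) ℝ (EuclideanSpace ℝ (Fin n))) (α β : Fin n → ℝ),
      (∀ i, 0 ≤ α i) ∧ (∀ i, 0 ≤ β i) ∧ Matrix.toEuclideanCLM (𝕜 := ℝ) A = diagonalMap b α ∧
        Matrix.toEuclideanCLM (𝕜 := ℝ) B = diagonalMap b β := by
  have hA' : A.PosSemidef := Matrix.nonneg_iff_posSemidef.1 hA
  have hB' : B.PosSemidef := Matrix.nonneg_iff_posSemidef.1 hB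
  obtain ⟨b, α, β, h1, h2⟩ := exists_eq_diagonalMap_of_commute
    (finrank_euclideanSpace_fin (𝕜 := ℝ) (n := n)) (isSymmetric_toEuclideanCLM hA'.isHermitian)
    (isSymmetric_toEuclideanCLM hB'.isHermitian) (by
      have := hAB.map (Matrix.toEuclideanCLM (n := Fin n) (𝕜 := ℝ))
      exact congrArg (fun L : EuclideanSpace ℝ (Fin n) →L[ℝ] EuclideanSpace ℝ (Fin n) =>
        (L : EuclideanSpace ℝ (Fin n) →ₗ[ℝ] EuclideanSpace ℝ (Fin n))) this.eq)
  have key : ∀ {C : Matrix (Fin n) (Fin n) ℝ} {f : Fin n → ℝ}, C.PosSemidef →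
      Matrix.toEuclideanCLM (𝕜 := ℝ) C = diagonalMap b f → ∀ i, 0 ≤ f i := fun {C f} hC h i => by
    have h3 := Matrix.inner_toEuclideanCLM C (b i) (b i)
    rw [h, diagonalMap_basis, real_inner_smul_right, real_inner_self_eq_norm_sq,
      b.orthonormal.1 i] at h3
    have h4 := hC.dotProduct_mulVec_nonneg (b i).ofLp
    simp only [star_trivial] at h4
    linarith
  exact ⟨b, α, β, key hA' h1, key hB' h2, h1, h2⟩

end SqrtOperator

/-! ### Explicit Gaussian trajectories and their limit. -/

section GaussianTrajectory

variable {E : Type*} [NormedAddCommGroup E] [InnerProductSpace ℝ E] [FiniteDimensional ℝ E]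
  [MeasurableSpace E] [BorelSpace E] {ι : Type*} [Fintype ι] (b : OrthonormalBasis ι ℝ E)

/-- The solution of the probability flow ODE of a Gaussian. -/
lemma hasDerivAt_gaussianTrajectory {T t : ℝ} (ht : 0 < t) (μ x : E) (α : ι → ℝ) :
    HasDerivAt (fun s => μ + diagonalMap b
        (fun i => Real.sqrt (α i ^ 2 + s ^ 2) / Real.sqrt (α i ^ 2 + T ^ 2)) (x - μ))
      (flowVelocity ((stdGaussian E).map fun z => μ + diagonalMap b α z) t
        (μ + diagonalMap b
          (fun i => Real.sqrt (α i ^ 2 + t ^ 2) / Real.sqrt (α i ^ 2 + T ^ 2)) (x - μ))) t := by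
  rw [flowVelocity_map_diagonalMap b ht, add_sub_cancel_left, diagonalMap_diagonalMap]
  refine (hasDerivAt_diagonalMap b (fun i => ?_) (x - μ)).const_add μ
  have h0 : 0 < α i ^ 2 + t ^ 2 := by positivity
  have h1 := ((((hasDerivAt_id t).fun_pow 2).const_add (α i ^ 2)).sqrt h0.ne').div_const
    (Real.sqrt (α i ^ 2 + T ^ 2))
  refine h1.congr_deriv ?_
  have h2 : Real.sqrt (α i ^ 2 + t ^ 2) ≠ 0 := (Real.sqrt_pos.2 h0).ne'
  have h3 := Real.sq_sqrt h0.le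
  simp only [id, Nat.cast_ofNat, Nat.add_one_sub_one, pow_one, mul_one]
  rw [← mul_div_assoc]
  congr 1
  rw [div_mul_eq_mul_div, div_eq_div_iff (by positivity) h0.ne']
  linear_combination (-2 * t) * h3

variable {n : ℕ}

/-- Each coordinate of `x_t - μ` is proportional to the standard deviation `√(α² + t²)` of the noisy
law. At time 0 this is `|α|`, so `0 ≤ α` is what gives `α`. -/
theorem noiseToImage_map_diagonalMap
    (b : OrthonormalBasis ι ℝ (EuclideanSpace ℝ (Fin n))) {T : ℝ} (hT : 0 < T)
    (μ x : EuclideanSpace ℝ (Fin n)) {α : ι → ℝ} (hα : ∀ i, 0 ≤ α i) :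
    noiseToImage ((stdGaussian _).map fun z => μ + diagonalMap b α z) T x
      = μ + diagonalMap b (fun i => α i / Real.sqrt (α i ^ 2 + T ^ 2)) (x - μ) := by
  have : IsProbabilityMeasure ((stdGaussian _).map fun z => μ + diagonalMap b α z) :=
    Measure.isProbabilityMeasure_map (by fun_prop)
  have hx : IsPFTrajectory ((stdGaussian _).map fun z => μ + diagonalMap b α z) T x
      (fun s => μ + diagonalMap b
        (fun i => Real.sqrt (α i ^ 2 + s ^ 2) / Real.sqrt (α i ^ 2 + T ^ 2)) (x - μ)) := by
    refine ⟨?_, ?_, fun t ht => ?_⟩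
    · simp_rw [diagonalMap_apply]
      fun_prop
    · have : ∀ i, Real.sqrt (α i ^ 2 + T ^ 2) / Real.sqrt (α i ^ 2 + T ^ 2) = 1 := fun i =>
        div_self (by positivity)
      simp_rw [this]
      rw [diagonalMap_one, add_sub_cancel]
    · rw [neg_smul_score ht.1]
      exact hasDerivAt_gaussianTrajectory b ht.1 μ x α
  rw [noiseToImage_eq hT hx]
  simp [Real.sqrt_sq (hα _)]

lemma noiseToImage_smul_map_diagonalMap
    (b : OrthonormalBasis ι ℝ (EuclideanSpace ℝ (Fin n))) {T : ℝ} (hT : 0 < T)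
    (μ ε : EuclideanSpace ℝ (Fin n)) {α : ι → ℝ} (hα : ∀ i, 0 ≤ α i) :
    noiseToImage ((stdGaussian _).map fun z => μ + diagonalMap b α z) T (T • ε)
      = μ + (diagonalMap b (fun i => α i / Real.sqrt (α i ^ 2 + T ^ 2) * T) ε
        - diagonalMap b (fun i => α i / Real.sqrt (α i ^ 2 + T ^ 2)) μ) := by
  rw [noiseToImage_map_diagonalMap b hT μ _ hα, map_sub, diagonalMap_smul]

lemma tendsto_sqrt_add_sq_atTop (a : ℝ) :
    Tendsto (fun T : ℝ => Real.sqrt (a ^ 2 + T ^ 2)) atTop atTop :=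
  Real.tendsto_sqrt_atTop.comp
    (tendsto_atTop_add_const_left _ _ (tendsto_pow_atTop two_ne_zero))

lemma tendsto_div_sqrt_add_sq (a : ℝ) :
    Tendsto (fun T : ℝ => a / Real.sqrt (a ^ 2 + T ^ 2)) atTop (𝓝 0) :=
  tendsto_const_nhds.div_atTop (tendsto_sqrt_add_sq_atTop a)

lemma tendsto_div_sqrt_add_sq_mul (a : ℝ) :
    Tendsto (fun T : ℝ => a / Real.sqrt (a ^ 2 + T ^ 2) * T) atTop (𝓝 a) := by
  -- For `T > 0`, `T / √(a² + T²) = √(1 - (a / √(a² + T²))²)`, which reduces to the previous limit.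
  have h1 := (((tendsto_div_sqrt_add_sq a).pow 2).const_sub 1).sqrt.const_mul a
  simp only [ne_eq, OfNat.ofNat_ne_zero, not_false_eq_true, zero_pow, sub_zero, Real.sqrt_one,
    mul_one] at h1
  refine h1.congr' ?_
  filter_upwards [eventually_gt_atTop 0] with T hT
  have h0 : 0 < a ^ 2 + T ^ 2 := by positivity
  have h2 : 1 - (a / Real.sqrt (a ^ 2 + T ^ 2)) ^ 2 = T ^ 2 / (a ^ 2 + T ^ 2) := by
    rw [div_pow, Real.sq_sqrt h0.le]
    field_simp
    ring
  rw [h2, Real.sqrt_div (by positivity), Real.sqrt_sq hT.le]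
  ring

theorem tendsto_noiseToImage_smul_map_diagonalMap
    (b : OrthonormalBasis ι ℝ (EuclideanSpace ℝ (Fin n)))
    (μ ε : EuclideanSpace ℝ (Fin n)) {α : ι → ℝ} (hα : ∀ i, 0 ≤ α i) :
    Tendsto (fun T : ℝ => noiseToImage ((stdGaussian _).map fun z => μ + diagonalMap b α z) T
      (T • ε)) atTop (𝓝 (μ + diagonalMap b α ε)) := by
  have h1 := tendsto_diagonalMap b (fun i => tendsto_div_sqrt_add_sq_mul (α i)) ε
  have h2 := tendsto_diagonalMap b (fun i => tendsto_div_sqrt_add_sq (α i)) μ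
  have h3 := (h1.sub h2).const_add μ
  have h4 : diagonalMap b (fun _ => 0) μ = 0 := by simp [diagonalMap_apply]
  rw [h4, sub_zero] at h3
  refine h3.congr' ?_
  filter_upwards [eventually_gt_atTop 0] with T hT
  rw [noiseToImage_smul_map_diagonalMap b hT μ ε hα]

/-- The bound is uniform in `T` and dominates in the passage to the limit; the sum of the `α i` is a
crude bound for the largest one. -/
lemma norm_noiseToImage_smul_map_diagonalMap_le
    (b : OrthonormalBasis ι ℝ (EuclideanSpace ℝ (Fin n))) {T : ℝ} (hT : 0 < T)
    (μ ε : EuclideanSpace ℝ (Fin n)) {α : ι → ℝ} (hα : ∀ i, 0 ≤ α i) :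
    ‖noiseToImage ((stdGaussian _).map fun z => μ + diagonalMap b α z) T (T • ε)‖
      ≤ 2 * ‖μ‖ + (∑ i, α i) * ‖ε‖ := by
  rw [noiseToImage_smul_map_diagonalMap b hT μ ε hα]
  have hs : ∀ i, 0 < Real.sqrt (α i ^ 2 + T ^ 2) := fun i => Real.sqrt_pos.2 (by positivity)
  have h1 : ∀ i, |α i / Real.sqrt (α i ^ 2 + T ^ 2)| ≤ 1 := fun i => by
    rw [abs_of_nonneg (div_nonneg (hα i) (hs i).le), div_le_one (hs i)]
    exact Real.le_sqrt_of_sq_le (by nlinarith [sq_nonneg T])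
  have h2 : ∀ i, |α i / Real.sqrt (α i ^ 2 + T ^ 2) * T| ≤ ∑ i, α i := fun i => by
    rw [abs_of_nonneg (mul_nonneg (div_nonneg (hα i) (hs i).le) hT.le), div_mul_eq_mul_div,
      div_le_iff₀ (hs i)]
    refine mul_le_mul (Finset.single_le_sum (fun j _ => hα j) (Finset.mem_univ i)) ?_ hT.le
      (Finset.sum_nonneg fun j _ => hα j)
    exact Real.le_sqrt_of_sq_le (by nlinarith [sq_nonneg (α i)])
  have h3 := norm_diagonalMap_le b h1 zero_le_one μ
  have h4 := norm_diagonalMap_le b h2 (Finset.sum_nonneg fun j _ => hα j) ε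
  refine (norm_add_le _ _).trans ?_
  linarith [norm_sub_le (diagonalMap b (fun i => α i / Real.sqrt (α i ^ 2 + T ^ 2) * T) ε)
    (diagonalMap b (fun i => α i / Real.sqrt (α i ^ 2 + T ^ 2)) μ)]

end GaussianTrajectory

/-! ### Second moments of affine images of the standard Gaussian. -/

section SecondMoment

lemma lintegral_enorm_sq_eq_ofReal {Ω F : Type*} [MeasurableSpace Ω] [NormedAddCommGroup F]
    {μ : Measure Ω} [IsFiniteMeasure μ] {f : Ω → F} (hf : MemLp f 2 μ) :
    ∫⁻ ω, ‖f ω‖ₑ ^ 2 ∂μ = ENNReal.ofReal (∫ ω, ‖f ω‖ ^ 2 ∂μ) := by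
  rw [ofReal_integral_eq_lintegral_ofReal hf.integrable_norm_pow'
    (ae_of_all _ fun _ => by positivity)]
  refine lintegral_congr fun ω => ?_
  rw [ENNReal.ofReal_pow (norm_nonneg _), ofReal_norm]

variable {E : Type*} [NormedAddCommGroup E] [InnerProductSpace ℝ E] [FiniteDimensional ℝ E]
  [MeasurableSpace E] [BorelSpace E] {ι : Type*} [Fintype ι]

lemma memLp_affine_stdGaussian {F : Type*} [NormedAddCommGroup F] [NormedSpace ℝ F] (a : F)
    (L : E →L[ℝ] F) : MemLp (fun z => a + L z) 2 (stdGaussian E) :=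
  (memLp_const a).add (L.comp_memLp' IsGaussian.memLp_two_id)

lemma memLp_add_mul_norm_stdGaussian (a c : ℝ) :
    MemLp (fun z => a + c * ‖z‖) 2 (stdGaussian E) := by
  have h : MemLp (fun z : E => ‖z‖) 2 (stdGaussian E) := IsGaussian.memLp_two_id.norm
  exact (memLp_const a).add (h.const_mul c)

lemma integral_affine_stdGaussian (c : ℝ) (L : StrongDual ℝ E) :
    ∫ z, (c + L z) ∂(stdGaussian E) = c := by
  have h : Integrable (fun z => L z) (stdGaussian E) := L.integrable_comp IsGaussian.integrable_id
  rw [integral_add (integrable_const c) h]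
  simp

lemma variance_affine_stdGaussian (c : ℝ) (L : StrongDual ℝ E) :
    Var[fun z => c + L z; stdGaussian E] = ‖L‖ ^ 2 := by
  rw [variance_const_add (by fun_prop), ← variance_dual_stdGaussian]

lemma integral_sq_affine_stdGaussian (c : ℝ) (L : StrongDual ℝ E) :
    ∫ z, (c + L z) ^ 2 ∂(stdGaussian E) = c ^ 2 + ‖L‖ ^ 2 := by
  have h := variance_eq_sub (memLp_affine_stdGaussian c L)
  rw [variance_affine_stdGaussian, integral_affine_stdGaussian] at h
  simp only [Pi.pow_apply] at h
  linarith

/-- The coordinate `⟨b i, B z⟩` is centred with variance `‖B* b i‖²`. The basis is free: the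
standard one yields the Frobenius norm, a common eigenbasis the sum of `(α i - β i)²`. -/
lemma integral_norm_sq_affine_stdGaussian (b : OrthonormalBasis ι ℝ E) (a : E) (B : E →L[ℝ] E) :
    ∫ z, ‖a + B z‖ ^ 2 ∂(stdGaussian E) = ‖a‖ ^ 2 + ∑ i, ‖B.adjoint (b i)‖ ^ 2 := by
  have e : ∀ i z, inner ℝ (b i) (a + B z) = inner ℝ (b i) a + innerSL ℝ (B.adjoint (b i)) z :=
    fun i z => by
      rw [inner_add_right, innerSL_apply_apply, ContinuousLinearMap.adjoint_inner_left]
  simp_rw [← b.sum_sq_inner_right, e]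
  rw [integral_finsetSum _ fun i _ => (memLp_affine_stdGaussian _ _).integrable_sq]
  simp_rw [integral_sq_affine_stdGaussian, innerSL_apply_norm]
  rw [Finset.sum_add_distrib, b.sum_sq_inner_right]
  simp_rw [b.sum_sq_inner_right]

end SecondMoment

/-! ### A lower bound on the cost of Gaussian couplings. -/

section CouplingLowerBound

/-- Reverse triangle inequality for standard deviations. -/
lemma sq_sub_le_variance_sub {Ω : Type*} [MeasurableSpace Ω] {P : Measure Ω}
    [IsProbabilityMeasure P] {X Y : Ω → ℝ} (hX : MemLp X 2 P) (hY : MemLp Y 2 P) {α β : ℝ}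
    (hα : 0 ≤ α) (hβ : 0 ≤ β) (hαX : Var[X; P] = α ^ 2) (hβY : Var[Y; P] = β ^ 2) :
    (α - β) ^ 2 ≤ Var[X - Y; P] := by
  -- This is `Var[X - s Y]`; its discriminant gives Cauchy–Schwarz for the covariance.
  have h1 : ∀ s : ℝ, 0 ≤ β ^ 2 * (s * s) + (-2 * cov[X, Y; P]) * s + α ^ 2 := fun s => by
    have h2 := variance_sub hX (hY.const_smul s)
    rw [variance_smul, covariance_smul_right, hαX, hβY] at h2
    have h3 := variance_nonneg (X - s • Y) P
    nlinarith
  have h4 := discrim_le_zero h1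
  rw [discrim] at h4
  have h5 : cov[X, Y; P] ≤ α * β :=
    abs_le_of_sq_le_sq' (by nlinarith) (mul_nonneg hα hβ) |>.2
  rw [variance_sub hX hY, hαX, hβY]
  nlinarith

variable {E : Type*} [NormedAddCommGroup E] [InnerProductSpace ℝ E] [FiniteDimensional ℝ E]
  [MeasurableSpace E] [BorelSpace E] {ι : Type*} [Fintype ι]

/-- Moments of a coordinate of a variable with Gaussian law. -/
lemma moments_inner_of_map_eq {Ω : Type*} [MeasurableSpace Ω] {P : Measure Ω} {X : Ω → E}
    (hX : Measurable X) (b : OrthonormalBasis ι ℝ E) {μ : E} {α : ι → ℝ}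
    (h : P.map X = (stdGaussian E).map fun z => μ + diagonalMap b α z) (i : ι) :
    MemLp (fun ω => inner ℝ (b i) (X ω)) 2 P ∧ ∫ ω, inner ℝ (b i) (X ω) ∂P = inner ℝ (b i) μ ∧
      Var[fun ω => inner ℝ (b i) (X ω); P] = α i ^ 2 := by
  have e : (fun x => inner ℝ (b i) x) ∘ (fun z => μ + diagonalMap b α z)
      = fun z => inner ℝ (b i) μ + (α i • innerSL ℝ (b i)) z := by
    funext z
    simp [inner_add_right, inner_diagonalMap]
  have hm : Measurable fun x => inner ℝ (b i) x := by fun_prop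
  have hd : Measurable fun z => μ + diagonalMap b α z := by fun_prop
  refine ⟨?_, ?_, ?_⟩
  · have h1 : MemLp (fun x => inner ℝ (b i) x) 2 (P.map X) := by
      rw [h, memLp_map_measure_iff hm.aestronglyMeasurable hd.aemeasurable, e]
      exact memLp_affine_stdGaussian _ _
    exact (memLp_map_measure_iff hm.aestronglyMeasurable hX.aemeasurable).1 h1
  · rw [← integral_map (f := fun x => inner ℝ (b i) x) hX.aemeasurable hm.aestronglyMeasurable, h,
      integral_map hd.aemeasurable hm.aestronglyMeasurable]
    exact (congrArg (fun f => ∫ z, f z ∂(stdGaussian E)) e).trans (integral_affine_stdGaussian _ _)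
  · have h1 := variance_map hm.aemeasurable hX.aemeasurable (μ := P)
    rw [h, variance_map hm.aemeasurable hd.aemeasurable, e, variance_affine_stdGaussian] at h1
    rw [norm_smul, innerSL_apply_norm, b.orthonormal.1 i, mul_one, Real.norm_eq_abs, sq_abs] at h1
    exact h1.symm

/-- In each coordinate the second moment of the difference is the squared difference of means plus a
variance of at least `(α i - β i)²`. The shared basis makes this work coordinatewise. -/
lemma le_lintegral_of_coupling (b : OrthonormalBasis ι ℝ E) {μ₁ μ₂ : E} {α β : ι → ℝ}
    (hα : ∀ i, 0 ≤ α i) (hβ : ∀ i, 0 ≤ β i) {g : Measure (E × E)}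
    (h₁ : g.map Prod.fst = (stdGaussian E).map fun z => μ₁ + diagonalMap b α z)
    (h₂ : g.map Prod.snd = (stdGaussian E).map fun z => μ₂ + diagonalMap b β z) :
    ENNReal.ofReal (‖μ₁ - μ₂‖ ^ 2 + ∑ i, (α i - β i) ^ 2) ≤ ∫⁻ z, ‖z.1 - z.2‖ₑ ^ 2 ∂g := by
  have hp : IsProbabilityMeasure (g.map Prod.fst) := by
    rw [h₁]; exact Measure.isProbabilityMeasure_map (by fun_prop)
  have hg : IsProbabilityMeasure g := Measure.isProbabilityMeasure_of_map Prod.fst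
  have hx := fun i => moments_inner_of_map_eq measurable_fst b h₁ i
  have hy := fun i => moments_inner_of_map_eq measurable_snd b h₂ i
  have hi : ∀ i, Integrable (fun z : E × E => inner ℝ (b i) (z.1 - z.2) ^ 2) g := fun i => by
    simp_rw [inner_sub_right]
    exact ((hx i).1.sub (hy i).1).integrable_sq
  have key : ∀ i, inner ℝ (b i) (μ₁ - μ₂) ^ 2 + (α i - β i) ^ 2
      ≤ ∫ z, inner ℝ (b i) (z.1 - z.2) ^ 2 ∂g := fun i => by
    have h1 := sq_sub_le_variance_sub (hx i).1 (hy i).1 (hα i) (hβ i) (hx i).2.2 (hy i).2.2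
    rw [variance_eq_sub ((hx i).1.sub (hy i).1)] at h1
    simp only [Pi.sub_apply, Pi.pow_apply] at h1
    rw [integral_sub ((hx i).1.integrable one_le_two) ((hy i).1.integrable one_le_two),
      (hx i).2.1, (hy i).2.1] at h1
    simp_rw [inner_sub_right]
    linarith
  have e : ∀ z : E × E, ‖z.1 - z.2‖ₑ ^ 2
      = ENNReal.ofReal (∑ i, inner ℝ (b i) (z.1 - z.2) ^ 2) := fun z => by
    rw [b.sum_sq_inner_right, ENNReal.ofReal_pow (norm_nonneg _), ofReal_norm]
  simp_rw [e]
  rw [← ofReal_integral_eq_lintegral_ofReal (integrable_finsetSum _ fun i _ => hi i)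
    (ae_of_all _ fun z => Finset.sum_nonneg fun i _ => sq_nonneg _)]
  refine ENNReal.ofReal_le_ofReal ?_
  rw [integral_finsetSum _ fun i _ => hi i, ← b.sum_sq_inner_right (μ₁ - μ₂),
    ← Finset.sum_add_distrib]
  exact Finset.sum_le_sum fun i _ => key i

end CouplingLowerBound

/-! ### The closed form for Gaussians and the commuting case. -/

section GaussianPFD

variable {n : ℕ} {ι κ : Type*} [Fintype ι] [Fintype κ]

lemma pfdAt_eq_lintegral_stdGaussian {p q : Measure (EuclideanSpace ℝ (Fin n))} {T : ℝ}
    (hT : 0 ≤ T) (hp : Measurable (noiseToImage p T)) (hq : Measurable (noiseToImage q T)) :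
    pfdAt p q T = (∫⁻ z, ‖noiseToImage p T (T • z) - noiseToImage q T (T • z)‖ₑ ^ 2
      ∂(stdGaussian (EuclideanSpace ℝ (Fin n)))) ^ (1 / 2 : ℝ) := by
  rw [pfdAt, multivariateGaussian_zero_smul_one hT, lintegral_map (by fun_prop) (by fun_prop)]

lemma measurable_noiseToImage_map_diagonalMap
    (b : OrthonormalBasis ι ℝ (EuclideanSpace ℝ (Fin n))) {T : ℝ} (hT : 0 < T)
    (μ : EuclideanSpace ℝ (Fin n)) {α : ι → ℝ} (hα : ∀ i, 0 ≤ α i) :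
    Measurable (noiseToImage ((stdGaussian _).map fun z => μ + diagonalMap b α z) T) := by
  have h : noiseToImage ((stdGaussian _).map fun z => μ + diagonalMap b α z) T = fun x =>
      μ + diagonalMap b (fun i => α i / Real.sqrt (α i ^ 2 + T ^ 2)) (x - μ) :=
    funext fun x => noiseToImage_map_diagonalMap b hT μ x hα
  rw [h]
  fun_prop

/-- Dominated convergence in the normalized noise. The two eigenbases are unrelated, so the
covariances need not commute. -/
theorem tendsto_pfdAt_map_diagonalMap (b : OrthonormalBasis ι ℝ (EuclideanSpace ℝ (Fin n)))
    (d : OrthonormalBasis κ ℝ (EuclideanSpace ℝ (Fin n))) (μ₁ μ₂ : EuclideanSpace ℝ (Fin n))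
    {α : ι → ℝ} {β : κ → ℝ} (hα : ∀ i, 0 ≤ α i) (hβ : ∀ i, 0 ≤ β i) :
    Tendsto (fun T : ℝ => pfdAt ((stdGaussian _).map fun z => μ₁ + diagonalMap b α z)
      ((stdGaussian _).map fun z => μ₂ + diagonalMap d β z) T) atTop
      (𝓝 ((∫⁻ z, ‖(μ₁ - μ₂) + (diagonalMap b α - diagonalMap d β) z‖ₑ ^ 2
        ∂(stdGaussian (EuclideanSpace ℝ (Fin n)))) ^ (1 / 2 : ℝ))) := by
  have h1 : Tendsto (fun T : ℝ => (∫⁻ z, ‖noiseToImage ((stdGaussian _).map fun z =>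
      μ₁ + diagonalMap b α z) T (T • z) - noiseToImage ((stdGaussian _).map fun z =>
      μ₂ + diagonalMap d β z) T (T • z)‖ₑ ^ 2 ∂(stdGaussian (EuclideanSpace ℝ (Fin n)))))
      atTop (𝓝 (∫⁻ z, ‖(μ₁ - μ₂) + (diagonalMap b α - diagonalMap d β) z‖ₑ ^ 2
        ∂(stdGaussian (EuclideanSpace ℝ (Fin n))))) := by
    refine tendsto_lintegral_filter_of_dominated_convergence
      (fun z => ‖(2 * ‖μ₁‖ + 2 * ‖μ₂‖) + (∑ i, α i + ∑ i, β i) * ‖z‖‖ₑ ^ 2) ?_ ?_ ?_ ?_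
    · filter_upwards [eventually_gt_atTop 0] with T hT
      have hp := measurable_noiseToImage_map_diagonalMap b hT μ₁ hα
      have hq := measurable_noiseToImage_map_diagonalMap d hT μ₂ hβ
      fun_prop
    · filter_upwards [eventually_gt_atTop 0] with T hT
      refine ae_of_all _ fun z => ?_
      gcongr
      rw [enorm_le_iff_norm_le]
      refine (norm_sub_le _ _).trans (le_trans ?_ (le_abs_self _))
      linarith [norm_noiseToImage_smul_map_diagonalMap_le b hT μ₁ z hα,
        norm_noiseToImage_smul_map_diagonalMap_le d hT μ₂ z hβ]
    · rw [lintegral_enorm_sq_eq_ofReal]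
      · exact ENNReal.ofReal_ne_top
      · exact memLp_add_mul_norm_stdGaussian _ _
    · refine ae_of_all _ fun z => ?_
      have h2 := (tendsto_noiseToImage_smul_map_diagonalMap b μ₁ z hα).sub
        (tendsto_noiseToImage_smul_map_diagonalMap d μ₂ z hβ)
      rw [_root_.sub_apply, sub_add_sub_comm]
      exact (ENNReal.continuous_pow 2).continuousAt.tendsto.comp h2.enorm
  refine ((ENNReal.continuous_rpow_const.tendsto _).comp h1).congr' ?_
  filter_upwards [eventually_gt_atTop 0] with T hT
  rw [pfdAt_eq_lintegral_stdGaussian hT.le (measurable_noiseToImage_map_diagonalMap b hT μ₁ hα)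
    (measurable_noiseToImage_map_diagonalMap d hT μ₂ hβ)]
  rfl

/-- The adjoint maps the standard basis to the rows of `A`. -/
lemma frobeniusNorm_sq (A : Matrix (Fin n) (Fin n) ℝ) :
    frobeniusNorm A ^ 2 = ∑ i, ‖(Matrix.toEuclideanCLM (𝕜 := ℝ) A).adjoint
      (EuclideanSpace.basisFun (Fin n) ℝ i)‖ ^ 2 := by
  have h0 : frobeniusNorm A = (∑ i, ∑ j, ‖A i j‖ ^ (2 : ℝ)) ^ (1 / 2 : ℝ) :=
    Matrix.frobenius_norm_def A
  rw [h0, ← Real.sqrt_eq_rpow, Real.sq_sqrt (by positivity)]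
  refine Finset.sum_congr rfl fun i _ => ?_
  rw [← ContinuousLinearMap.star_eq_adjoint, ← map_star, EuclideanSpace.norm_sq_eq]
  refine Finset.sum_congr rfl fun j _ => ?_
  simp [Matrix.ofLp_toEuclideanCLM, Matrix.star_eq_conjTranspose]

/-- The limiting distance of two Gaussians in terms of the noise. -/
theorem tendsto_pfdAt_multivariateGaussian (μ₁ μ₂ : EuclideanSpace ℝ (Fin n))
    (S₁ S₂ : Matrix (Fin n) (Fin n) ℝ) :
    Tendsto (fun T : ℝ => pfdAt (multivariateGaussian μ₁ S₁) (multivariateGaussian μ₂ S₂) T) atTop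
      (𝓝 ((∫⁻ z, ‖(μ₁ - μ₂) + Matrix.toEuclideanCLM (𝕜 := ℝ) (CFC.sqrt S₁ - CFC.sqrt S₂) z‖ₑ ^ 2
        ∂(stdGaussian (EuclideanSpace ℝ (Fin n)))) ^ (1 / 2 : ℝ))) := by
  obtain ⟨b, α, -, hα, -, h1, -⟩ := exists_toEuclideanCLM_eq_diagonalMap_of_commute
    (CFC.sqrt_nonneg S₁) (CFC.sqrt_nonneg S₁) (Commute.refl _)
  obtain ⟨d, β, -, hβ, -, h2, -⟩ := exists_toEuclideanCLM_eq_diagonalMap_of_commute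
    (CFC.sqrt_nonneg S₂) (CFC.sqrt_nonneg S₂) (Commute.refl _)
  rw [multivariateGaussian, multivariateGaussian, map_sub, h1, h2]
  exact tendsto_pfdAt_map_diagonalMap b d μ₁ μ₂ hα hβ

theorem pfd_multivariateGaussian (μ₁ μ₂ : EuclideanSpace ℝ (Fin n))
    (S₁ S₂ : Matrix (Fin n) (Fin n) ℝ) :
    pfd (multivariateGaussian μ₁ S₁) (multivariateGaussian μ₂ S₂)
      = (∫⁻ z, ‖(μ₁ - μ₂) + Matrix.toEuclideanCLM (𝕜 := ℝ) (CFC.sqrt S₁ - CFC.sqrt S₂) z‖ₑ ^ 2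
        ∂(stdGaussian (EuclideanSpace ℝ (Fin n)))) ^ (1 / 2 : ℝ) :=
  (tendsto_pfdAt_multivariateGaussian μ₁ μ₂ S₁ S₂).liminf_eq

lemma lintegral_enorm_sq_affine_stdGaussian (b : OrthonormalBasis ι ℝ (EuclideanSpace ℝ (Fin n)))
    (a : EuclideanSpace ℝ (Fin n)) (B : EuclideanSpace ℝ (Fin n) →L[ℝ] EuclideanSpace ℝ (Fin n)) :
    ∫⁻ z, ‖a + B z‖ₑ ^ 2 ∂(stdGaussian (EuclideanSpace ℝ (Fin n)))
      = ENNReal.ofReal (‖a‖ ^ 2 + ∑ i, ‖B.adjoint (b i)‖ ^ 2) := by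
  rw [lintegral_enorm_sq_eq_ofReal (memLp_affine_stdGaussian a B),
    integral_norm_sq_affine_stdGaussian b]

theorem pfd_multivariateGaussian_eq_sqrt (μ₁ μ₂ : EuclideanSpace ℝ (Fin n))
    (S₁ S₂ : Matrix (Fin n) (Fin n) ℝ) :
    pfd (multivariateGaussian μ₁ S₁) (multivariateGaussian μ₂ S₂) =
      ENNReal.ofReal (Real.sqrt (‖μ₁ - μ₂‖ ^ 2 +
        frobeniusNorm (CFC.sqrt S₁ - CFC.sqrt S₂) ^ 2)) := by
  rw [pfd_multivariateGaussian, lintegral_enorm_sq_affine_stdGaussian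
    (EuclideanSpace.basisFun (Fin n) ℝ), ← frobeniusNorm_sq,
    ENNReal.ofReal_rpow_of_nonneg (by positivity) (by norm_num), Real.sqrt_eq_rpow]

theorem pfd_le_wasserstein2_of_commute (μ₁ μ₂ : EuclideanSpace ℝ (Fin n))
    {S₁ S₂ : Matrix (Fin n) (Fin n) ℝ} (h : Commute S₁ S₂) :
    pfd (multivariateGaussian μ₁ S₁) (multivariateGaussian μ₂ S₂)
      ≤ wasserstein2 (multivariateGaussian μ₁ S₁) (multivariateGaussian μ₂ S₂) := by
  have hc : Commute (CFC.sqrt S₁) (CFC.sqrt S₂) :=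
    -- The square root is a continuous functional calculus, so it commutes with whatever commutes
    -- with the matrix.
    ((h.cfcₙ_nnreal _).symm.cfcₙ_nnreal _).symm
  obtain ⟨b, α, β, hα, hβ, h1, h2⟩ := exists_toEuclideanCLM_eq_diagonalMap_of_commute
    (CFC.sqrt_nonneg S₁) (CFC.sqrt_nonneg S₂) hc
  have h3 : ∀ i, ‖(diagonalMap b α - diagonalMap b β).adjoint (b i)‖ ^ 2 = (α i - β i) ^ 2 :=
    fun i => by
      have h4 : (diagonalMap b α - diagonalMap b β).adjoint (b i) = (α i - β i) • b i := by
        refine ext_inner_right ℝ fun v => ?_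
        rw [ContinuousLinearMap.adjoint_inner_left, _root_.sub_apply, inner_sub_right,
          inner_diagonalMap, inner_diagonalMap, real_inner_smul_left]
        ring
      rw [h4, norm_smul, b.orthonormal.1 i, mul_one, Real.norm_eq_abs, sq_abs]
  rw [pfd_multivariateGaussian, map_sub, h1, h2, lintegral_enorm_sq_affine_stdGaussian b]
  simp_rw [h3]
  rw [wasserstein2]
  refine le_iInf₂ fun g hg => ENNReal.rpow_le_rpow ?_ (by norm_num)
  have hg1 := hg.1
  have hg2 := hg.2
  rw [multivariateGaussian, h1] at hg1
  rw [multivariateGaussian, h2] at hg2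
  exact le_lintegral_of_coupling b hα hβ hg1 hg2

end GaussianPFD

/-! ### Assembly of the four statements. -/

theorem mainTheorem3 (n : ℕ) :
    -- the probability flow ODE determines the noise-to-image map, for almost every noise vector
    (∀ p : Measure (EuclideanSpace ℝ (Fin n)), IsProbabilityMeasure p → ∀ T : ℝ, 0 < T →
      (∀ᵐ xT ∂(volume : Measure (EuclideanSpace ℝ (Fin n))), ∃ x, IsPFTrajectory p T xT x) ∧
      (∀ xT x y, IsPFTrajectory p T xT x → IsPFTrajectory p T xT y →
        Set.EqOn x y (Set.Icc 0 T))) ∧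
    -- the Wasserstein distance is a lower bound
    (∀ p q : Measure (EuclideanSpace ℝ (Fin n)), IsProbabilityMeasure p → IsProbabilityMeasure q →
      wasserstein2 p q ≤ pfd p q) ∧
    -- the limiting noise-to-image map of a Gaussian, in terms of the normalized noise `ε = x_T / T`
    (∀ (μ : EuclideanSpace ℝ (Fin n)) (S : Matrix (Fin n) (Fin n) ℝ), S.PosSemidef →
      ∀ ε : EuclideanSpace ℝ (Fin n),
        Tendsto (fun T : ℝ => noiseToImage (multivariateGaussian μ S) T (T • ε)) atTop
          (𝓝 (μ + Matrix.toEuclideanCLM (𝕜 := ℝ) (CFC.sqrt S) ε))) ∧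
    -- the closed form for two Gaussians, and equality for commuting covariances
    (∀ (μ₁ μ₂ : EuclideanSpace ℝ (Fin n)) (S₁ S₂ : Matrix (Fin n) (Fin n) ℝ),
      S₁.PosSemidef → S₂.PosSemidef →
        Tendsto (fun T : ℝ => pfdAt (multivariateGaussian μ₁ S₁) (multivariateGaussian μ₂ S₂) T)
          atTop (𝓝 (pfd (multivariateGaussian μ₁ S₁) (multivariateGaussian μ₂ S₂))) ∧
        pfd (multivariateGaussian μ₁ S₁) (multivariateGaussian μ₂ S₂) =
          ENNReal.ofReal (Real.sqrt (‖μ₁ - μ₂‖ ^ 2 +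
            frobeniusNorm (CFC.sqrt S₁ - CFC.sqrt S₂) ^ 2)) ∧
        (S₁ * S₂ = S₂ * S₁ →
          pfd (multivariateGaussian μ₁ S₁) (multivariateGaussian μ₂ S₂) =
            wasserstein2 (multivariateGaussian μ₁ S₁) (multivariateGaussian μ₂ S₂))) := by

  refine ⟨fun p _ T hT => ⟨ae_exists_isPFTrajectory p hT, fun xT x y hx hy =>
    IsPFTrajectory.eqOn hT hx hy⟩, fun p q _ _ => wasserstein2_le_pfd p q, fun μ S _ ε => ?_,
    fun μ₁ μ₂ S₁ S₂ _ _ => ⟨?_, pfd_multivariateGaussian_eq_sqrt μ₁ μ₂ S₁ S₂, fun h =>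
      le_antisymm (pfd_le_wasserstein2_of_commute μ₁ μ₂ h) (wasserstein2_le_pfd _ _)⟩⟩
  · obtain ⟨b, α, -, hα, -, h1, -⟩ := exists_toEuclideanCLM_eq_diagonalMap_of_commute
      (CFC.sqrt_nonneg S) (CFC.sqrt_nonneg S) (Commute.refl _)
    rw [multivariateGaussian, h1]
    exact tendsto_noiseToImage_smul_map_diagonalMap b μ ε hα
  · rw [pfd_multivariateGaussian]
    exact tendsto_pfdAt_multivariateGaussian μ₁ μ₂ S₁ S₂
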